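/- Let $p,q\ge 2$ be integers; write $(p,q)$ for their greatest common divisor and $\langle p,q\rangle$ for their least common multiple. A hypermap on a set $D$ of $n\ge 1$ darts is a pair of permutations $\alpha,\sigma$ of $D$ generating a transitive group; put $\varphi=\sigma^{-1}\alpha^{-1}$ (permutations are multiplied from left to right). It is a $(p,q)$-hypermap if all cycles of $\alpha$ have length $p$ and all cycles of $\varphi$ have length $q$. Two hypermaps on $D$ are isomorphic if some permutation $\psi$ of $D$ conjugates $(\alpha_1,\sigma_1)$ to $(\alpha_2,\sigma_2)$; a rooted hypermap has a marked dart, which isomorphisms have to preserve. Let $|\mathfrak H_{p,q}(n)|$ and $|\mathfrak H^r_{p,q}(n)|$ be the numbers of isomorphism classes of $(p,q)$-hypermaps and of rooted $(p,q)$-hypermaps on $n$ darts (both are $0$ for $n=0$), and let $\widetilde H(z)=\sum_{n\ge 0}|\mathfrak H_{p,q}(n)|\,z^n$. (i) As formal power series over $\mathbb Q$ (with coefficientwise convergence), $$\widetilde H(z)=\sum_{k=1}^\infty\frac{\mu(k)}{k}\sum_{n=1}^\infty \log(P_n\odot Q_n)(z_n)\big|_{z_n=z^{nk}},$$ where $\mu$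 is the Möbius function, $\phi$ is the Euler totient function, $$P_n(z_n)=\exp\Big(\frac1{np}\sum_{d\mid (n,p)}d\,\phi(d)\,z_n^{p/d}\Big),\qquad Q_n(z_n)=\exp\Big(\frac1{nq}\sum_{d\mid (n,q)}d\,\phi(d)\,z_n^{q/d}\Big),$$ and $\odot$ is the Hadamard product of series in $z_n$: $$\Big(\sum_{j\ge0} a_j\frac{z_n^j}{n^j j!}\Big)\odot\Big(\sum_{j\ge0} b_j\frac{z_n^j}{n^j j!}\Big)=\sum_{j\ge0} a_jb_j\frac{z_n^j}{n^j j!}.$$ (ii) $|\mathfrak H_{p,q}(n)|=0$ unless $\langle p,q\rangle$ divides $n$. If moreover $pq\ge 6$, then, where $\sim$ means that the ratio tends to $1$ (terms with both sides $0$ being disregarded), $$|\mathfrak H_{p,q}(n)|\sim\frac1n\,|\mathfrak H^r_{p,q}(n)|\quad (n\to\infty),\qquad [z^{\langle p,q\rangle k}]\widetilde H(z)\sim C\,k^{(N-1)k-c_0}\,e^{c_1k}\quad(k\to\infty),$$ with the following constants, which depend only on $p$ and $q$: $$N=1+\frac{(p-1)(q-1)-1}{(p,q)},\quad C=\frac{(2\pi)^{(N-1)/2}}{\prod_i\Gamma(a_i)}>0,\quad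 c_0=\frac{N+1}2-\sum_i a_i,\quad c_1=1+\log c-N,$$ where $c>0$ is given by $c^{(p,q)}=\langle p,q\rangle^{(p-1)(q-1)-1}$, and $a_i=\frac{i\,(p,q)}{pq}$ with $i$ ranging over the integers $1\le i\le\frac{pq}{(p,q)}-1$ such that $p\nmid i$ and $q\nmid i$. -/

import Mathlib

open Filter Asymptotics
open scoped PowerSeries PowerSeries.WithPiTopology

/-- A (connected, oriented, labelled) combinatorial hypermap with set of darts `D`: a pair of
permutations `α`, `σ` of the nonempty set `D` that together generate a transitive group. -/
@[ext]
structure Hypermap (D : Type*) where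
  α : Equiv.Perm D
  σ : Equiv.Perm D
  nonempty : Nonempty D
  transitive : MulAction.IsPretransitive (Subgroup.closure ({α, σ} : Set (Equiv.Perm D))) D

namespace Hypermap

variable {D : Type*}

/-- The permutation whose orbits are the hyper-faces, `φ = σ⁻¹ α⁻¹` with permutations multiplied
from left to right (first apply `σ⁻¹`, then `α⁻¹`); Mathlib multiplies them from right to left. -/
def φ (H : Hypermap D) : Equiv.Perm D := H.α⁻¹ * H.σ⁻¹

/-- `H` is a `(p, q)`-hypermap: every dart lies on a cycle of `α` of length exactly `p` and on a
cycle of `φ` of length exactly `q`. -/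
def IsPQ (p q : ℕ) (H : Hypermap D) : Prop :=
  (∀ x, Function.minimalPeriod H.α x = p) ∧ (∀ x, Function.minimalPeriod H.φ x = q)

/-- `ψ` is an isomorphism from the hypermap `H₁` to the hypermap `H₂`. -/
def IsIso (ψ : Equiv.Perm D) (H₁ H₂ : Hypermap D) : Prop :=
  ψ * H₁.α * ψ⁻¹ = H₂.α ∧ ψ * H₁.σ * ψ⁻¹ = H₂.σ

theorem IsIso.one (H : Hypermap D) : IsIso 1 H H := by simp [IsIso]

theorem IsIso.inv {ψ : Equiv.Perm D} {H₁ H₂ : Hypermap D} (h : IsIso ψ H₁ H₂) :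
    IsIso ψ⁻¹ H₂ H₁ := by
  obtain ⟨h1, h2⟩ := h
  constructor
  · rw [← h1]; group
  · rw [← h2]; group

theorem IsIso.mul {ψ χ : Equiv.Perm D} {H₁ H₂ H₃ : Hypermap D} (h : IsIso ψ H₁ H₂)
    (k : IsIso χ H₂ H₃) : IsIso (χ * ψ) H₁ H₃ := by
  obtain ⟨h1, h2⟩ := h
  obtain ⟨k1, k2⟩ := k
  constructor
  · rw [← k1, ← h1]; group
  · rw [← k2, ← h2]; group

instance [Finite D] : Finite (Hypermap D) :=
  Finite.of_injective (fun H : Hypermap D => (H.α, H.σ)) fun H₁ H₂ h => by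
    simp only [Prod.mk.injEq] at h
    exact Hypermap.ext h.1 h.2

end Hypermap

/-- Labelled `(p, q)`-hypermaps on `n` darts. -/
abbrev PQHypermap (p q n : ℕ) : Type := {H : Hypermap (Fin n) // H.IsPQ p q}

/-- Isomorphism of (unrooted) `(p, q)`-hypermaps on `n` darts. -/
def pqIsoSetoid (p q n : ℕ) : Setoid (PQHypermap p q n) where
  r H₁ H₂ := ∃ ψ : Equiv.Perm (Fin n), Hypermap.IsIso ψ H₁.1 H₂.1
  iseqv :=
    { refl := fun H => ⟨1, .one H.1⟩
      symm := fun ⟨ψ, h⟩ => ⟨ψ⁻¹, h.inv⟩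
      trans := fun ⟨ψ, h⟩ ⟨χ, k⟩ => ⟨χ * ψ, h.mul k⟩ }

/-- Isomorphism of rooted `(p, q)`-hypermaps on `n` darts; a rooted hypermap is a hypermap with a
marked dart, and an isomorphism has to send the root to the root. -/
def pqRootedIsoSetoid (p q n : ℕ) : Setoid (PQHypermap p q n × Fin n) where
  r H₁ H₂ := ∃ ψ : Equiv.Perm (Fin n), Hypermap.IsIso ψ H₁.1.1 H₂.1.1 ∧ ψ H₁.2 = H₂.2
  iseqv :=
    { refl := fun H => ⟨1, .one H.1.1, rfl⟩
      symm := fun ⟨ψ, h, e⟩ => ⟨ψ⁻¹, h.inv, by rw [← e]; simp⟩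
      trans := fun ⟨ψ, h, e⟩ ⟨χ, k, f⟩ => ⟨χ * ψ, h.mul k, by rw [← f, ← e]; rfl⟩ }

/-- The number of isomorphism classes of `(p, q)`-hypermaps on `n` darts. -/
noncomputable def numIsoClasses (p q n : ℕ) : ℕ := Nat.card (Quotient (pqIsoSetoid p q n))

/-- The number of (isomorphism classes of) rooted `(p, q)`-hypermaps on `n` darts. -/
noncomputable def numRooted (p q n : ℕ) : ℕ := Nat.card (Quotient (pqRootedIsoSetoid p q n))

/-- The growth series of the number of isomorphism classes of `(p, q)`-hypermaps. -/
noncomputable def isoSeries (p q : ℕ) : ℚ⟦X⟧ := PowerSeries.mk fun n => (numIsoClasses p q n : ℚ)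

/-- The series `exp ((1 / (n p)) ∑_{d ∣ gcd(n, p)} d φ(d) z_n ^ (p / d))` in the variable `z_n`. -/
noncomputable def cycleFactor (p n : ℕ) : ℚ⟦X⟧ :=
  (PowerSeries.exp ℚ).subst
    (PowerSeries.C (1 / ((n : ℚ) * p)) *
      ∑ d ∈ (n.gcd p).divisors,
        PowerSeries.C ((d : ℚ) * d.totient) * (PowerSeries.X : ℚ⟦X⟧) ^ (p / d))

/-- The Hadamard product `A ⊙ B` of two series in the variable `z_n`. The product of
`∑_λ a_λ z^λ / λ!` and `∑_λ b_λ z^λ / λ!` is `∑_λ a_λ b_λ z^λ / λ!`, where `λ! = ∏ i^(n_i) n_i!` for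
the partition `λ` with `n_i` parts `i`. For the partition `λ` with `k` parts, all equal to `n`, one
has `z^λ = z_n ^ k` and `λ! = n ^ k * k!`. -/
noncomputable def hadamard (n : ℕ) (A B : ℚ⟦X⟧) : ℚ⟦X⟧ :=
  PowerSeries.mk fun k =>
    let w : ℚ := (n : ℚ) ^ k * k.factorial
    (PowerSeries.coeff k A * w) * (PowerSeries.coeff k B * w) / w

/-- The constant `N = 1 + ((p - 1)(q - 1) - 1) / gcd(p, q)`. -/
noncomputable def growthN (p q : ℕ) : ℝ :=
  1 + (((p : ℝ) - 1) * ((q : ℝ) - 1) - 1) / (p.gcd q : ℝ)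

/-- The indices `1 ≤ i ≤ pq / gcd(p, q) - 1` with `p ∤ i` and `q ∤ i`. -/
def growthIndices (p q : ℕ) : Finset ℕ :=
  (Finset.Ico 1 (p * q / p.gcd q)).filter fun i => ¬ p ∣ i ∧ ¬ q ∣ i

/-- The numbers `a_i = i gcd(p, q) / (pq)`. -/
noncomputable def growthA (p q i : ℕ) : ℝ := (i : ℝ) * (p.gcd q : ℝ) / ((p : ℝ) * q)

/-- The positive real `c` with `c ^ gcd(p, q) = lcm(p, q) ^ ((p - 1)(q - 1) - 1)`. -/
noncomputable def growthBase (p q : ℕ) : ℝ :=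
  (p.lcm q : ℝ) ^ ((((p : ℝ) - 1) * ((q : ℝ) - 1) - 1) / (p.gcd q : ℝ))

/-- `C = (2π) ^ ((N - 1) / 2) / ∏_i Γ(a_i)`. -/
noncomputable def growthC (p q : ℕ) : ℝ :=
  (2 * Real.pi) ^ ((growthN p q - 1) / 2) / ∏ i ∈ growthIndices p q, Real.Gamma (growthA p q i)

/-- `c₀ = (N + 1) / 2 - ∑_i a_i`. -/
noncomputable def growthC0 (p q : ℕ) : ℝ :=
  (growthN p q + 1) / 2 - ∑ i ∈ growthIndices p q, growthA p q i

/-- `c₁ = 1 + log c - N`. -/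
noncomputable def growthC1 (p q : ℕ) : ℝ := 1 + Real.log (growthBase p q) - growthN p q

/-!
A `(p, q)`-hypermap on `n` darts is a transitive pair `(α, φ)` of permutations all of whose cycles
have length `p`, respectively `q`: a transitive permutation representation of the free group `F` on
two generators with a condition on the point stabilizers. Adding a third permutation that commutes
with both gives representations of `F × ℤ` (`FreeByZ Bool`), and everything is obtained by counting
these in two ways.

*Counting by orbits.* For a set `𝓢` of subgroups of a group `Γ` closed under conjugation, let
`f n` be the number of representations on `n` points with all stabilizers in `𝓢`, divided by `n!`,
and let `s n` be the number of subgroups of index `n` in `𝓢`. Sorting pointed representations by the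
orbit of the marked point gives `n f n = ∑ s k f (n - k)` (`mul_actDensity`), that is,
`log f = ∑ s n zⁿ / n`.

*Counting by the central permutation.* If all cycles of the central permutation `ψ` have length `i`,
the other generators are independent elements of the centralizer of `ψ`, so the densities for
several generators are Hadamard products of those for a single generator
(`actDensity_mul_weight`). For one generator the group is `ℤ × ℤ`, whose subgroups are counted
directly (`numSubgroups_unit`), and the orbit recurrence identifies the density with the coefficients
of `P_i` (`coeff_cycleFactor`). Hence the coefficients of `log (P_i ⊙ Q_i)` count the subgroups of
`F × ℤ` modulo which the central generator has order `i` (`coeff_logOf_hadamard`).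

*The growth series.* By Burnside's lemma, `n` times the number of isomorphism classes on `n` darts is
the number of admissible subgroups of index `n` that project onto `ℤ` (`mul_numIsoClasses`). Every
subgroup of finite index projects onto some `d ℤ`, and rescaling `ℤ` turns it into a subgroup of
index `n / d` projecting onto `ℤ` (`numSubgroups_admSet`). Möbius inversion over `d` yields the
formula for the growth series.

*Asymptotics.* Rooted hypermaps correspond to the subgroups that contain the central generator. The
recurrence for the coefficients of `P_i` shows that they are at most `(k!) ^ (-1 / p)`
(`actDensity_unit_le`), whence the subgroups in which the central generator has order `i ≥ 2`, that
is, the hypermaps with a nontrivial automorphism, are negligible (`numIsoClasses_sub_le`). The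
density `pqDensity p q (lcm p q * k)` satisfies a hypergeometric recurrence with parameters `a_i`
(`pqDensity_lcm_succ`); its ratios increase at least linearly, so disconnected pairs are negligible
as well (`sum_convolution_le`, `numRooted_isEquivalent`), and Euler's limit formula for the Gamma
function together with Stirling's formula give the asymptotic form
(`pqDensity_lcm_isEquivalent`).
-/

/-! ### Counting permutation representations with prescribed point stabilizers -/

section Actions

variable {Γ D R : Type} [Group Γ]

/-- The stabilizer of the point `x` under the permutation representation `ρ`. -/
def homStab (ρ : Γ →* Equiv.Perm D) (x : D) : Subgroup Γ :=
  (MulAction.stabilizer (Equiv.Perm D) x).comap ρ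

@[simp]
theorem mem_homStab {ρ : Γ →* Equiv.Perm D} {x : D} {g : Γ} : g ∈ homStab ρ x ↔ ρ g x = x :=
  Iff.rfl

/-- The permutation representations of `Γ` on `D` all of whose point stabilizers belong to `𝓢`. -/
def Act (𝓢 : Set (Subgroup Γ)) (D : Type) : Type :=
  {ρ : Γ →* Equiv.Perm D // ∀ x, homStab ρ x ∈ 𝓢}

/-- The set `𝓢` of subgroups is closed under conjugation. -/
def ConjClosed (𝓢 : Set (Subgroup Γ)) : Prop :=
  ∀ K ∈ 𝓢, ∀ g : Γ, K.map (MulAut.conj g).toMonoidHom ∈ 𝓢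

/-- The number of subgroups of index `k` in `𝓢`. -/
noncomputable def numSubgroups (𝓢 : Set (Subgroup Γ)) (k : ℕ) : ℕ :=
  Nat.card {K : Subgroup Γ // K ∈ 𝓢 ∧ K.index = k}

/-- The number of permutation representations on `n` points with all stabilizers in `𝓢`. -/
noncomputable def numActs (𝓢 : Set (Subgroup Γ)) (n : ℕ) : ℕ := Nat.card (Act 𝓢 (Fin n))

theorem mem_map_conj {K : Subgroup Γ} {g h : Γ} :
    h ∈ K.map (MulAut.conj g).toMonoidHom ↔ g⁻¹ * h * g ∈ K := by
  constructor
  · rintro ⟨k, hk, rfl⟩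
    simpa [mul_assoc] using hk
  · intro hk
    exact ⟨_, hk, by simp [mul_assoc]⟩

/-- Transport of a permutation representation along a bijection. -/
def transportHom (E : D ≃ R) (ρ : Γ →* Equiv.Perm D) : Γ →* Equiv.Perm R :=
  E.permCongrHom.toMonoidHom.comp ρ

@[simp]
theorem transportHom_apply (E : D ≃ R) (ρ : Γ →* Equiv.Perm D) (g : Γ) (y : R) :
    transportHom E ρ g y = E (ρ g (E.symm y)) := rfl

theorem homStab_transportHom (E : D ≃ R) (ρ : Γ →* Equiv.Perm D) (y : R) :
    homStab (transportHom E ρ) y = homStab ρ (E.symm y) := by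
  ext g
  simp [← Equiv.eq_symm_apply]

/-- Bijective sets carry the same number of representations. -/
def Act.congr (𝓢 : Set (Subgroup Γ)) (E : D ≃ R) : Act 𝓢 D ≃ Act 𝓢 R where
  toFun ρ := ⟨transportHom E ρ.1, fun x => by rw [homStab_transportHom]; exact ρ.2 _⟩
  invFun ρ := ⟨transportHom E.symm ρ.1, fun x => by rw [homStab_transportHom]; exact ρ.2 _⟩
  left_inv ρ := Subtype.ext (by ext; simp)
  right_inv ρ := Subtype.ext (by ext; simp)

theorem card_act [Finite D] (𝓢 : Set (Subgroup Γ)) : Nat.card (Act 𝓢 D) = numActs 𝓢 (Nat.card D) :=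
  Nat.card_congr (Act.congr 𝓢 (Finite.equivFin D))

theorem homStab_toPermHom (K : Subgroup Γ) (g : Γ) :
    homStab (MulAction.toPermHom Γ (Γ ⧸ K)) (g : Γ ⧸ K)
      = K.map (MulAut.conj g).toMonoidHom := by
  ext h
  rw [mem_map_conj, mem_homStab]
  change ((h * g : Γ) : Γ ⧸ K) = g ↔ _
  rw [eq_comm, QuotientGroup.eq, mul_assoc]

/-- The representation on a disjoint union of the coset space of `K` and of a set `R`. -/
def glueHom (K : Subgroup Γ) (ρ : Γ →* Equiv.Perm R) : Γ →* Equiv.Perm ((Γ ⧸ K) ⊕ R) :=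
  (Equiv.Perm.sumCongrHom _ _).comp ((MulAction.toPermHom Γ (Γ ⧸ K)).prod ρ)

@[simp]
theorem glueHom_inl (K : Subgroup Γ) (ρ : Γ →* Equiv.Perm R) (g : Γ) (c : Γ ⧸ K) :
    glueHom K ρ g (Sum.inl c) = Sum.inl (g • c) := rfl

@[simp]
theorem glueHom_inr (K : Subgroup Γ) (ρ : Γ →* Equiv.Perm R) (g : Γ) (r : R) :
    glueHom K ρ g (Sum.inr r) = Sum.inr (ρ g r) := rfl

theorem homStab_glueHom_mem {𝓢 : Set (Subgroup Γ)} (h𝓢 : ConjClosed 𝓢) {K : Subgroup Γ}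
    (hK : K ∈ 𝓢) (ρ : Act 𝓢 R) (x : (Γ ⧸ K) ⊕ R) : homStab (glueHom K ρ.1) x ∈ 𝓢 := by
  rcases x with c | r
  · induction c using QuotientGroup.induction_on with
    | H g =>
      convert h𝓢 K hK g using 1
      rw [← homStab_toPermHom]
      ext h
      simp
  · convert ρ.2 r using 1
    ext h
    simp

/-- Every representation on `(Γ ⧸ K) ⊕ R` which is the standard one on `Γ ⧸ K` is glued from the
standard one and a unique representation on `R`. -/
theorem bijective_glueHom [Finite R] {𝓢 : Set (Subgroup Γ)} (h𝓢 : ConjClosed 𝓢) {K : Subgroup Γ}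
    [Finite (Γ ⧸ K)] (hK : K ∈ 𝓢) (E : (Γ ⧸ K) ⊕ R ≃ D) :
    Function.Bijective (fun ρ : Act 𝓢 R =>
      (⟨⟨transportHom E (glueHom K ρ.1), fun x => by
          rw [homStab_transportHom]; exact homStab_glueHom_mem h𝓢 hK ρ _⟩, by simp⟩ :
        {ρ : Act 𝓢 D // ∀ g c, ρ.1 g (E (Sum.inl c)) = E (Sum.inl (g • c))})) := by
  constructor
  · intro ρ₁ ρ₂ h
    have h' : ∀ g x, transportHom E (glueHom K ρ₁.1) g x = transportHom E (glueHom K ρ₂.1) g x := by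
      intro g x
      exact DFunLike.congr_fun (DFunLike.congr_fun (congrArg (fun z => z.1.1) h) g) x
    refine Subtype.ext (MonoidHom.ext fun g => Equiv.ext fun r => ?_)
    have := h' g (E (Sum.inr r))
    simpa using this
  · rintro ⟨ρ, hρ⟩
    set τ := transportHom E.symm ρ.1 with hτ
    have hrange : ∀ g, τ g ∈ (Equiv.Perm.sumCongrHom (Γ ⧸ K) R).range := by
      intro g
      apply Equiv.Perm.mem_sumCongrHom_range_of_perm_mapsTo_inl
      rintro _ ⟨c, rfl⟩
      exact ⟨g • c, by simp [hτ, hρ]⟩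
    let τ' : Γ →* Equiv.Perm (Γ ⧸ K) × Equiv.Perm R :=
      (MonoidHom.ofInjective
        (Equiv.Perm.sumCongrHom_injective (α := Γ ⧸ K) (β := R))).symm.toMonoidHom.comp
          (τ.codRestrict _ hrange)
    have hτ' : ∀ g, Equiv.Perm.sumCongrHom _ _ (τ' g) = τ g := fun g =>
      MonoidHom.apply_ofInjective_symm Equiv.Perm.sumCongrHom_injective ⟨τ g, hrange g⟩
    have hr : ∀ g r, ρ.1 g (E (Sum.inr r)) = E (Sum.inr ((τ' g).2 r)) := by
      intro g r
      have : τ g (Sum.inr r) = Sum.inr ((τ' g).2 r) := by rw [← hτ']; rfl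
      rw [← this]
      simp [hτ]
    refine ⟨⟨(MonoidHom.snd _ _).comp τ', fun r => ?_⟩, ?_⟩
    · convert ρ.2 (E (Sum.inr r)) using 1
      ext g
      simp [hr]
    · refine Subtype.ext (Subtype.ext (MonoidHom.ext fun g => Equiv.ext fun y => ?_))
      obtain ⟨x, rfl⟩ := E.surjective y
      rcases x with c | r
      · simp [hρ]
      · simp [hr]

/-- The number of representations extending a given embedding of a coset space. -/
theorem card_extensions [Finite D] {𝓢 : Set (Subgroup Γ)} (h𝓢 : ConjClosed 𝓢) {K : Subgroup Γ}
    [Finite (Γ ⧸ K)] (hK : K ∈ 𝓢) (e : (Γ ⧸ K) ↪ D) :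
    Nat.card {ρ : Act 𝓢 D // ∀ g c, ρ.1 g (e c) = e (g • c)}
      = numActs 𝓢 (Nat.card D - K.index) := by
  classical
  let E : (Γ ⧸ K) ⊕ ((Set.range e)ᶜ : Set D) ≃ D :=
    (Equiv.sumCongr (Equiv.ofInjective e e.injective) (Equiv.refl _)).trans
      (Equiv.Set.sumCompl (Set.range e))
  have hE : ∀ c, E (Sum.inl c) = e c := fun c => rfl
  have hcard : Nat.card D = K.index + Nat.card ((Set.range e)ᶜ : Set D) := by
    rw [← Nat.card_congr E, Nat.card_sum, Subgroup.index]
  rw [hcard, Nat.add_sub_cancel_left, ← card_act]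
  exact (Nat.card_congr (Equiv.ofBijective _ (bijective_glueHom h𝓢 hK E))).symm

/-- A pointed representation amounts to a subgroup `K` (the stabilizer of the point), an embedding
of the coset space of `K` (the orbit of the point), and a representation extending it. -/
theorem bijective_pointed (𝓢 : Set (Subgroup Γ)) (k : ℕ) :
    Function.Bijective (fun z : Σ K : {K : Subgroup Γ // K ∈ 𝓢 ∧ K.index = k}, Σ e : (Γ ⧸ K.1) ↪ D,
        {ρ : Act 𝓢 D // ∀ g c, ρ.1 g (e c) = e (g • c)} =>
      (⟨(z.2.2.1, z.2.1 ((1 : Γ) : Γ ⧸ z.1.1)), by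
        obtain ⟨⟨K, hK, hk⟩, e, ρ, hρ⟩ := z
        suffices homStab ρ.1 (e ((1 : Γ) : Γ ⧸ K)) = K by rw [this]; exact hk
        ext g
        rw [mem_homStab, hρ, e.injective.eq_iff]
        change ((g * 1 : Γ) : Γ ⧸ K) = (1 : Γ) ↔ _
        rw [eq_comm, QuotientGroup.eq]
        simp⟩ :
        {w : Act 𝓢 D × D // (homStab w.1.1 w.2).index = k})) := by
  constructor
  · rintro ⟨⟨K₁, h₁, i₁⟩, e₁, ρ₁, r₁⟩ ⟨⟨K₂, h₂, i₂⟩, e₂, ρ₂, r₂⟩ h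
    simp only [Subtype.mk.injEq, Prod.mk.injEq] at h
    obtain ⟨rfl, hx⟩ := h
    have key : ∀ (K : Subgroup Γ) (e : (Γ ⧸ K) ↪ D), (∀ g c, ρ₁.1 g (e c) = e (g • c)) →
        homStab ρ₁.1 (e ((1 : Γ) : Γ ⧸ K)) = K := by
      intro K e he
      ext g
      rw [mem_homStab, he, e.injective.eq_iff]
      change ((g * 1 : Γ) : Γ ⧸ K) = (1 : Γ) ↔ _
      rw [eq_comm, QuotientGroup.eq]
      simp
    have hK : K₁ = K₂ := by rw [← key K₁ e₁ r₁, ← key K₂ e₂ r₂, hx]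
    subst hK
    have he : e₁ = e₂ := by
      ext c
      induction c using QuotientGroup.induction_on with
      | H g =>
        have a₁ := r₁ g ((1 : Γ) : Γ ⧸ K₁)
        have a₂ := r₂ g ((1 : Γ) : Γ ⧸ K₁)
        rw [hx, a₂] at a₁
        have hg : g • ((1 : Γ) : Γ ⧸ K₁) = (g : Γ ⧸ K₁) := by
          change ((g * 1 : Γ) : Γ ⧸ K₁) = _
          rw [mul_one]
        rw [hg] at a₁
        exact a₁.symm
    subst he
    rfl
  · rintro ⟨⟨ρ, x⟩, hk⟩
    let K := homStab ρ.1 x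
    let f : Γ ⧸ K → D := Quotient.lift (fun g => ρ.1 g x) (by
      intro a b hab
      have : a⁻¹ * b ∈ K := QuotientGroup.leftRel_apply.mp hab
      have h2 : ρ.1 (a⁻¹ * b) x = x := this
      simp only [map_mul, map_inv, Equiv.Perm.mul_apply, Equiv.Perm.inv_eq_iff_eq] at h2
      exact h2.symm)
    have hf : ∀ g : Γ, f (g : Γ ⧸ K) = ρ.1 g x := fun g => rfl
    have hinj : Function.Injective f := by
      intro a b
      induction a using QuotientGroup.induction_on with
      | H a =>
        induction b using QuotientGroup.induction_on with
        | H b =>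
          intro hab
          rw [hf, hf] at hab
          rw [QuotientGroup.eq]
          change ρ.1 (a⁻¹ * b) x = x
          simp only [map_mul, map_inv, Equiv.Perm.mul_apply, Equiv.Perm.inv_eq_iff_eq]
          exact hab.symm
    refine ⟨⟨⟨K, ρ.2 x, hk⟩, ⟨f, hinj⟩, ⟨ρ, ?_⟩⟩, ?_⟩
    · intro g c
      induction c using QuotientGroup.induction_on with
      | H a =>
        change ρ.1 g (ρ.1 a x) = ρ.1 (g * a) x
        simp
    · refine Subtype.ext (Prod.ext rfl ?_)
      change ρ.1 1 x = x
      simp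

theorem index_homStab (ρ : Γ →* Equiv.Perm D) (x : D) :
    (homStab ρ x).index = Nat.card (Set.range fun g => ρ g x) := by
  let : MulAction Γ D := MulAction.compHom D ρ
  exact MulAction.index_stabilizer Γ x

theorem finite_quotient_of_index {K : Subgroup Γ} {k : ℕ} (hk : k ≠ 0) (h : K.index = k) :
    Finite (Γ ⧸ K) :=
  Nat.finite_of_card_ne_zero (h.trans_ne hk)

theorem numActs_zero (𝓢 : Set (Subgroup Γ)) : numActs 𝓢 0 = 1 := by
  rw [numActs, Nat.card_eq_one_iff_unique]
  refine ⟨⟨fun a b => Subtype.ext (MonoidHom.ext fun g => Subsingleton.elim _ _)⟩,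
    ⟨⟨1, fun x => x.elim0⟩⟩⟩

/-- The number of representations on `n` points divided by `n!`. -/
noncomputable def actDensity (𝓢 : Set (Subgroup Γ)) (n : ℕ) : ℚ :=
  (numActs 𝓢 n : ℚ) / n.factorial

theorem actDensity_zero (𝓢 : Set (Subgroup Γ)) : actDensity 𝓢 0 = 1 := by
  simp [actDensity, numActs_zero]

theorem actDensity_nonneg (𝓢 : Set (Subgroup Γ)) (n : ℕ) : 0 ≤ actDensity 𝓢 n := by
  rw [actDensity]; positivity

variable [∀ n, Finite (Γ →* Equiv.Perm (Fin n))]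

instance finite_act (𝓢 : Set (Subgroup Γ)) (n : ℕ) : Finite (Act 𝓢 (Fin n)) :=
  Subtype.finite

/-- A group with finitely many permutation representations in each degree has finitely many
subgroups of each positive index. -/
theorem finite_subgroups_index (𝓢 : Set (Subgroup Γ)) {k : ℕ} (hk : k ≠ 0) :
    Finite {K : Subgroup Γ // K ∈ 𝓢 ∧ K.index = k} := by
  refine Finite.of_surjective
    (fun z : {w : (Γ →* Equiv.Perm (Fin k)) × Fin k //
        homStab w.1 w.2 ∈ 𝓢 ∧ (homStab w.1 w.2).index = k} =>
      (⟨homStab z.1.1 z.1.2, z.2⟩ : {K : Subgroup Γ // K ∈ 𝓢 ∧ K.index = k})) ?_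
  rintro ⟨K, hK, hi⟩
  have := finite_quotient_of_index hk hi
  let E : Γ ⧸ K ≃ Fin k := Finite.equivFinOfCardEq hi
  have h : homStab (transportHom E (MulAction.toPermHom Γ (Γ ⧸ K))) (E ((1 : Γ) : Γ ⧸ K)) = K := by
    rw [homStab_transportHom, Equiv.symm_apply_apply, homStab_toPermHom]
    ext g
    rw [mem_map_conj]
    simp
  exact ⟨⟨(transportHom E (MulAction.toPermHom Γ (Γ ⧸ K)), E ((1 : Γ) : Γ ⧸ K)), by
    rw [h]; exact ⟨hK, hi⟩⟩, Subtype.ext h⟩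

theorem card_pointed_index {𝓢 : Set (Subgroup Γ)} (h𝓢 : ConjClosed 𝓢) (n : ℕ) {k : ℕ}
    (hk : k ≠ 0) :
    Nat.card {w : Act 𝓢 (Fin n) × Fin n // (homStab w.1.1 w.2).index = k}
      = numSubgroups 𝓢 k * (n.descFactorial k * numActs 𝓢 (n - k)) := by
  classical
  have := finite_subgroups_index 𝓢 hk
  have hfin : ∀ K : {K : Subgroup Γ // K ∈ 𝓢 ∧ K.index = k}, Finite (Γ ⧸ K.1) :=
    fun K => finite_quotient_of_index hk K.2.2
  have := Fintype.ofFinite {K : Subgroup Γ // K ∈ 𝓢 ∧ K.index = k}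
  have : ∀ K : {K : Subgroup Γ // K ∈ 𝓢 ∧ K.index = k}, Fintype (Γ ⧸ K.1) :=
    fun K => Fintype.ofFinite _
  rw [← Nat.card_congr (Equiv.ofBijective _ (bijective_pointed (D := Fin n) 𝓢 k)), Nat.card_sigma]
  have h1 : ∀ K : {K : Subgroup Γ // K ∈ 𝓢 ∧ K.index = k},
      Nat.card (Σ e : (Γ ⧸ K.1) ↪ Fin n,
        {ρ : Act 𝓢 (Fin n) // ∀ g c, ρ.1 g (e c) = e (g • c)})
        = n.descFactorial k * numActs 𝓢 (n - k) := by
    intro K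
    rw [Nat.card_sigma]
    simp_rw [card_extensions h𝓢 K.2.1]
    rw [Finset.sum_const, Finset.card_univ, Fintype.card_embedding_eq, smul_eq_mul,
      Fintype.card_fin, ← Nat.card_eq_fintype_card, Nat.card_eq_fintype_card (α := Fin n),
      Fintype.card_fin]
    have : Nat.card (Γ ⧸ K.1) = k := K.2.2
    rw [this, K.2.2]
  simp_rw [h1]
  rw [Finset.sum_const, Finset.card_univ, smul_eq_mul, numSubgroups, Nat.card_eq_fintype_card]

/-- Sorting pointed representations by the size of the orbit of the marked point. -/
theorem mul_numActs {𝓢 : Set (Subgroup Γ)} (h𝓢 : ConjClosed 𝓢) (n : ℕ) :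
    n * numActs 𝓢 n
      = ∑ k ∈ Finset.Icc 1 n, numSubgroups 𝓢 k * (n.descFactorial k * numActs 𝓢 (n - k)) := by
  classical
  have := Fintype.ofFinite (Act 𝓢 (Fin n))
  have h : ∀ w ∈ (Finset.univ : Finset (Act 𝓢 (Fin n) × Fin n)),
      (homStab w.1.1 w.2).index ∈ Finset.Icc 1 n := by
    intro w _
    rw [index_homStab, Finset.mem_Icc]
    refine ⟨?_, ?_⟩
    · have : Nonempty (Set.range fun g => w.1.1 g w.2) := ⟨⟨_, 1, rfl⟩⟩
      exact Nat.card_pos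
    · calc _ ≤ Nat.card (Fin n) := Nat.card_le_card_of_injective _ Subtype.val_injective
        _ = n := by simp
  have h2 := Finset.card_eq_sum_card_fiberwise h
  rw [Finset.card_univ, Fintype.card_prod, Fintype.card_fin, mul_comm,
    ← Nat.card_eq_fintype_card (α := Act 𝓢 (Fin n))] at h2
  rw [numActs, h2]
  refine Finset.sum_congr rfl fun k hk => ?_
  rw [Finset.mem_Icc] at hk
  rw [← card_pointed_index h𝓢 n (by omega), Nat.card_eq_fintype_card, Fintype.card_subtype]

/-- The number of transitive representations. -/
theorem mul_card_transitive {𝓢 : Set (Subgroup Γ)} (h𝓢 : ConjClosed 𝓢) {n : ℕ} (hn : n ≠ 0) :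
    n * Nat.card {ρ : Act 𝓢 (Fin n) // ∀ x y, ∃ g, ρ.1 g x = y}
      = n.factorial * numSubgroups 𝓢 n := by
  have h1 := card_pointed_index h𝓢 n hn
  rw [Nat.sub_self, numActs_zero, Nat.descFactorial_self, mul_one, mul_comm] at h1
  rw [← h1]
  have e : {w : Act 𝓢 (Fin n) × Fin n // (homStab w.1.1 w.2).index = n} ≃
      Fin n × {ρ : Act 𝓢 (Fin n) // ∀ x y, ∃ g, ρ.1 g x = y} :=
    { toFun := fun w => (w.1.2, ⟨w.1.1, by
        have h := w.2
        rw [index_homStab] at h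
        have h3 : (Set.range fun g => w.1.1.1 g w.1.2) = Set.univ := by
          apply Set.eq_of_subset_of_ncard_le (Set.subset_univ _)
          rw [Set.ncard_univ, Nat.card_fin]
          exact h.ge
        intro x y
        obtain ⟨a, ha⟩ : x ∈ Set.range fun g => w.1.1.1 g w.1.2 := h3 ▸ Set.mem_univ x
        obtain ⟨b, hb⟩ : y ∈ Set.range fun g => w.1.1.1 g w.1.2 := h3 ▸ Set.mem_univ y
        refine ⟨b * a⁻¹, ?_⟩
        rw [← ha, ← hb]
        simp⟩)
      invFun := fun w => ⟨(w.2.1, w.1), by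
        rw [index_homStab]
        have : (Set.range fun g => w.2.1.1 g w.1) = Set.univ :=
          Set.eq_univ_of_forall fun y => w.2.2 w.1 y
        rw [this]
        simp⟩
      left_inv := fun w => rfl
      right_inv := fun w => rfl }
  rw [Nat.card_congr e, Nat.card_prod, Nat.card_fin]

/-- The exponential formula, as a recurrence: if `f = ∑ actDensity 𝓢 n * z ^ n` and
`S = ∑ numSubgroups 𝓢 n * z ^ n`, then `z f' = S f`. -/
theorem mul_actDensity {𝓢 : Set (Subgroup Γ)} (h𝓢 : ConjClosed 𝓢) (n : ℕ) :
    n * actDensity 𝓢 n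
      = ∑ k ∈ Finset.Icc 1 n, (numSubgroups 𝓢 k : ℚ) * actDensity 𝓢 (n - k) := by
  have h := mul_numActs h𝓢 n
  have hq : (n : ℚ) * numActs 𝓢 n = ∑ k ∈ Finset.Icc 1 n,
      (numSubgroups 𝓢 k : ℚ) * (n.descFactorial k * numActs 𝓢 (n - k)) := by exact_mod_cast h
  rw [actDensity, ← mul_div_assoc, hq, Finset.sum_div]
  refine Finset.sum_congr rfl fun k hk => ?_
  rw [Finset.mem_Icc] at hk
  have h1 : ((n - k).factorial : ℚ) * n.descFactorial k = n.factorial := by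
    exact_mod_cast Nat.factorial_mul_descFactorial hk.2
  have h2 : ((n - k).factorial : ℚ) ≠ 0 := by exact_mod_cast Nat.factorial_ne_zero _
  have h3 : (n.factorial : ℚ) ≠ 0 := by exact_mod_cast Nat.factorial_ne_zero _
  rw [actDensity]
  field_simp
  rw [← h1]
  ring

theorem numSubgroups_le {𝓢 : Set (Subgroup Γ)} (h𝓢 : ConjClosed 𝓢) {n : ℕ} (hn : n ≠ 0) :
    (numSubgroups 𝓢 n : ℚ) ≤ n * actDensity 𝓢 n := by
  rw [mul_actDensity h𝓢]
  refine le_trans (le_of_eq ?_) (Finset.single_le_sum (f := fun k =>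
    (numSubgroups 𝓢 k : ℚ) * actDensity 𝓢 (n - k))
    (fun k _ => mul_nonneg (by positivity) (actDensity_nonneg _ _))
    (Finset.mem_Icc.mpr ⟨Nat.one_le_iff_ne_zero.mpr hn, le_rfl⟩))
  rw [Nat.sub_self, actDensity_zero, mul_one]

end Actions

/-! ### Logarithms and exponentials of power series through recurrences -/

section PowerSeriesRecurrences

open PowerSeries

theorem sum_antidiagonal_eq_sum_Icc (f g : ℕ → ℚ) (hf : f 0 = 0) (k : ℕ) :
    ∑ x ∈ Finset.HasAntidiagonal.antidiagonal k, f x.1 * g x.2 = ∑ j ∈ Finset.Icc 1 k, f j * g (k - j) := by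
  rw [Finset.Nat.sum_antidiagonal_eq_sum_range_succ (fun i j => f i * g j)]
  symm
  apply Finset.sum_subset
  · intro j hj
    simp only [Finset.mem_Icc, Finset.mem_range] at *
    omega
  · intro j hj hj'
    simp only [Finset.mem_Icc, Finset.mem_range] at *
    have : j = 0 := by omega
    rw [this, hf, zero_mul]

theorem coeff_X_mul_derivative (F : ℚ⟦X⟧) (k : ℕ) :
    coeff k (X * d⁄dX ℚ F) = k * coeff k F := by
  rcases k with _ | k
  · simp
  · rw [coeff_succ_X_mul, coeff_derivative]
    push_cast
    ring

theorem hasSubst_sub_one {A : ℚ⟦X⟧} (hA : constantCoeff A = 1) : HasSubst (A - 1) :=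
  HasSubst.of_constantCoeff_zero' (by simp [hA])

theorem derivative_logOf_mul {A : ℚ⟦X⟧} (hA : constantCoeff A = 1) :
    d⁄dX ℚ (logOf A) * A = d⁄dX ℚ A := by
  have hs := hasSubst_sub_one hA
  have h1 : d⁄dX ℚ (log ℚ) * (1 + X) = 1 := by
    ext n
    rw [deriv_log, mul_add, mul_one]
    rcases n with _ | n
    · simp
    · rw [map_add, coeff_succ_mul_X]
      simp [pow_succ, coeff_one]
  have h2 := congrArg (fun F : ℚ⟦X⟧ => F.subst (A - 1)) h1
  have hone : (1 : ℚ⟦X⟧).subst (A - 1) = (1 : ℚ⟦X⟧) := by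
    rw [← coe_substAlgHom hs, map_one]
  simp only [subst_mul hs, subst_add hs, subst_X hs, hone, add_sub_cancel] at h2
  rw [logOf_eq, derivative_subst hs, mul_right_comm, h2, one_mul, map_sub, derivative_one, sub_zero]

/-- If `z A' = S A` and `A` has constant term `1`, then `z (log A)' = S`. -/
theorem coeff_logOf_of_recurrence {A : ℚ⟦X⟧} (hA : constantCoeff A = 1) {c : ℕ → ℚ}
    (h : ∀ k : ℕ, k * coeff k A = ∑ j ∈ Finset.Icc 1 k, c j * coeff (k - j) A) {j : ℕ}
    (hj : j ≠ 0) : j * coeff j (logOf A) = c j := by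
  have hA0 : A ≠ 0 := by rintro rfl; simp at hA
  have hS : (mk fun j => if j = 0 then 0 else c j) * A = X * d⁄dX ℚ A := by
    ext k
    rw [coeff_X_mul_derivative, h, coeff_mul]
    simp only [coeff_mk]
    rw [sum_antidiagonal_eq_sum_Icc (fun j => if j = 0 then 0 else c j) (fun i => coeff i A)
      (by simp)]
    refine Finset.sum_congr rfl fun i hi => ?_
    rw [Finset.mem_Icc] at hi
    rw [if_neg (by omega)]
  have h3 : X * d⁄dX ℚ (logOf A) = mk fun j => if j = 0 then 0 else c j := by
    apply mul_right_cancel₀ hA0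
    rw [hS, mul_assoc, derivative_logOf_mul hA]
  rw [← coeff_X_mul_derivative, h3, coeff_mk, if_neg hj]

theorem constantCoeff_exp_subst {L : ℚ⟦X⟧} (hL : constantCoeff L = 0) :
    constantCoeff ((exp ℚ).subst L) = 1 := by
  have hs : HasSubst L := HasSubst.of_constantCoeff_zero' hL
  have h1 : exp ℚ = 1 + (exp ℚ - 1) := by ring
  have hone : (1 : ℚ⟦X⟧).subst L = (1 : ℚ⟦X⟧) := by
    rw [← coe_substAlgHom hs, map_one]
  rw [h1, subst_add hs, hone, map_add, map_one]
  have := constantCoeff_subst_eq_zero (a := L) hL (exp ℚ - 1) (by simp)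
  rw [← constantCoeff_eq] at this
  rw [this, add_zero]

theorem coeff_exp_subst_recurrence {L : ℚ⟦X⟧} (hL : constantCoeff L = 0) (k : ℕ) :
    k * coeff k ((exp ℚ).subst L)
      = ∑ j ∈ Finset.Icc 1 k, (j * coeff j L) * coeff (k - j) ((exp ℚ).subst L) := by
  have hs : HasSubst L := HasSubst.of_constantCoeff_zero' hL
  rw [← coeff_X_mul_derivative, derivative_subst hs, derivative_exp,
    mul_comm (PowerSeries.subst _ _) (d⁄dX ℚ L), ← mul_assoc, coeff_mul]
  simp_rw [coeff_X_mul_derivative]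
  exact sum_antidiagonal_eq_sum_Icc (fun j => j * coeff j L) (fun i => coeff i _) (by simp) k

theorem recurrence_unique {x y c : ℕ → ℚ} (h0 : x 0 = y 0)
    (hx : ∀ k : ℕ, k * x k = ∑ j ∈ Finset.Icc 1 k, c j * x (k - j))
    (hy : ∀ k : ℕ, k * y k = ∑ j ∈ Finset.Icc 1 k, c j * y (k - j)) (k : ℕ) : x k = y k := by
  induction k using Nat.strong_induction_on with
  | _ k ih =>
    rcases Nat.eq_zero_or_pos k with rfl | hk
    · exact h0
    · have hk' : (k : ℚ) ≠ 0 := by exact_mod_cast hk.ne'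
      apply mul_left_cancel₀ hk'
      rw [hx, hy]
      refine Finset.sum_congr rfl fun j hj => ?_
      rw [Finset.mem_Icc] at hj
      rw [ih (k - j) (by omega)]

end PowerSeriesRecurrences

/-! ### Semiregular permutations and the group `F × ℤ` -/

section Semiregular

variable {D R ι : Type}

/-- All cycles of the permutation `f` (fixed points included) have length `k`. -/
def Semireg (f : Equiv.Perm D) (k : ℕ) : Prop := ∀ x, Function.minimalPeriod f x = k

theorem semireg_iff {f : Equiv.Perm D} {k : ℕ} :
    Semireg f k ↔ ∀ x (n : ℕ), (f ^ n) x = x ↔ k ∣ n := by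
  have h : ∀ x (n : ℕ), (f ^ n) x = x ↔ Function.minimalPeriod f x ∣ n := by
    intro x n
    rw [← Function.isPeriodicPt_iff_minimalPeriod_dvd, Function.IsPeriodicPt,
      Function.IsFixedPt, Equiv.Perm.iterate_eq_pow]
  constructor
  · intro hf x n
    rw [h, hf x]
  · intro hf x
    refine Nat.dvd_right_iff_eq.mp fun n => ?_
    rw [← h, hf]

theorem semireg_one_iff {f : Equiv.Perm D} : Semireg f 1 ↔ f = 1 := by
  rw [semireg_iff]
  constructor
  · intro hf
    ext x
    simpa using hf x 1
  · rintro rfl x n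
    simp

theorem Semireg.conj {f : Equiv.Perm D} {k : ℕ} (hf : Semireg f k) (g : Equiv.Perm D) :
    Semireg (g * f * g⁻¹) k := by
  rw [semireg_iff] at hf ⊢
  intro x n
  rw [conj_pow, Equiv.Perm.mul_apply, Equiv.Perm.mul_apply, ← Equiv.Perm.eq_inv_iff_eq, hf]

/-- The subgroups in whose coset space every cycle of the element `γ` has length `p`. -/
def ordSet {Γ : Type} [Group Γ] (γ : Γ) (p : ℕ) : Set (Subgroup Γ) :=
  {K | ∀ (δ : Γ) (k : ℕ), δ * γ ^ k * δ⁻¹ ∈ K ↔ p ∣ k}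

theorem conjClosed_ordSet {Γ : Type} [Group Γ] (γ : Γ) (p : ℕ) : ConjClosed (ordSet γ p) := by
  intro K hK g δ k
  rw [mem_map_conj, ← hK (g⁻¹ * δ) k]
  simp [mul_assoc]

theorem homStab_mem_ordSet_iff {Γ : Type} [Group Γ] {γ : Γ} {p : ℕ} {ρ : Γ →* Equiv.Perm D} :
    (∀ x, homStab ρ x ∈ ordSet γ p) ↔ Semireg (ρ γ) p := by
  rw [semireg_iff]
  constructor
  · intro h x k
    rw [← h x 1 k]
    simp
  · intro h x δ k
    rw [mem_homStab, ← h (ρ δ⁻¹ x) k]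
    simp [Equiv.eq_symm_apply]

/-- The product of the free group on `ι` and an infinite cyclic group. Its permutation
representations are families of permutations together with one that commutes with all of them. -/
abbrev FreeByZ (ι : Type) : Type := FreeGroup ι × Multiplicative ℤ

/-- The `j`-th free generator of `FreeByZ ι`. -/
def genA (j : ι) : FreeByZ ι := (FreeGroup.of j, 1)

/-- The central generator of `FreeByZ ι`. -/
def genT : FreeByZ ι := (1, Multiplicative.ofAdd 1)

theorem genT_comm (g : FreeByZ ι) : g * genT = genT * g :=
  Prod.ext (by simp [genT]) (mul_comm _ _)

theorem genT_pow (k : ℕ) : (genT : FreeByZ ι) ^ k = (1, Multiplicative.ofAdd (k : ℤ)) := by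
  refine Prod.ext (by simp [genT]) ?_
  simp [genT, ← ofAdd_nsmul]

/-- A representation of `FreeByZ ι` is a family of permutations indexed by `ι` and a permutation
that commutes with all of them. -/
def homEquiv (ι D : Type) : (FreeByZ ι →* Equiv.Perm D) ≃
    {w : (ι → Equiv.Perm D) × Equiv.Perm D // ∀ j, Commute (w.1 j) w.2} where
  toFun ρ := ⟨(fun j => ρ (genA j), ρ genT), fun j => by
    change _ * _ = _ * _
    rw [← map_mul, genT_comm, map_mul]⟩
  invFun w := MonoidHom.noncommCoprod (FreeGroup.lift w.1.1) (zpowersHom _ w.1.2) (by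
    intro g z
    rw [zpowersHom_apply]
    apply Commute.zpow_right
    induction g using FreeGroup.induction_on with
    | C1 => simp
    | of j => simpa using w.2 j
    | inv_of j h => rw [map_inv]; exact h.inv_left
    | mul x y hx hy => rw [map_mul]; exact hx.mul_left hy)
  left_inv ρ := by
    refine MonoidHom.ext fun g => ?_
    obtain ⟨g, z⟩ := g
    have h1 : FreeGroup.lift (fun j => ρ (genA j)) = ρ.comp (MonoidHom.inl _ _) := by
      ext j
      simp [genA]
    have h2 : (ρ genT) ^ (Multiplicative.toAdd z) = ρ (1, z) := by
      rw [← map_zpow]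
      congr 1
      refine Prod.ext (by simp [genT]) ?_
      simp [genT, ← ofAdd_zsmul]
    rw [MonoidHom.noncommCoprod_apply]
    simp only [zpowersHom_apply]
    rw [h1, h2, MonoidHom.comp_apply, ← map_mul]
    simp
  right_inv w := by
    refine Subtype.ext (Prod.ext (funext fun j => ?_) ?_)
    · simp [genA]
    · simp [genT]

instance finite_homs [Finite ι] (n : ℕ) : Finite (FreeByZ ι →* Equiv.Perm (Fin n)) :=
  Finite.of_equiv _ (homEquiv ι (Fin n)).symm

/-- The subgroups in whose coset space every cycle of the `j`-th generator has length `m j`. -/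
def admSet (m : ι → ℕ) : Set (Subgroup (FreeByZ ι)) := {K | ∀ j, K ∈ ordSet (genA j) (m j)}

/-- The members of `admSet m` in whose coset space every cycle of the central generator has
length `i`. -/
def admSetT (m : ι → ℕ) (i : ℕ) : Set (Subgroup (FreeByZ ι)) := admSet m ∩ ordSet genT i

theorem conjClosed_admSet (m : ι → ℕ) : ConjClosed (admSet m) :=
  fun K hK g j => conjClosed_ordSet _ _ K (hK j) g

theorem conjClosed_admSetT (m : ι → ℕ) (i : ℕ) : ConjClosed (admSetT m i) :=
  fun K hK g => ⟨conjClosed_admSet m K hK.1 g, conjClosed_ordSet _ _ K hK.2 g⟩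

theorem homStab_mem_admSet_iff {m : ι → ℕ} {ρ : FreeByZ ι →* Equiv.Perm D} :
    (∀ x, homStab ρ x ∈ admSet m) ↔ ∀ j, Semireg (ρ (genA j)) (m j) := by
  simp_rw [← homStab_mem_ordSet_iff]
  exact forall_comm

theorem homStab_mem_admSetT_iff {m : ι → ℕ} {i : ℕ} {ρ : FreeByZ ι →* Equiv.Perm D} :
    (∀ x, homStab ρ x ∈ admSetT m i) ↔
      (∀ j, Semireg (ρ (genA j)) (m j)) ∧ Semireg (ρ genT) i := by
  rw [← homStab_mem_admSet_iff, ← homStab_mem_ordSet_iff, ← forall_and]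
  rfl

/-- The number of permutations of `D` with all cycles of length `p` that commute with `ψ`. -/
noncomputable def numCentral (p : ℕ) (ψ : Equiv.Perm D) : ℕ :=
  Nat.card {α : Equiv.Perm D // Semireg α p ∧ Commute α ψ}

theorem numCentral_conj (p : ℕ) (ψ g : Equiv.Perm D) :
    numCentral p (g * ψ * g⁻¹) = numCentral p ψ := by
  symm
  refine Nat.card_congr ((MulAut.conj g).toEquiv.subtypeEquiv fun α => ?_)
  change _ ↔ Semireg (g * α * g⁻¹) p ∧ (g * α * g⁻¹) * (g * ψ * g⁻¹) = (g * ψ * g⁻¹) * (g * α * g⁻¹)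
  constructor
  · rintro ⟨h1, h2⟩
    refine ⟨h1.conj g, ?_⟩
    have h2' : α * ψ = ψ * α := h2
    calc _ = g * (α * ψ) * g⁻¹ := by group
      _ = g * (ψ * α) * g⁻¹ := by rw [h2']
      _ = _ := by group
  · rintro ⟨h1, h2⟩
    refine ⟨by simpa [mul_assoc] using h1.conj g⁻¹, ?_⟩
    have h3 : g * (α * ψ) * g⁻¹ = g * (ψ * α) * g⁻¹ := by
      calc _ = (g * α * g⁻¹) * (g * ψ * g⁻¹) := by group
        _ = _ := h2
        _ = _ := by group
    exact mul_left_cancel (mul_right_cancel h3)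

theorem orderOf_cycleOf_of_semireg [Fintype D] [DecidableEq D] {f : Equiv.Perm D} {k : ℕ}
    (hf : Semireg f k) (x : D) : orderOf (f.cycleOf x) = k := by
  refine Nat.dvd_right_iff_eq.mp fun n => ?_
  rw [orderOf_dvd_iff_pow_eq_one, ← semireg_iff.mp hf x n, ← Equiv.Perm.cycleOf_pow_apply_self]
  by_cases hx : f x = x
  · rw [(Equiv.Perm.cycleOf_eq_one_iff f).mpr hx]
    simp
  · rw [(Equiv.Perm.isCycle_cycleOf f hx).pow_eq_one_iff]
    constructor
    · rintro ⟨y, hy, hy'⟩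
      have hc := Equiv.Perm.isCycle_cycleOf f hx
      have := (hc.pow_eq_one_iff (n := n)).mpr ⟨y, hy, hy'⟩
      rw [this]
      rfl
    · intro h
      exact ⟨x, by simpa using hx, h⟩

/-- Two permutations of a finite set whose cycles all have the same length are conjugate. -/
theorem isConj_of_semireg [Finite D] {f g : Equiv.Perm D} {k : ℕ}
    (hf : Semireg f k) (hg : Semireg g k) : IsConj f g := by
  classical
  have := Fintype.ofFinite D
  by_cases hk : k = 1
  · subst hk
    rw [semireg_one_iff.mp hf, semireg_one_iff.mp hg]
  · have h : ∀ {f : Equiv.Perm D}, Semireg f k →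
        f.cycleType = Multiset.replicate f.cycleType.card k ∧
          f.cycleType.card * k = Fintype.card D := by
      intro f hf
      have h1 : f.cycleType = Multiset.replicate f.cycleType.card k := by
        rw [Multiset.eq_replicate]
        refine ⟨rfl, fun b hb => ?_⟩
        rw [Equiv.Perm.cycleType_def, Multiset.mem_map] at hb
        obtain ⟨c, hc, rfl⟩ := hb
        rw [Finset.mem_val, Equiv.Perm.mem_cycleFactorsFinset_iff] at hc
        obtain ⟨x, hx⟩ := hc.1.nonempty_support
        have hcx : c = f.cycleOf x := by
          apply Equiv.Perm.cycle_is_cycleOf hx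
          rw [Equiv.Perm.mem_cycleFactorsFinset_iff]
          exact hc
        rw [Function.comp_apply, ← hc.1.orderOf, hcx, orderOf_cycleOf_of_semireg hf]
      refine ⟨h1, ?_⟩
      have h2 := Equiv.Perm.sum_cycleType f
      rw [h1, Multiset.sum_replicate, smul_eq_mul] at h2
      rw [h2, ← Finset.card_univ]
      congr 1
      refine Finset.eq_univ_of_forall fun x => ?_
      rw [Equiv.Perm.mem_support]
      intro hx
      have := (semireg_iff.mp hf x 1).mp (by simpa using hx)
      exact hk (Nat.dvd_one.mp this)
    rw [Equiv.Perm.isConj_iff_cycleType_eq, (h hf).1, (h hg).1]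
    have h3 := (h hf).2.trans (h hg).2.symm
    rcases Nat.eq_zero_or_pos k with rfl | hk0
    · have hD : IsEmpty D := by
        have := (h hf).2
        rw [mul_zero] at this
        exact Fintype.card_eq_zero_iff.mp this.symm
      rw [Subsingleton.elim f g]
    · rw [Nat.eq_of_mul_eq_mul_right hk0 h3]

/-- A representation in which the central generator has cycles of length `i` is a permutation `ψ`
with cycles of length `i` and a family of permutations commuting with it. -/
noncomputable def actEquiv (m : ι → ℕ) (i : ℕ) (D : Type) : Act (admSetT m i) D ≃
    Σ ψ : {ψ : Equiv.Perm D // Semireg ψ i},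
      ∀ j, {α : Equiv.Perm D // Semireg α (m j) ∧ Commute α ψ.1} where
  toFun ρ := ⟨⟨ρ.1 genT, (homStab_mem_admSetT_iff.mp ρ.2).2⟩, fun j => ⟨ρ.1 (genA j),
    (homStab_mem_admSetT_iff.mp ρ.2).1 j, (homEquiv ι D ρ.1).2 j⟩⟩
  invFun w := ⟨(homEquiv ι D).symm ⟨(fun j => (w.2 j).1, w.1.1), fun j => (w.2 j).2.2⟩, by
    set v : {w : (ι → Equiv.Perm D) × Equiv.Perm D // ∀ j, Commute (w.1 j) w.2} :=
      ⟨(fun j => (w.2 j).1, w.1.1), fun j => (w.2 j).2.2⟩ with hv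
    have h := (homEquiv ι D).apply_symm_apply v
    rw [homStab_mem_admSetT_iff]
    constructor
    · intro j
      have h1 : (homEquiv ι D).symm v (genA j) = (w.2 j).1 :=
        congrFun (congrArg (fun z => z.1.1) h) j
      rw [h1]
      exact (w.2 j).2.1
    · have h1 : (homEquiv ι D).symm v genT = w.1.1 := congrArg (fun z => z.1.2) h
      rw [h1]
      exact w.1.2⟩
  left_inv ρ := Subtype.ext ((homEquiv ι D).symm_apply_apply ρ.1)
  right_inv w := by
    obtain ⟨⟨ψ, hψ⟩, α⟩ := w
    set v : {w : (ι → Equiv.Perm D) × Equiv.Perm D // ∀ j, Commute (w.1 j) w.2} :=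
      ⟨(fun j => (α j).1, ψ), fun j => (α j).2.2⟩ with hv
    have h := (homEquiv ι D).apply_symm_apply v
    have h1 : ∀ j, (homEquiv ι D).symm v (genA j) = (α j).1 := fun j =>
      congrFun (congrArg (fun z => z.1.1) h) j
    have h2 : (homEquiv ι D).symm v genT = ψ := congrArg (fun z => z.1.2) h
    refine Sigma.ext (Subtype.ext h2) ?_
    refine Function.hfunext rfl fun j j' hj => ?_
    obtain rfl := eq_of_heq hj
    simp only
    refine (Subtype.heq_iff_coe_eq ?_).mpr (h1 j)
    intro β
    rw [h2]

/-- The number of permutations of `n` points with all cycles of length `i`. -/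
noncomputable def numSemireg (i n : ℕ) : ℕ := Nat.card {ψ : Equiv.Perm (Fin n) // Semireg ψ i}

/-- The number of permutations commuting with `ψ` depends only on the conjugacy class of `ψ`, which
is determined by `i`; hence a single `ψ` suffices for the count. -/
theorem numActs_eq [Fintype ι] (m : ι → ℕ) {i n : ℕ} {ψ : Equiv.Perm (Fin n)} (hψ : Semireg ψ i) :
    numActs (admSetT m i) n = numSemireg i n * ∏ j, numCentral (m j) ψ := by
  classical
  rw [numActs, Nat.card_congr (actEquiv m i (Fin n))]
  have := Fintype.ofFinite {ψ : Equiv.Perm (Fin n) // Semireg ψ i}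
  rw [Nat.card_sigma]
  have h : ∀ χ : {ψ : Equiv.Perm (Fin n) // Semireg ψ i},
      Nat.card (∀ j, {α : Equiv.Perm (Fin n) // Semireg α (m j) ∧ Commute α χ.1})
        = ∏ j, numCentral (m j) ψ := by
    intro χ
    rw [Nat.card_pi]
    refine Finset.prod_congr rfl fun j _ => ?_
    obtain ⟨g, hg⟩ := isConj_iff.mp (isConj_of_semireg hψ χ.2)
    rw [← numCentral_conj _ ψ g, hg, numCentral]
  simp_rw [h]
  rw [Finset.sum_const, Finset.card_univ, smul_eq_mul, numSemireg, Nat.card_eq_fintype_card]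

theorem numActs_eq_zero (m : ι → ℕ) {i n : ℕ} (h : numSemireg i n = 0) [Finite ι] :
    numActs (admSetT m i) n = 0 := by
  rw [numActs, Nat.card_congr (actEquiv m i (Fin n)), Nat.card_eq_zero]
  left
  rw [numSemireg, Nat.card_eq_zero] at h
  rcases h with h | h
  · exact ⟨fun w => h.elim w.1⟩
  · exact absurd h (not_infinite_iff_finite.mpr inferInstance)

theorem numActs_empty (m : Empty → ℕ) (i n : ℕ) :
    numActs (admSetT m i) n = numSemireg i n := by
  by_cases h : numSemireg i n = 0
  · rw [numActs_eq_zero m h, h]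
  · obtain ⟨ψ⟩ : Nonempty {ψ : Equiv.Perm (Fin n) // Semireg ψ i} :=
      (Nat.card_ne_zero.mp h).1
    rw [numActs_eq m ψ.2]
    simp

/-- Without free generators there is exactly one subgroup, the kernel of the reduction modulo `i`. -/
theorem numSubgroups_empty (m : Empty → ℕ) {i : ℕ} (hi : i ≠ 0) (k : ℕ) :
    numSubgroups (admSetT m i) k = if k = i then 1 else 0 := by
  have key : ∀ K : Subgroup (FreeByZ Empty), K ∈ admSetT m i ↔
      K = ((Int.castAddHom (ZMod i)).toMultiplicative.comp (MonoidHom.snd _ _)).ker := by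
    intro K
    have h1 : ∀ (g : FreeByZ Empty), g = (1, g.2) := fun g => Prod.ext (Subsingleton.elim _ _) rfl
    constructor
    · rintro ⟨-, hK⟩
      have hK' : ∀ k : ℕ, (1, Multiplicative.ofAdd (k : ℤ)) ∈ K ↔ i ∣ k := by
        intro k
        rw [← hK 1 k, genT_pow]
        simp
      have hK'' : ∀ z : ℤ, ((1, Multiplicative.ofAdd z) : FreeByZ Empty) ∈ K ↔ (i : ℤ) ∣ z := by
        intro z
        obtain ⟨k, rfl | rfl⟩ := z.eq_nat_or_neg
        · rw [hK', Int.natCast_dvd_natCast]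
        · rw [← inv_mem_iff]
          simp only [Prod.inv_mk, inv_one, ofAdd_neg, inv_inv, dvd_neg]
          rw [hK', Int.natCast_dvd_natCast]
      ext g
      rw [h1 g, MonoidHom.mem_ker]
      have := hK'' (Multiplicative.toAdd g.2)
      rw [ofAdd_toAdd] at this
      rw [this, ← ZMod.intCast_zmod_eq_zero_iff_dvd]
      rfl
    · rintro rfl
      refine ⟨fun j => j.elim, fun δ k => ?_⟩
      rw [MonoidHom.mem_ker, map_mul, map_mul, map_inv, mul_inv_eq_one, mul_eq_left, genT_pow]
      change ((k : ℤ) : ZMod i) = 0 ↔ _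
      rw [Int.cast_natCast, ZMod.natCast_eq_zero_iff]
  have hindex : ((Int.castAddHom (ZMod i)).toMultiplicative.comp
      (MonoidHom.snd (FreeGroup Empty) (Multiplicative ℤ))).ker.index = i := by
    rw [Subgroup.index_ker]
    have : Function.Surjective ((Int.castAddHom (ZMod i)).toMultiplicative.comp
        (MonoidHom.snd (FreeGroup Empty) (Multiplicative ℤ))) := by
      intro z
      obtain ⟨y, hy⟩ := ZMod.intCast_surjective (Multiplicative.toAdd z)
      exact ⟨(1, Multiplicative.ofAdd y), hy⟩
    rw [MonoidHom.range_eq_top.mpr this, Subgroup.card_top]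
    exact Nat.card_zmod i
  split_ifs with h
  · subst h
    rw [numSubgroups, Nat.card_eq_one_iff_unique]
    refine ⟨⟨fun a b => Subtype.ext ?_⟩, ⟨⟨_, (key _).mpr rfl, hindex⟩⟩⟩
    rw [(key _).mp a.2.1, (key _).mp b.2.1]
  · rw [numSubgroups, Nat.card_eq_zero]
    left
    refine ⟨fun a => h ?_⟩
    rw [← a.2.2, (key _).mp a.2.1, hindex]

/-- The orbit recurrence for a single permutation, obtained from the empty family of free
generators. -/
theorem mul_numSemireg_div {i : ℕ} (hi : i ≠ 0) (n : ℕ) :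
    n * ((numSemireg i n : ℚ) / n.factorial)
      = if i ≤ n then (numSemireg i (n - i) : ℚ) / (n - i).factorial else 0 := by
  have h := mul_actDensity (conjClosed_admSetT (fun j : Empty => j.elim) i) n
  simp only [actDensity, numActs_empty, numSubgroups_empty _ hi] at h
  rw [h]
  simp only [Nat.cast_ite, Nat.cast_one, Nat.cast_zero, ite_mul, one_mul, zero_mul]
  rw [Finset.sum_ite_eq']
  simp [Finset.mem_Icc, Nat.one_le_iff_ne_zero, hi]

theorem numSemireg_eq_zero {i n : ℕ} (hi : i ≠ 0) (hn : ¬ i ∣ n) : numSemireg i n = 0 := by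
  induction n using Nat.strong_induction_on with
  | _ n ih =>
    have h := mul_numSemireg_div hi n
    have hn0 : n ≠ 0 := by rintro rfl; exact hn (dvd_zero _)
    have h0 : (n : ℚ) * ((numSemireg i n : ℚ) / n.factorial) = 0 := by
      rw [h]
      split_ifs with hle
      · rw [ih (n - i) (by omega) fun ⟨c, hc⟩ => hn ⟨c + 1, by rw [mul_add]; omega⟩]
        simp
      · rfl
    have hf := Nat.factorial_ne_zero n
    simpa [hn0, hf] using h0

theorem numSemireg_mul {i : ℕ} (hi : i ≠ 0) (k : ℕ) :
    (numSemireg i (i * k) : ℚ) / (i * k).factorial = 1 / ((i : ℚ) ^ k * k.factorial) := by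
  induction k with
  | zero =>
    have := numActs_zero (admSetT (fun j : Empty => j.elim) i)
    rw [numActs_empty] at this
    simp [this]
  | succ k ih =>
    have h := mul_numSemireg_div hi (i * (k + 1))
    rw [if_pos (by nlinarith), show i * (k + 1) - i = i * k by rw [mul_add, mul_one]; omega, ih] at h
    have hi' : (i : ℚ) ≠ 0 := by exact_mod_cast hi
    have hk' : ((k : ℚ) + 1) ≠ 0 := by positivity
    have hf : (k.factorial : ℚ) ≠ 0 := by exact_mod_cast Nat.factorial_ne_zero _
    have h2 : (numSemireg i (i * (k + 1)) : ℚ) / (i * (k + 1)).factorial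
        = (1 / ((i : ℚ) ^ k * k.factorial)) / ((i * (k + 1) : ℕ) : ℚ) := by
      rw [eq_div_iff (by push_cast; positivity), mul_comm, h]
    rw [h2, Nat.factorial_succ]
    push_cast
    field_simp
    ring

theorem numSemireg_mul_ne_zero {i : ℕ} (hi : i ≠ 0) (k : ℕ) : numSemireg i (i * k) ≠ 0 := by
  intro h
  have := numSemireg_mul hi k
  rw [h] at this
  have h2 : (0 : ℚ) < 1 / ((i : ℚ) ^ k * k.factorial) := by
    have := Nat.pos_of_ne_zero hi
    positivity
  rw [← this] at h2
  simp at h2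

/-- The densities of the representations of `FreeByZ ι` on `i * k` points are, up to the weight
`i ^ k * k!`, multiplicative in the generators. -/
theorem actDensity_mul_weight [Fintype ι] (m : ι → ℕ) {i : ℕ} (hi : i ≠ 0) (k : ℕ) :
    actDensity (admSetT m i) (i * k) * ((i : ℚ) ^ k * k.factorial)
      = ∏ j, (actDensity (admSetT (fun _ : Unit => m j) i) (i * k)
          * ((i : ℚ) ^ k * k.factorial)) := by
  obtain ⟨ψ⟩ : Nonempty {ψ : Equiv.Perm (Fin (i * k)) // Semireg ψ i} :=
    (Nat.card_ne_zero.mp (numSemireg_mul_ne_zero hi k)).1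
  have hw : ((i : ℚ) ^ k * k.factorial) ≠ 0 := by
    have := Nat.pos_of_ne_zero hi
    positivity
  have h : ∀ {ι : Type} [Fintype ι] (m : ι → ℕ),
      actDensity (admSetT m i) (i * k) * ((i : ℚ) ^ k * k.factorial)
        = ∏ j, (numCentral (m j) ψ.1 : ℚ) := by
    intro ι _ m
    rw [actDensity, numActs_eq m ψ.2]
    push_cast
    rw [mul_div_right_comm, numSemireg_mul hi]
    field_simp
  rw [h m]
  refine Finset.prod_congr rfl fun j _ => ?_
  rw [h]
  simp

theorem actDensity_eq_zero [Finite ι] (m : ι → ℕ) {i n : ℕ} (hi : i ≠ 0) (hn : ¬ i ∣ n) :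
    actDensity (admSetT m i) n = 0 := by
  rw [actDensity, numActs_eq_zero m (numSemireg_eq_zero hi hn)]
  simp

end Semiregular

/-! ### Subgroups of `F × ℤ` sorted by their projection to `ℤ` -/

section SubgroupCounting

variable {ι : Type}

/-- The subgroups of `FreeByZ ι` that project onto the infinite cyclic factor; equivalently, the
free factor is transitive on their coset space. -/
def connSet (ι : Type) : Set (Subgroup (FreeByZ ι)) := {K | ∃ g, (g, Multiplicative.ofAdd 1) ∈ K}

theorem conjClosed_connSet : ConjClosed (connSet ι) := by
  rintro K ⟨g, hg⟩ h
  refine ⟨h.1 * g * h.1⁻¹, ?_⟩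
  rw [mem_map_conj]
  convert hg using 1
  refine Prod.ext ?_ ?_
  · simp [mul_assoc]
  · simp

/-- The endomorphism of `FreeByZ ι` that multiplies the infinite cyclic factor by `d`. -/
def scaleHom (ι : Type) (d : ℕ) : FreeByZ ι →* FreeByZ ι :=
  (MonoidHom.id _).prodMap (powMonoidHom d)

@[simp]
theorem scaleHom_apply (d : ℕ) (g : FreeGroup ι) (z : ℤ) :
    scaleHom ι d (g, Multiplicative.ofAdd z) = (g, Multiplicative.ofAdd (d * z)) := by
  refine Prod.ext rfl ?_
  change (Multiplicative.ofAdd z) ^ d = _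
  rw [← ofAdd_nsmul, nsmul_eq_mul]

theorem scaleHom_injective {d : ℕ} (hd : d ≠ 0) : Function.Injective (scaleHom ι d) := by
  rintro ⟨g, z⟩ ⟨h, w⟩ e
  obtain ⟨z, rfl⟩ := Multiplicative.ofAdd.surjective z
  obtain ⟨w, rfl⟩ := Multiplicative.ofAdd.surjective w
  rw [scaleHom_apply, scaleHom_apply, Prod.mk.injEq] at e
  have h2 : (d : ℤ) * z = d * w := Multiplicative.ofAdd.injective e.2
  rw [e.1, mul_left_cancel₀ (by exact_mod_cast hd) h2]

/-- The reduction of the infinite cyclic factor modulo `d`. -/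
def modHom (ι : Type) (d : ℕ) : FreeByZ ι →* Multiplicative (ZMod d) :=
  (Int.castAddHom (ZMod d)).toMultiplicative.comp (MonoidHom.snd _ _)

theorem mem_ker_modHom {d : ℕ} {g : FreeGroup ι} {z : ℤ} :
    (g, Multiplicative.ofAdd z) ∈ (modHom ι d).ker ↔ (d : ℤ) ∣ z := by
  rw [MonoidHom.mem_ker, ← ZMod.intCast_zmod_eq_zero_iff_dvd]
  rfl

theorem index_ker_modHom (d : ℕ) : (modHom ι d).ker.index = d := by
  rw [Subgroup.index_ker]
  have : Function.Surjective (modHom ι d) := by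
    intro z
    obtain ⟨y, hy⟩ := ZMod.intCast_surjective (Multiplicative.toAdd z)
    exact ⟨(1, Multiplicative.ofAdd y), hy⟩
  rw [MonoidHom.range_eq_top.mpr this, Subgroup.card_top]
  exact Nat.card_zmod d

theorem range_scaleHom (d : ℕ) : (scaleHom ι d).range = (modHom ι d).ker := by
  ext ⟨g, z⟩
  obtain ⟨z, rfl⟩ := Multiplicative.ofAdd.surjective z
  rw [mem_ker_modHom]
  constructor
  · rintro ⟨⟨h, w⟩, e⟩
    obtain ⟨w, rfl⟩ := Multiplicative.ofAdd.surjective w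
    rw [scaleHom_apply, Prod.mk.injEq] at e
    exact ⟨w, (Multiplicative.ofAdd.injective e.2).symm⟩
  · rintro ⟨w, rfl⟩
    exact ⟨(g, Multiplicative.ofAdd w), scaleHom_apply _ _ _⟩

theorem index_map_scaleHom {d : ℕ} (hd : d ≠ 0) (K : Subgroup (FreeByZ ι)) :
    (K.map (scaleHom ι d)).index = K.index * d := by
  rw [Subgroup.index_map_of_injective _ (scaleHom_injective hd), range_scaleHom, index_ker_modHom]

theorem mem_map_scaleHom {d : ℕ} {K : Subgroup (FreeByZ ι)} {g : FreeGroup ι} {z : ℤ} :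
    (g, Multiplicative.ofAdd z) ∈ K.map (scaleHom ι d) ↔
      ∃ w : ℤ, z = d * w ∧ (g, Multiplicative.ofAdd w) ∈ K := by
  constructor
  · rintro ⟨⟨h, w⟩, hK, e⟩
    obtain ⟨w, rfl⟩ := Multiplicative.ofAdd.surjective w
    rw [scaleHom_apply, Prod.mk.injEq] at e
    obtain ⟨rfl, e⟩ := e
    exact ⟨w, (Multiplicative.ofAdd.injective e).symm, hK⟩
  · rintro ⟨w, rfl, hK⟩
    exact ⟨_, hK, scaleHom_apply _ _ _⟩

theorem exists_mem_map_scaleHom_iff {d : ℕ} {K : Subgroup (FreeByZ ι)}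
    (hK : K ∈ connSet ι) (z : ℤ) :
    (∃ g, (g, Multiplicative.ofAdd z) ∈ K.map (scaleHom ι d)) ↔ (d : ℤ) ∣ z := by
  simp_rw [mem_map_scaleHom]
  constructor
  · rintro ⟨g, w, rfl, -⟩
    exact dvd_mul_right _ _
  · rintro ⟨w, rfl⟩
    obtain ⟨g, hg⟩ := hK
    refine ⟨g ^ w, w, rfl, ?_⟩
    convert K.zpow_mem hg w using 1
    refine Prod.ext rfl ?_
    simp [← ofAdd_zsmul]

/-- Every subgroup of finite index is `scaleHom ι d` applied to a subgroup projecting onto the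
infinite cyclic factor, where `d` generates the projection of the given subgroup. -/
theorem exists_map_scaleHom {K : Subgroup (FreeByZ ι)} (hK : K.index ≠ 0) :
    ∃ d : ℕ, d ≠ 0 ∧ ∃ K' ∈ connSet ι, K'.map (scaleHom ι d) = K := by
  let P : AddSubgroup ℤ := (K.map (MonoidHom.snd _ _)).toAddSubgroup'
  have hP : ∀ z : ℤ, z ∈ P ↔ ∃ g, (g, Multiplicative.ofAdd z) ∈ K := by
    intro z
    constructor
    · rintro ⟨⟨g, w⟩, hg, e⟩
      obtain rfl : w = Multiplicative.ofAdd z := e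
      exact ⟨g, hg⟩
    · rintro ⟨g, hg⟩
      exact ⟨_, hg, rfl⟩
  obtain ⟨a, ha⟩ := Int.subgroup_cyclic P
  have hd : ∀ z : ℤ, z ∈ P ↔ (a.natAbs : ℤ) ∣ z := by
    intro z
    rw [ha, AddSubgroup.mem_closure_singleton, Int.natAbs_dvd]
    constructor
    · rintro ⟨n, rfl⟩
      simp
    · rintro ⟨n, rfl⟩
      exact ⟨n, by simp [mul_comm]⟩
  have hd0 : a.natAbs ≠ 0 := by
    intro h0
    obtain ⟨n, hn, -, hmem⟩ := Subgroup.exists_pow_mem_of_index_ne_zero hK genT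
    rw [genT_pow] at hmem
    have := (hd n).mp ((hP n).mpr ⟨_, hmem⟩)
    rw [h0] at this
    simp at this
    omega
  refine ⟨a.natAbs, hd0, K.comap (scaleHom ι a.natAbs), ?_, ?_⟩
  · obtain ⟨g, hg⟩ := (hP a.natAbs).mp ((hd _).mpr dvd_rfl)
    refine ⟨g, ?_⟩
    rw [Subgroup.mem_comap, scaleHom_apply, mul_one]
    exact hg
  · rw [Subgroup.map_comap_eq, range_scaleHom, inf_eq_right]
    rintro ⟨g, z⟩ hg
    obtain ⟨z, rfl⟩ := Multiplicative.ofAdd.surjective z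
    rw [mem_ker_modHom, ← hd, hP]
    exact ⟨g, hg⟩

/-- Counting subgroups by the size of the cokernel of their projection to the infinite cyclic
factor. -/
theorem numSubgroups_eq_sum_divisors [Finite ι] {𝓢 : Set (Subgroup (FreeByZ ι))}
    {𝓣 : ℕ → Set (Subgroup (FreeByZ ι))}
    (h : ∀ d ≠ 0, ∀ K ∈ connSet ι, K.map (scaleHom ι d) ∈ 𝓢 ↔ K ∈ 𝓣 d) {n : ℕ} (hn : n ≠ 0) :
    numSubgroups 𝓢 n = ∑ d ∈ n.divisors, numSubgroups (𝓣 d ∩ connSet ι) (n / d) := by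
  have hd0 : ∀ d : n.divisors, d.1 ≠ 0 := fun d => (Nat.pos_of_mem_divisors d.2).ne'
  have hdn : ∀ d : n.divisors, n / d.1 * d.1 = n := fun d =>
    Nat.div_mul_cancel (Nat.dvd_of_mem_divisors d.2)
  let Φ : (Σ d : n.divisors, {K : Subgroup (FreeByZ ι) //
      K ∈ 𝓣 d ∩ connSet ι ∧ K.index = n / d}) → {K : Subgroup (FreeByZ ι) // K ∈ 𝓢 ∧ K.index = n} :=
    fun z => ⟨z.2.1.map (scaleHom ι z.1), (h _ (hd0 z.1) _ z.2.2.1.2).mpr z.2.2.1.1, by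
      rw [index_map_scaleHom (hd0 z.1), z.2.2.2, hdn]⟩
  have hΦ : Function.Bijective Φ := by
    constructor
    · rintro ⟨d₁, K₁, ⟨h₁, c₁⟩, i₁⟩ ⟨d₂, K₂, ⟨h₂, c₂⟩, i₂⟩ e
      have e' : K₁.map (scaleHom ι d₁) = K₂.map (scaleHom ι d₂) := congrArg Subtype.val e
      have hd : d₁ = d₂ := by
        have key : ∀ z : ℤ, ((d₁.1 : ℕ) : ℤ) ∣ z ↔ ((d₂.1 : ℕ) : ℤ) ∣ z := by
          intro z
          rw [← exists_mem_map_scaleHom_iff c₁, ← exists_mem_map_scaleHom_iff c₂,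
            e']
        refine Subtype.ext (Nat.dvd_antisymm ?_ ?_)
        · exact Int.natCast_dvd_natCast.mp ((key _).mpr dvd_rfl)
        · exact Int.natCast_dvd_natCast.mp ((key _).mp dvd_rfl)
      subst hd
      have hK : K₁ = K₂ := Subgroup.map_injective (scaleHom_injective (hd0 d₁)) e'
      subst hK
      rfl
    · rintro ⟨K, hK, hi⟩
      obtain ⟨d, hd, K', hc, rfl⟩ := exists_map_scaleHom (hi.trans_ne hn)
      rw [index_map_scaleHom hd] at hi
      have hmem : d ∈ n.divisors := Nat.mem_divisors.mpr ⟨⟨_, by rw [mul_comm, hi]⟩, hn⟩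
      exact ⟨⟨⟨d, hmem⟩, K', ⟨(h d hd K' hc).mp hK, hc⟩,
        (Nat.div_eq_of_eq_mul_left (Nat.pos_of_ne_zero hd) hi.symm).symm⟩, rfl⟩
  have hfin : ∀ d : n.divisors, Finite {K : Subgroup (FreeByZ ι) //
      K ∈ 𝓣 d ∩ connSet ι ∧ K.index = n / d} := fun d =>
    finite_subgroups_index _ (Nat.div_pos (Nat.divisor_le d.2) (Nat.pos_of_ne_zero (hd0 d))).ne'
  rw [numSubgroups, ← Nat.card_congr (Equiv.ofBijective Φ hΦ), Nat.card_sigma]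
  exact Finset.sum_coe_sort n.divisors
    (fun d => numSubgroups (𝓣 d ∩ connSet ι) (n / d))

theorem map_scaleHom_mem_admSet {m : ι → ℕ} {d : ℕ} (hd : d ≠ 0) {K : Subgroup (FreeByZ ι)} :
    K.map (scaleHom ι d) ∈ admSet m ↔ K ∈ admSet m := by
  refine forall_congr' fun j => forall_congr' fun δ => forall_congr' fun k => ?_
  have h : δ * genA j ^ k * δ⁻¹ = (δ.1 * FreeGroup.of j ^ k * δ.1⁻¹, Multiplicative.ofAdd (0 : ℤ)) := by
    refine Prod.ext rfl ?_
    simp [genA]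
  rw [h, mem_map_scaleHom]
  have : (∃ w : ℤ, 0 = (d : ℤ) * w ∧ (δ.1 * FreeGroup.of j ^ k * δ.1⁻¹, Multiplicative.ofAdd w) ∈ K)
      ↔ (δ.1 * FreeGroup.of j ^ k * δ.1⁻¹, Multiplicative.ofAdd (0 : ℤ)) ∈ K := by
    constructor
    · rintro ⟨w, hw, hK⟩
      have : w = 0 := by
        rcases mul_eq_zero.mp hw.symm with h0 | h0
        · exact absurd (by exact_mod_cast h0) hd
        · exact h0
      rwa [this] at hK
    · exact fun hK => ⟨0, by simp, hK⟩
  rw [this]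

theorem mem_ordSet_genT {K : Subgroup (FreeByZ ι)} {i : ℕ} :
    K ∈ ordSet genT i ↔ ∀ k : ℕ, (1, Multiplicative.ofAdd (k : ℤ)) ∈ K ↔ i ∣ k := by
  have h : ∀ (δ : FreeByZ ι) (k : ℕ), δ * genT ^ k * δ⁻¹ = (1, Multiplicative.ofAdd (k : ℤ)) := by
    intro δ k
    rw [genT_pow]
    refine Prod.ext (by simp) (by simp)
  constructor
  · intro hK k
    rw [← hK 1 k, h]
  · intro hK δ k
    rw [h, hK]

theorem map_scaleHom_mem_ordSet {i d : ℕ} (hd : d ≠ 0) {K : Subgroup (FreeByZ ι)} :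
    K.map (scaleHom ι d) ∈ ordSet genT i ↔ d ∣ i ∧ K ∈ ordSet genT (i / d) := by
  have h1 : ∀ k : ℕ, (1, Multiplicative.ofAdd (k : ℤ)) ∈ K.map (scaleHom ι d) ↔
      ∃ w : ℕ, k = d * w ∧ (1, Multiplicative.ofAdd (w : ℤ)) ∈ K := by
    intro k
    rw [mem_map_scaleHom]
    constructor
    · rintro ⟨w, hw, hK⟩
      have : 0 ≤ w := by
        by_contra hneg
        have hd' : (0 : ℤ) < d := by exact_mod_cast Nat.pos_of_ne_zero hd
        nlinarith [Int.natCast_nonneg k]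
      lift w to ℕ using this
      exact ⟨w, by exact_mod_cast hw, hK⟩
    · rintro ⟨w, rfl, hK⟩
      exact ⟨w, by push_cast; rfl, hK⟩
  rw [mem_ordSet_genT, mem_ordSet_genT]
  simp_rw [h1]
  constructor
  · intro h
    have hdi : d ∣ i := by
      obtain ⟨w, hw, -⟩ := (h i).mpr dvd_rfl
      exact ⟨w, hw⟩
    refine ⟨hdi, fun k => ?_⟩
    rw [Nat.div_dvd_iff_dvd_mul hdi (Nat.pos_of_ne_zero hd), ← h]
    constructor
    · exact fun hK => ⟨k, rfl, hK⟩
    · rintro ⟨w, hw, hK⟩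
      rwa [Nat.eq_of_mul_eq_mul_left (Nat.pos_of_ne_zero hd) hw]
  · rintro ⟨hdi, h⟩ k
    constructor
    · rintro ⟨w, rfl, hK⟩
      rw [← Nat.div_dvd_iff_dvd_mul hdi (Nat.pos_of_ne_zero hd), ← h]
      exact hK
    · rintro hk
      obtain ⟨w, rfl⟩ := hdi.trans hk
      refine ⟨w, rfl, ?_⟩
      rwa [h, Nat.div_dvd_iff_dvd_mul hdi (Nat.pos_of_ne_zero hd)]

theorem numSubgroups_admSet [Finite ι] (m : ι → ℕ) {n : ℕ} (hn : n ≠ 0) :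
    numSubgroups (admSet m) n
      = ∑ d ∈ n.divisors, numSubgroups (admSet m ∩ connSet ι) (n / d) :=
  numSubgroups_eq_sum_divisors (𝓣 := fun _ => admSet m)
    (fun _ hd _ _ => map_scaleHom_mem_admSet hd) hn

/-- The homomorphism from `ℤ × ℤ` to `ℤ / p` sending the first generator to `1` and the second
to `x`. -/
def planeHom (p : ℕ) (x : ZMod p) : FreeByZ Unit →* Multiplicative (ZMod p) :=
  (FreeGroup.lift fun _ => Multiplicative.ofAdd 1).coprod (zpowersHom _ (Multiplicative.ofAdd x))

theorem planeHom_apply (p : ℕ) (x : ZMod p) (v z : ℤ) :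
    planeHom p x (FreeGroup.of () ^ v, Multiplicative.ofAdd z)
      = Multiplicative.ofAdd ((v : ZMod p) + z * x) := by
  simp [planeHom, ← ofAdd_zsmul]

theorem mem_ker_planeHom {p : ℕ} {x : ZMod p} {v z : ℤ} :
    (FreeGroup.of () ^ v, Multiplicative.ofAdd z) ∈ (planeHom p x).ker ↔
      (v : ZMod p) + z * x = 0 := by
  rw [MonoidHom.mem_ker, planeHom_apply, ofAdd_eq_one]

theorem index_ker_planeHom (p : ℕ) (x : ZMod p) : (planeHom p x).ker.index = p := by
  rw [Subgroup.index_ker]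
  have : Function.Surjective (planeHom p x) := by
    intro z
    obtain ⟨y, hy⟩ := ZMod.intCast_surjective (Multiplicative.toAdd z)
    refine ⟨(FreeGroup.of () ^ y, Multiplicative.ofAdd 0), ?_⟩
    rw [planeHom_apply, hy]
    simp
  rw [MonoidHom.range_eq_top.mpr this, Subgroup.card_top]
  exact Nat.card_zmod p

theorem exists_zpow_eq (g : FreeGroup Unit) : ∃ v : ℤ, g = FreeGroup.of () ^ v :=
  ⟨FreeGroup.freeGroupUnitEquivInt g, (FreeGroup.freeGroupUnitEquivInt.symm_apply_apply g).symm⟩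

/-- The subgroups of `ℤ × ℤ` projecting onto the second factor, modulo which the generators have
orders `p` and `i`, are the kernels of `planeHom p x` with `x` of order `i`. -/
theorem mem_admSetT_inter_connSet_iff {p i : ℕ} (K : Subgroup (FreeByZ Unit)) :
    K ∈ admSetT (fun _ : Unit => p) i ∩ connSet Unit ↔
      ∃ x : ZMod p, addOrderOf x = i ∧ (planeHom p x).ker = K := by
  constructor
  · rintro ⟨⟨hA, hT⟩, g, hg⟩
    obtain ⟨u, rfl⟩ := exists_zpow_eq g
    have hA' : ∀ v : ℤ, (FreeGroup.of () ^ v, Multiplicative.ofAdd (0 : ℤ)) ∈ K ↔ (p : ℤ) ∣ v := by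
      have hA1 : ∀ k : ℕ, (FreeGroup.of () ^ (k : ℤ), Multiplicative.ofAdd (0 : ℤ)) ∈ K ↔ p ∣ k := by
        intro k
        rw [← hA () 1 k]
        simp [genA]
      intro v
      obtain ⟨k, rfl | rfl⟩ := v.eq_nat_or_neg
      · rw [hA1, Int.natCast_dvd_natCast]
      · rw [← inv_mem_iff]
        have : ((FreeGroup.of () ^ (-(k : ℤ)), Multiplicative.ofAdd (0 : ℤ)) : FreeByZ Unit)⁻¹
            = (FreeGroup.of () ^ (k : ℤ), Multiplicative.ofAdd (0 : ℤ)) := by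
          simp
        rw [this, hA1, dvd_neg, Int.natCast_dvd_natCast]
    have hker : (planeHom p (-(u : ZMod p))).ker = K := by
      ext ⟨h, z⟩
      obtain ⟨v, rfl⟩ := exists_zpow_eq h
      obtain ⟨z, rfl⟩ := Multiplicative.ofAdd.surjective z
      have h1 : ((FreeGroup.of () ^ v, Multiplicative.ofAdd z) : FreeByZ Unit)
          = (FreeGroup.of () ^ (v - u * z), Multiplicative.ofAdd (0 : ℤ)) *
            (FreeGroup.of () ^ u, Multiplicative.ofAdd 1) ^ z := by
        refine Prod.ext ?_ ?_
        · simp [← zpow_mul, ← zpow_add]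
        · simp [← ofAdd_zsmul]
      rw [mem_ker_planeHom, h1, Subgroup.mul_mem_cancel_right _ (K.zpow_mem hg z), hA',
        ← ZMod.intCast_zmod_eq_zero_iff_dvd]
      push_cast
      ring_nf
    refine ⟨-(u : ZMod p), ?_, hker⟩
    refine Nat.dvd_right_iff_eq.mp fun k => ?_
    rw [← mem_ordSet_genT.mp hT k, ← hker]
    have := mem_ker_planeHom (p := p) (x := -(u : ZMod p)) (v := 0) (z := k)
    rw [zpow_zero] at this
    rw [this, addOrderOf_dvd_iff_nsmul_eq_zero]
    simp
  · rintro ⟨x, hx, rfl⟩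
    refine ⟨⟨fun j δ k => ?_, ?_⟩, ?_⟩
    · rw [MonoidHom.mem_ker, map_mul, map_mul, map_inv, mul_inv_eq_one, mul_eq_left,
        ← MonoidHom.mem_ker]
      have h1 : (genA j : FreeByZ Unit) ^ k = (FreeGroup.of () ^ (k : ℤ), Multiplicative.ofAdd 0) := by
        refine Prod.ext (by simp [genA]) (by simp [genA])
      rw [h1, mem_ker_planeHom]
      simp [ZMod.natCast_eq_zero_iff]
    · rw [mem_ordSet_genT]
      intro k
      have := mem_ker_planeHom (p := p) (x := x) (v := 0) (z := k)
      rw [zpow_zero] at this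
      rw [this, ← hx, addOrderOf_dvd_iff_nsmul_eq_zero]
      simp
    · obtain ⟨v, hv⟩ := ZMod.intCast_surjective (-x)
      refine ⟨FreeGroup.of () ^ v, ?_⟩
      rw [mem_ker_planeHom, hv]
      simp

theorem planeHom_ker_injective (p : ℕ) :
    Function.Injective fun x : ZMod p => (planeHom p x).ker := by
  intro x y h
  obtain ⟨v, hv⟩ := ZMod.intCast_surjective (-x)
  have h1 : (FreeGroup.of () ^ v, Multiplicative.ofAdd 1) ∈ (planeHom p x).ker := by
    rw [mem_ker_planeHom, hv]
    simp
  have h2 : (FreeGroup.of () ^ v, Multiplicative.ofAdd 1) ∈ (planeHom p y).ker := by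
    rw [← show (planeHom p x).ker = (planeHom p y).ker from h]
    exact h1
  rw [mem_ker_planeHom, hv] at h2
  simp only [Int.cast_one, one_mul] at h2
  exact (neg_add_eq_zero.mp h2)

theorem numSubgroups_unit_conn {p : ℕ} (hp : p ≠ 0) (i k : ℕ) :
    numSubgroups (admSetT (fun _ : Unit => p) i ∩ connSet Unit) k
      = if k = p ∧ i ∣ p then i.totient else 0 := by
  have : NeZero p := ⟨hp⟩
  by_cases hk : k = p
  · subst hk
    have e : {K : Subgroup (FreeByZ Unit) //
        K ∈ admSetT (fun _ : Unit => k) i ∩ connSet Unit ∧ K.index = k}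
        ≃ {x : ZMod k // addOrderOf x = i} :=
      (Equiv.ofBijective (fun x : {x : ZMod k // addOrderOf x = i} =>
        (⟨(planeHom k x.1).ker, (mem_admSetT_inter_connSet_iff _).mpr ⟨x.1, x.2, rfl⟩,
          index_ker_planeHom _ _⟩ : {K : Subgroup (FreeByZ Unit) //
            K ∈ admSetT (fun _ : Unit => k) i ∩ connSet Unit ∧ K.index = k})) (by
        constructor
        · intro x y h
          exact Subtype.ext (planeHom_ker_injective k (congrArg Subtype.val h))
        · rintro ⟨K, hK, -⟩
          obtain ⟨x, hx, rfl⟩ := (mem_admSetT_inter_connSet_iff K).mp hK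
          exact ⟨⟨x, hx⟩, rfl⟩)).symm
    rw [numSubgroups, Nat.card_congr e, Nat.card_eq_fintype_card, Fintype.card_subtype]
    split_ifs with h
    · exact IsAddCyclic.card_addOrderOf_eq_totient (by rw [ZMod.card]; exact h.2)
    · rw [Finset.card_eq_zero, Finset.filter_eq_empty_iff]
      rintro x - rfl
      refine h ⟨rfl, ?_⟩
      have := addOrderOf_dvd_card (x := x)
      rwa [ZMod.card] at this
  · rw [if_neg (fun h => hk h.1), numSubgroups, Nat.card_eq_zero]
    left
    refine ⟨fun K => hk ?_⟩
    obtain ⟨x, -, hx⟩ := (mem_admSetT_inter_connSet_iff K.1).mp K.2.1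
    rw [← K.2.2, ← hx, index_ker_planeHom]

/-- The number of subgroups of index `i * j` of `ℤ × ℤ` modulo which the generators have orders
`p` and `i`. -/
theorem numSubgroups_unit {p i j : ℕ} (hp : p ≠ 0) (hi : i ≠ 0) (hj : j ≠ 0) :
    numSubgroups (admSetT (fun _ : Unit => p) i) (i * j)
      = ∑ δ ∈ (i.gcd p).divisors, if j * δ = p then δ.totient else 0 := by
  have h1 := numSubgroups_eq_sum_divisors (𝓢 := admSetT (fun _ : Unit => p) i)
    (𝓣 := fun d => {K | d ∣ i ∧ K ∈ admSetT (fun _ : Unit => p) (i / d)})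
    (fun d hd K hK => by
      change _ ∈ admSet _ ∧ _ ∈ ordSet _ _ ↔ _
      rw [map_scaleHom_mem_admSet hd, map_scaleHom_mem_ordSet hd]
      exact and_left_comm) (mul_ne_zero hi hj)
  have h2 : ∀ d, numSubgroups ({K | d ∣ i ∧ K ∈ admSetT (fun _ : Unit => p) (i / d)} ∩ connSet Unit)
      (i * j / d) = if d ∣ i ∧ (i * j / d = p ∧ (i / d) ∣ p) then (i / d).totient else 0 := by
    intro d
    by_cases hd : d ∣ i
    · have : {K | d ∣ i ∧ K ∈ admSetT (fun _ : Unit => p) (i / d)}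
          = admSetT (fun _ : Unit => p) (i / d) := by
        ext K
        simp [hd]
      rw [this, numSubgroups_unit_conn hp]
      simp [hd]
    · rw [if_neg (fun h => hd h.1), numSubgroups, Nat.card_eq_zero]
      left
      exact ⟨fun K => hd K.2.1.1.1⟩
  have h3 : ∀ d ∈ i.divisors, (if d ∣ i ∧ (i * j / d = p ∧ (i / d) ∣ p) then (i / d).totient else 0)
      = if j * (i / d) = p then (i / d).totient else 0 := by
    intro d hd
    have hdi := Nat.dvd_of_mem_divisors hd
    rw [mul_comm i j, Nat.mul_div_assoc j hdi]
    refine if_congr ⟨fun h => h.2.1, fun h => ⟨hdi, h, ⟨j, ?_⟩⟩⟩ rfl rfl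
    rw [← h, mul_comm]
  rw [h1, Finset.sum_congr rfl fun d _ => h2 d]
  calc _ = ∑ d ∈ i.divisors,
        (if d ∣ i ∧ (i * j / d = p ∧ (i / d) ∣ p) then (i / d).totient else 0) := by
        symm
        refine Finset.sum_subset (Nat.divisors_subset_of_dvd (mul_ne_zero hi hj)
          (dvd_mul_right i j)) fun d _ hd => if_neg fun h => hd ?_
        exact Nat.mem_divisors.mpr ⟨h.1, hi⟩
    _ = ∑ d ∈ i.divisors, if j * (i / d) = p then (i / d).totient else 0 :=
        Finset.sum_congr rfl h3
    _ = ∑ δ ∈ i.divisors, if j * δ = p then δ.totient else 0 :=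
        Nat.sum_div_divisors i fun δ => if j * δ = p then δ.totient else 0
    _ = _ := by
        symm
        refine Finset.sum_subset (Nat.divisors_subset_of_dvd hi (Nat.gcd_dvd_left i p))
          fun δ hδ hδ' => if_neg fun h => hδ' ?_
        exact Nat.mem_divisors.mpr ⟨Nat.dvd_gcd (Nat.dvd_of_mem_divisors hδ) ⟨j, by
          rw [← h, mul_comm]⟩, (Nat.gcd_pos_of_pos_left _ (Nat.pos_of_ne_zero hi)).ne'⟩

end SubgroupCounting

/-! ### The factors `P_n`, `Q_n` and the logarithm of their Hadamard product -/

section CycleFactor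

open PowerSeries

variable {ι : Type}

theorem numSubgroups_eq_zero [Finite ι] (m : ι → ℕ) {i n : ℕ} (hi : i ≠ 0) (hn : ¬ i ∣ n) :
    numSubgroups (admSetT m i) n = 0 := by
  have hn0 : n ≠ 0 := by rintro rfl; exact hn (dvd_zero _)
  have h := numSubgroups_le (conjClosed_admSetT m i) hn0
  rw [actDensity_eq_zero m hi hn, mul_zero] at h
  exact_mod_cast le_antisymm h (Nat.cast_nonneg _)

/-- The recurrence for the densities, restricted to the multiples of `i`. -/
theorem mul_actDensity_mul [Finite ι] (m : ι → ℕ) {i : ℕ} (hi : i ≠ 0) (k : ℕ) :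
    k * actDensity (admSetT m i) (i * k) = ∑ j ∈ Finset.Icc 1 k,
      ((numSubgroups (admSetT m i) (i * j) : ℚ) / i) * actDensity (admSetT m i) (i * (k - j)) := by
  have hi' : (i : ℚ) ≠ 0 := by exact_mod_cast hi
  have h := mul_actDensity (conjClosed_admSetT m i) (i * k)
  have h2 : ∑ l ∈ Finset.Icc 1 (i * k),
      (numSubgroups (admSetT m i) l : ℚ) * actDensity (admSetT m i) (i * k - l)
      = ∑ j ∈ Finset.Icc 1 k, (numSubgroups (admSetT m i) (i * j) : ℚ) *
          actDensity (admSetT m i) (i * (k - j)) := by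
    symm
    refine Finset.sum_of_injOn (fun j => i * j) ?_ ?_ ?_ ?_
    · intro a _ b _ hab
      exact Nat.eq_of_mul_eq_mul_left (Nat.pos_of_ne_zero hi) hab
    · intro j hj
      simp only [Finset.coe_Icc, Set.mem_Icc] at hj ⊢
      exact ⟨Nat.mul_pos (Nat.pos_of_ne_zero hi) hj.1, Nat.mul_le_mul_left i hj.2⟩
    · intro l hl hl'
      rw [numSubgroups_eq_zero m hi, Nat.cast_zero, zero_mul]
      rintro ⟨j, rfl⟩
      rw [Finset.mem_Icc] at hl
      refine hl' ⟨j, ?_, rfl⟩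
      simp only [Finset.coe_Icc, Set.mem_Icc]
      refine ⟨Nat.pos_of_ne_zero ?_, Nat.le_of_mul_le_mul_left hl.2 (Nat.pos_of_ne_zero hi)⟩
      rintro rfl
      omega
    · intro j _
      rw [Nat.mul_sub]
  rw [h2] at h
  push_cast at h
  apply mul_left_cancel₀ hi'
  rw [← mul_assoc, h, Finset.mul_sum]
  refine Finset.sum_congr rfl fun j _ => ?_
  field_simp

/-- The exponent of `cycleFactor p i`. -/
noncomputable def cycleExponent (p i : ℕ) : ℚ⟦X⟧ :=
  C (1 / ((i : ℚ) * p)) * ∑ d ∈ (i.gcd p).divisors,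
        C ((d : ℚ) * d.totient) * (X : ℚ⟦X⟧) ^ (p / d)

theorem coeff_cycleExponent (p i j : ℕ) : coeff j (cycleExponent p i)
    = 1 / ((i : ℚ) * p) * ∑ d ∈ (i.gcd p).divisors,
        if j = p / d then (d : ℚ) * d.totient else 0 := by
  rw [cycleExponent, coeff_C_mul, map_sum]
  congr 1
  refine Finset.sum_congr rfl fun d _ => ?_
  rw [coeff_C_mul, coeff_X_pow]
  simp

theorem constantCoeff_cycleExponent {p i : ℕ} (hp : p ≠ 0) :
    constantCoeff (cycleExponent p i) = 0 := by
  rw [← coeff_zero_eq_constantCoeff_apply, coeff_cycleExponent, Finset.sum_eq_zero, mul_zero]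
  intro d hd
  rw [if_neg]
  have hdp : d ∣ p := (Nat.dvd_of_mem_divisors hd).trans (Nat.gcd_dvd_right i p)
  exact (Nat.div_pos (Nat.le_of_dvd (Nat.pos_of_ne_zero hp) hdp)
    (Nat.pos_of_mem_divisors hd)).ne

theorem mul_coeff_cycleExponent {p i j : ℕ} (hp : p ≠ 0) (hi : i ≠ 0) (hj : j ≠ 0) :
    j * coeff j (cycleExponent p i)
      = (numSubgroups (admSetT (fun _ : Unit => p) i) (i * j) : ℚ) / i := by
  have hp' : (p : ℚ) ≠ 0 := by exact_mod_cast hp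
  have hi' : (i : ℚ) ≠ 0 := by exact_mod_cast hi
  rw [coeff_cycleExponent, numSubgroups_unit hp hi hj, Nat.cast_sum, Finset.sum_div,
    Finset.mul_sum, Finset.mul_sum]
  refine Finset.sum_congr rfl fun d hd => ?_
  have hdp : d ∣ p := (Nat.dvd_of_mem_divisors hd).trans (Nat.gcd_dvd_right i p)
  have hd0 := Nat.pos_of_mem_divisors hd
  have hiff : j = p / d ↔ j * d = p := by
    rw [eq_comm, Nat.div_eq_iff_eq_mul_left hd0 hdp, eq_comm]
  by_cases h : j * d = p
  · rw [if_pos (hiff.mpr h), if_pos h, ← h]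
    have hj' : (j : ℚ) ≠ 0 := by exact_mod_cast hj
    have hd' : (d : ℚ) ≠ 0 := by exact_mod_cast hd0.ne'
    push_cast
    field_simp
  · rw [if_neg (fun h' => h (hiff.mp h')), if_neg h]
    simp

/-- The coefficients of `cycleFactor p i` count the permutations with cycles of length `p` in the
centralizer of a permutation with cycles of length `i`. -/
theorem coeff_cycleFactor {p i : ℕ} (hp : p ≠ 0) (hi : i ≠ 0) (k : ℕ) :
    coeff k (cycleFactor p i) = actDensity (admSetT (fun _ : Unit => p) i) (i * k) := by
  have hL := constantCoeff_cycleExponent (i := i) hp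
  have hdef : cycleFactor p i = (exp ℚ).subst (cycleExponent p i) := rfl
  refine recurrence_unique (x := fun k => coeff k (cycleFactor p i))
    (y := fun k => actDensity (admSetT (fun _ : Unit => p) i) (i * k))
    (c := fun j => (numSubgroups (admSetT (fun _ : Unit => p) i) (i * j) : ℚ) / i) ?_ ?_ ?_ k
  · simp only [mul_zero]
    rw [actDensity_zero, hdef, coeff_zero_eq_constantCoeff_apply, constantCoeff_exp_subst hL]
  · intro k
    rw [hdef, coeff_exp_subst_recurrence hL]
    refine Finset.sum_congr rfl fun j hj => ?_
    rw [mul_coeff_cycleExponent hp hi (by rw [Finset.mem_Icc] at hj; omega)]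
  · exact fun k => mul_actDensity_mul _ hi k

/-- The cycle lengths of the two generators of a `(p, q)`-hypermap. -/
def pqOrders (p q : ℕ) : Bool → ℕ := fun b => cond b q p

theorem coeff_hadamard_cycleFactor {p q i : ℕ} (hp : p ≠ 0) (hq : q ≠ 0) (hi : i ≠ 0) (k : ℕ) :
    coeff k (hadamard i (cycleFactor p i) (cycleFactor q i))
      = actDensity (admSetT (pqOrders p q) i) (i * k) := by
  have hw : ((i : ℚ) ^ k * k.factorial) ≠ 0 := by
    have := Nat.pos_of_ne_zero hi
    positivity
  have h := actDensity_mul_weight (pqOrders p q) hi k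
  rw [Fintype.prod_bool] at h
  rw [hadamard, coeff_mk, coeff_cycleFactor hp hi, coeff_cycleFactor hq hi, div_eq_iff hw, h]
  simp only [pqOrders, cond_true, cond_false]
  rw [mul_comm]

theorem constantCoeff_hadamard_cycleFactor {p q i : ℕ} (hp : p ≠ 0) (hq : q ≠ 0) (hi : i ≠ 0) :
    constantCoeff (hadamard i (cycleFactor p i) (cycleFactor q i)) = 1 := by
  rw [← coeff_zero_eq_constantCoeff_apply, coeff_hadamard_cycleFactor hp hq hi, mul_zero,
    actDensity_zero]

theorem coeff_logOf_hadamard {p q i j : ℕ} (hp : p ≠ 0) (hq : q ≠ 0) (hi : i ≠ 0) (hj : j ≠ 0) :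
    coeff j (logOf (hadamard i (cycleFactor p i) (cycleFactor q i)))
      = (numSubgroups (admSetT (pqOrders p q) i) (i * j) : ℚ) / ((i * j : ℕ) : ℚ) := by
  have h := coeff_logOf_of_recurrence (constantCoeff_hadamard_cycleFactor hp hq hi)
    (c := fun j => (numSubgroups (admSetT (pqOrders p q) i) (i * j) : ℚ) / i) (fun k => by
      simp_rw [coeff_hadamard_cycleFactor hp hq hi]
      exact mul_actDensity_mul _ hi k) hj
  have hi' : (i : ℚ) ≠ 0 := by exact_mod_cast hi
  have hj' : (j : ℚ) ≠ 0 := by exact_mod_cast hj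
  push_cast
  rw [eq_div_iff (mul_ne_zero hi' hj')]
  rw [eq_div_iff hi'] at h
  linarith

end CycleFactor

/-! ### Hypermaps as transitive representations -/

section Hypermaps

variable {D : Type}

/-- The pair `w` generates a transitive group, and its members have cycles of lengths `p` and `q`
respectively. -/
def IsPQPair (p q : ℕ) (w : Bool → Equiv.Perm D) : Prop :=
  (∀ j, Semireg (w j) (pqOrders p q j)) ∧ ∀ x y, ∃ g, FreeGroup.lift w g x = y

theorem isPretransitive_closure_iff (w : Bool → Equiv.Perm D) {σ : Equiv.Perm D}
    (hσ : (w false * w true)⁻¹ = σ) :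
    MulAction.IsPretransitive (Subgroup.closure ({w false, σ} : Set (Equiv.Perm D))) D ↔
      ∀ x y, ∃ g, FreeGroup.lift w g x = y := by
  subst hσ
  have h : Subgroup.closure ({w false, (w false * w true)⁻¹} : Set (Equiv.Perm D))
      = (FreeGroup.lift w).range := by
    rw [FreeGroup.range_lift_eq_closure, Bool.range_eq]
    apply le_antisymm
    · rw [Subgroup.closure_le]
      have h0 := Subgroup.subset_closure (k := ({w false, w true} : Set (Equiv.Perm D)))
      rintro x (rfl | rfl)
      · exact h0 (by simp)
      · exact inv_mem (mul_mem (h0 (by simp)) (h0 (by simp)))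
    · rw [Subgroup.closure_le]
      have h0 := Subgroup.subset_closure
        (k := ({w false, (w false * w true)⁻¹} : Set (Equiv.Perm D)))
      rintro x (rfl | rfl)
      · exact h0 (by simp)
      · have h1 : w true = (w false)⁻¹ * ((w false * w true)⁻¹)⁻¹ := by group
        have h2 := mul_mem (inv_mem (h0 (Set.mem_insert _ _)))
          (inv_mem (h0 (Set.mem_insert_of_mem _ rfl)))
        rwa [← h1] at h2
  rw [h]
  constructor
  · intro ht x y
    obtain ⟨⟨_, g, rfl⟩, hg⟩ := ht.exists_smul_eq x y
    exact ⟨g, hg⟩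
  · intro ht
    exact ⟨fun x y => let ⟨g, hg⟩ := ht x y; ⟨⟨_, g, rfl⟩, hg⟩⟩

/-- A `(p, q)`-hypermap is determined by the permutations `α` and `φ`. -/
def hypermapEquiv [hD : Nonempty D] (p q : ℕ) :
    {H : Hypermap D // H.IsPQ p q} ≃ {w : Bool → Equiv.Perm D // IsPQPair p q w} where
  toFun H := ⟨fun b => cond b H.1.φ H.1.α, by
    refine ⟨fun j => ?_, ?_⟩
    · cases j
      · exact H.2.1
      · exact H.2.2
    · exact (isPretransitive_closure_iff (fun b => cond b H.1.φ H.1.α) (σ := H.1.σ)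
        (by simp [Hypermap.φ])).mp H.1.transitive⟩
  invFun w := ⟨⟨w.1 false, (w.1 false * w.1 true)⁻¹, hD,
      (isPretransitive_closure_iff w.1 rfl).mpr w.2.2⟩, w.2.1 false, by
    have : (w.1 false)⁻¹ * ((w.1 false * w.1 true)⁻¹)⁻¹ = w.1 true := by group
    simp only [Hypermap.φ, this]
    exact w.2.1 true⟩
  left_inv H := by
    refine Subtype.ext (Hypermap.ext rfl ?_)
    simp [Hypermap.φ]
  right_inv w := by
    refine Subtype.ext (funext fun b => ?_)
    cases b
    · rfl
    · simp [Hypermap.φ]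

theorem lift_genA (ρ : FreeByZ Bool →* Equiv.Perm D) (g : FreeGroup Bool) :
    FreeGroup.lift (fun j => ρ (genA j)) g = ρ (g, 1) := by
  have h1 : FreeGroup.lift (fun j => ρ (genA j)) = ρ.comp (MonoidHom.inl _ _) := by
    ext j
    simp [genA]
  rw [h1]
  rfl

/-- The transitive representations with stabilizers in `admSet m ∩ connSet ι` are those for which
the free factor alone is transitive. -/
theorem transitive_conn_iff {p q : ℕ} (ρ : FreeByZ Bool →* Equiv.Perm D) :
    ((∀ x, homStab ρ x ∈ admSet (pqOrders p q) ∩ connSet Bool) ∧ ∀ x y, ∃ g, ρ g x = y) ↔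
      IsPQPair p q (fun j => ρ (genA j)) := by
  simp only [IsPQPair, lift_genA]
  constructor
  · rintro ⟨h1, h2⟩
    refine ⟨homStab_mem_admSet_iff.mp fun x => (h1 x).1, fun x y => ?_⟩
    obtain ⟨⟨g, z⟩, hg⟩ := h2 x y
    obtain ⟨z, rfl⟩ := Multiplicative.ofAdd.surjective z
    obtain ⟨h, hh⟩ := (h1 x).2
    have h3 : (h, Multiplicative.ofAdd 1) ^ (-z) ∈ homStab ρ x := Subgroup.zpow_mem _ hh _
    rw [mem_homStab] at h3
    refine ⟨g * h ^ (-z), ?_⟩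
    have h4 : ((g * h ^ (-z), 1) : FreeByZ Bool)
        = (g, Multiplicative.ofAdd z) * (h, Multiplicative.ofAdd 1) ^ (-z) := by
      refine Prod.ext rfl ?_
      simp [← ofAdd_zsmul]
    rw [h4, map_mul, Equiv.Perm.mul_apply, h3, hg]
  · rintro ⟨h1, h2⟩
    refine ⟨fun x => ⟨homStab_mem_admSet_iff.mpr h1 x, ?_⟩, fun x y => ?_⟩
    · obtain ⟨g, hg⟩ := h2 (ρ genT x) x
      refine ⟨g, ?_⟩
      rw [mem_homStab]
      have h4 : ((g, Multiplicative.ofAdd 1) : FreeByZ Bool) = (g, 1) * genT := by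
        refine Prod.ext (by simp [genT]) (by simp [genT])
      rw [h4, map_mul, Equiv.Perm.mul_apply, hg]
    · obtain ⟨g, hg⟩ := h2 x y
      exact ⟨_, hg⟩

theorem transitive_one_iff {p q : ℕ} (ρ : FreeByZ Bool →* Equiv.Perm D) :
    ((∀ x, homStab ρ x ∈ admSetT (pqOrders p q) 1) ∧ ∀ x y, ∃ g, ρ g x = y) ↔
      IsPQPair p q (fun j => ρ (genA j)) ∧ ρ genT = 1 := by
  rw [← transitive_conn_iff, homStab_mem_admSetT_iff, semireg_one_iff, ← homStab_mem_admSet_iff]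
  constructor
  · rintro ⟨⟨h1, h2⟩, h3⟩
    refine ⟨⟨fun x => ⟨h1 x, 1, ?_⟩, h3⟩, h2⟩
    change ρ genT x = x
    rw [h2]
    rfl
  · rintro ⟨⟨h1, h3⟩, h2⟩
    exact ⟨⟨fun x => (h1 x).1, h2⟩, h3⟩

/-- Permutations act on hypermaps by simultaneous conjugation. -/
instance : MulAction (Equiv.Perm D) (Hypermap D) where
  smul ψ H := ⟨ψ * H.α * ψ⁻¹, ψ * H.σ * ψ⁻¹, H.nonempty, by
    have h : Subgroup.closure ({ψ * H.α * ψ⁻¹, ψ * H.σ * ψ⁻¹} : Set (Equiv.Perm D))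
        = (Subgroup.closure {H.α, H.σ}).map (MulAut.conj ψ).toMonoidHom := by
      rw [MonoidHom.map_closure, Set.image_pair]
      rfl
    rw [h]
    refine ⟨fun x y => ?_⟩
    obtain ⟨⟨g, hg⟩, hgx⟩ := H.transitive.exists_smul_eq (ψ⁻¹ x) (ψ⁻¹ y)
    refine ⟨⟨_, g, hg, rfl⟩, ?_⟩
    change ψ (g (ψ⁻¹ x)) = y
    have hgx' : g (ψ⁻¹ x) = ψ⁻¹ y := hgx
    rw [hgx']
    simp⟩
  one_smul H := Hypermap.ext (by change 1 * _ * _ = _; simp) (by change 1 * _ * _ = _; simp)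
  mul_smul ψ χ H := Hypermap.ext
    (by change ψ * χ * H.α * (ψ * χ)⁻¹ = ψ * (χ * H.α * χ⁻¹) * ψ⁻¹; group)
    (by change ψ * χ * H.σ * (ψ * χ)⁻¹ = ψ * (χ * H.σ * χ⁻¹) * ψ⁻¹; group)

theorem smul_eq_iff_isIso {ψ : Equiv.Perm D} {H₁ H₂ : Hypermap D} :
    ψ • H₁ = H₂ ↔ Hypermap.IsIso ψ H₁ H₂ := by
  rw [Hypermap.ext_iff]
  rfl

theorem Hypermap.IsPQ.smul {p q : ℕ} {H : Hypermap D} (h : H.IsPQ p q) (ψ : Equiv.Perm D) :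
    (ψ • H).IsPQ p q := by
  refine ⟨Semireg.conj h.1 ψ, ?_⟩
  have : (ψ • H).φ = ψ * H.φ * ψ⁻¹ := by
    change (ψ * H.α * ψ⁻¹)⁻¹ * (ψ * H.σ * ψ⁻¹)⁻¹ = ψ * (H.α⁻¹ * H.σ⁻¹) * ψ⁻¹
    group
  rw [this]
  exact Semireg.conj h.2 ψ

instance (p q n : ℕ) : MulAction (Equiv.Perm (Fin n)) (PQHypermap p q n) where
  smul ψ H := ⟨ψ • H.1, H.2.smul ψ⟩
  one_smul H := Subtype.ext (one_smul _ H.1)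
  mul_smul ψ χ H := Subtype.ext (mul_smul ψ χ H.1)

theorem pq_smul_eq_iff {p q n : ℕ} {ψ : Equiv.Perm (Fin n)} {H₁ H₂ : PQHypermap p q n} :
    ψ • H₁ = H₂ ↔ Hypermap.IsIso ψ H₁.1 H₂.1 := by
  rw [← smul_eq_iff_isIso, Subtype.ext_iff]
  rfl

theorem numIsoClasses_mul_factorial (p q n : ℕ) :
    numIsoClasses p q n * n.factorial
      = Nat.card (Σ ψ : Equiv.Perm (Fin n), MulAction.fixedBy (PQHypermap p q n) ψ) := by
  have h : pqIsoSetoid p q n = MulAction.orbitRel (Equiv.Perm (Fin n)) (PQHypermap p q n) := by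
    ext H₁ H₂
    rw [MulAction.orbitRel_apply, MulAction.mem_orbit_symm]
    exact exists_congr fun ψ => pq_smul_eq_iff.symm
  rw [Nat.card_congr (MulAction.sigmaFixedByEquivOrbitsProdGroup _ _), Nat.card_prod,
    numIsoClasses, h, Nat.card_perm, Nat.card_fin]

/-- A rooted hypermap has no automorphism besides the identity, because the group generated by
`α` and `σ` is transitive. -/
theorem eq_one_of_isIso {ψ : Equiv.Perm D} {H : Hypermap D} (h : Hypermap.IsIso ψ H H) {x : D}
    (hx : ψ x = x) : ψ = 1 := by
  have hc : ∀ g ∈ Subgroup.closure ({H.α, H.σ} : Set (Equiv.Perm D)), ψ * g = g * ψ := by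
    intro g hg
    induction hg using Subgroup.closure_induction with
    | mem g hg =>
      rcases hg with rfl | rfl
      · exact mul_inv_eq_iff_eq_mul.mp h.1
      · exact mul_inv_eq_iff_eq_mul.mp h.2
    | one => simp
    | mul a b _ _ ha hb => rw [← mul_assoc, ha, mul_assoc, hb, mul_assoc]
    | inv a _ ha => exact (Commute.inv_right (show Commute ψ a from ha))
  ext y
  obtain ⟨⟨g, hg⟩, hgx⟩ := H.transitive.exists_smul_eq x y
  have hgx' : g x = y := hgx
  have := DFunLike.congr_fun (hc g hg) x
  rw [Equiv.Perm.mul_apply, Equiv.Perm.mul_apply, hx, hgx'] at this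
  exact this

theorem numRooted_mul_factorial (p q n : ℕ) :
    numRooted p q n * n.factorial = Nat.card (PQHypermap p q n) * n := by
  have h : pqRootedIsoSetoid p q n
      = MulAction.orbitRel (Equiv.Perm (Fin n)) (PQHypermap p q n × Fin n) := by
    ext H₁ H₂
    rw [MulAction.orbitRel_apply, MulAction.mem_orbit_symm]
    refine exists_congr fun ψ => ?_
    rw [← pq_smul_eq_iff]
    exact (Prod.ext_iff (x := ψ • H₁) (y := H₂)).symm
  have e : PQHypermap p q n × Fin n ≃
      Σ ψ : Equiv.Perm (Fin n), MulAction.fixedBy (PQHypermap p q n × Fin n) ψ :=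
    Equiv.ofBijective (fun w => ⟨1, w, one_smul _ w⟩) (by
      constructor
      · intro v w hvw
        simp only [Sigma.mk.injEq, heq_eq_eq, true_and] at hvw
        exact congrArg Subtype.val hvw
      · rintro ⟨ψ, ⟨H, x⟩, hw⟩
        have hw' := Prod.ext_iff.mp (MulAction.mem_fixedBy.mp hw)
        have : ψ = 1 := eq_one_of_isIso (pq_smul_eq_iff.mp hw'.1) hw'.2
        subst this
        exact ⟨(H, x), rfl⟩)
  have h2 := Nat.card_congr
    (MulAction.sigmaFixedByEquivOrbitsProdGroup (Equiv.Perm (Fin n)) (PQHypermap p q n × Fin n))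
  rw [← Nat.card_congr e, Nat.card_prod, Nat.card_prod, Nat.card_perm, Nat.card_fin] at h2
  rw [h2, numRooted, h]

/-- Hypermaps together with an automorphism are transitive representations of `FreeByZ Bool` for
which the free factor is transitive. -/
theorem card_fixed_eq (p q : ℕ) {n : ℕ} (hn : n ≠ 0) :
    Nat.card (Σ ψ : Equiv.Perm (Fin n), MulAction.fixedBy (PQHypermap p q n) ψ)
      = Nat.card {ρ : Act (admSet (pqOrders p q) ∩ connSet Bool) (Fin n) //
          ∀ x y, ∃ g, ρ.1 g x = y} := by
  have : NeZero n := ⟨hn⟩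
  let e₁ : {ρ : Act (admSet (pqOrders p q) ∩ connSet Bool) (Fin n) // ∀ x y, ∃ g, ρ.1 g x = y}
      ≃ {ρ : FreeByZ Bool →* Equiv.Perm (Fin n) // IsPQPair p q (fun j => ρ (genA j))} :=
    (Equiv.subtypeSubtypeEquivSubtypeInter _ _).trans
      (Equiv.subtypeEquivRight fun ρ => transitive_conn_iff ρ)
  let e₂ : (Σ ψ : Equiv.Perm (Fin n), MulAction.fixedBy (PQHypermap p q n) ψ) ≃
      {ρ : FreeByZ Bool →* Equiv.Perm (Fin n) // IsPQPair p q (fun j => ρ (genA j))} := by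
    refine Equiv.trans ?_ ((homEquiv Bool (Fin n)).subtypeEquiv
      (q := fun w => IsPQPair p q w.1.1) fun ρ => Iff.rfl).symm
    refine
      { toFun := fun z => ⟨⟨((hypermapEquiv p q z.2.1).1, z.1), ?_⟩, (hypermapEquiv p q z.2.1).2⟩
        invFun := fun w => ⟨w.1.1.2, (hypermapEquiv p q).symm ⟨w.1.1.1, w.2⟩, ?_⟩
        left_inv := fun z => ?_
        right_inv := fun w => ?_ }
    · obtain ⟨ψ, H, hH⟩ := z
      have h := pq_smul_eq_iff.mp (MulAction.mem_fixedBy.mp hH)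
      have h1 : Commute H.1.α ψ := (mul_inv_eq_iff_eq_mul.mp h.1).symm
      have h2 : Commute H.1.σ ψ := (mul_inv_eq_iff_eq_mul.mp h.2).symm
      intro j
      cases j
      · exact h1
      · exact h1.inv_left.mul_left h2.inv_left
    · rw [MulAction.mem_fixedBy, pq_smul_eq_iff]
      have h1 := (w.1.2 false).eq
      have h2 : Commute (w.1.1.1 false * w.1.1.1 true)⁻¹ w.1.1.2 :=
        ((w.1.2 false).mul_left (w.1.2 true)).inv_left
      exact ⟨mul_inv_eq_iff_eq_mul.mpr h1.symm, mul_inv_eq_iff_eq_mul.mpr h2.eq.symm⟩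
    · obtain ⟨ψ, H, hH⟩ := z
      refine Sigma.ext rfl (heq_of_eq (Subtype.ext ?_))
      exact (hypermapEquiv p q).symm_apply_apply H
    · refine Subtype.ext (Subtype.ext (Prod.ext ?_ rfl))
      exact congrArg Subtype.val ((hypermapEquiv p q).apply_symm_apply ⟨w.1.1.1, w.2⟩)
  exact Nat.card_congr (e₂.trans e₁.symm)

theorem card_pqHypermap_eq (p q : ℕ) {n : ℕ} (hn : n ≠ 0) :
    Nat.card (PQHypermap p q n)
      = Nat.card {ρ : Act (admSetT (pqOrders p q) 1) (Fin n) // ∀ x y, ∃ g, ρ.1 g x = y} := by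
  have : NeZero n := ⟨hn⟩
  let e₁ : {ρ : Act (admSetT (pqOrders p q) 1) (Fin n) // ∀ x y, ∃ g, ρ.1 g x = y}
      ≃ {ρ : FreeByZ Bool →* Equiv.Perm (Fin n) //
          IsPQPair p q (fun j => ρ (genA j)) ∧ ρ genT = 1} :=
    (Equiv.subtypeSubtypeEquivSubtypeInter _ _).trans
      (Equiv.subtypeEquivRight fun ρ => transitive_one_iff ρ)
  let e₂ : PQHypermap p q n ≃ {ρ : FreeByZ Bool →* Equiv.Perm (Fin n) //
      IsPQPair p q (fun j => ρ (genA j)) ∧ ρ genT = 1} := by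
    refine (hypermapEquiv p q).trans (Equiv.trans ?_ ((homEquiv Bool (Fin n)).subtypeEquiv
      (q := fun w => IsPQPair p q w.1.1 ∧ w.1.2 = 1) fun ρ => Iff.rfl).symm)
    exact
      { toFun := fun w => ⟨⟨(w.1, 1), fun j => Commute.one_right _⟩, w.2, rfl⟩
        invFun := fun w => ⟨w.1.1.1, w.2.1⟩
        left_inv := fun w => rfl
        right_inv := fun w => Subtype.ext (Subtype.ext (Prod.ext rfl w.2.2.symm)) }
  exact Nat.card_congr (e₂.trans e₁.symm)

/-- The number of isomorphism classes on `n` darts in terms of subgroups. -/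
theorem mul_numIsoClasses (p q : ℕ) {n : ℕ} (hn : n ≠ 0) :
    n * numIsoClasses p q n = numSubgroups (admSet (pqOrders p q) ∩ connSet Bool) n := by
  have hconj : ConjClosed (admSet (pqOrders p q) ∩ connSet Bool) :=
    fun K hK g => ⟨conjClosed_admSet _ K hK.1 g, conjClosed_connSet K hK.2 g⟩
  have h := mul_card_transitive hconj hn
  rw [← card_fixed_eq p q hn, ← numIsoClasses_mul_factorial, ← mul_assoc, mul_comm] at h
  exact Nat.eq_of_mul_eq_mul_left (Nat.factorial_pos n) h

theorem numRooted_eq (p q : ℕ) {n : ℕ} (hn : n ≠ 0) :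
    numRooted p q n = numSubgroups (admSetT (pqOrders p q) 1) n := by
  have h := mul_card_transitive (conjClosed_admSetT (pqOrders p q) 1) hn
  rw [← card_pqHypermap_eq p q hn, mul_comm, ← numRooted_mul_factorial, mul_comm] at h
  exact Nat.eq_of_mul_eq_mul_left (Nat.factorial_pos n) h

theorem numIsoClasses_zero (p q : ℕ) : numIsoClasses p q 0 = 0 := by
  rw [numIsoClasses, Nat.card_eq_zero]
  left
  refine ⟨fun c => ?_⟩
  induction c using Quotient.inductionOn with
  | h H => exact H.1.nonempty.elim fun x => x.elim0

end Hypermaps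

/-! ### The growth series -/

section GrowthSeries

open PowerSeries

theorem exists_mem_ordSet_genT {ι : Type} {K : Subgroup (FreeByZ ι)} (hK : K.index ≠ 0) :
    ∃ i, i ≠ 0 ∧ K ∈ ordSet genT i := by
  refine ⟨Function.minimalPeriod (fun c : FreeByZ ι ⧸ K => (genT : FreeByZ ι) • c)
    ((1 : FreeByZ ι) : FreeByZ ι ⧸ K), ?_⟩
  have h : ∀ k : ℕ, (1, Multiplicative.ofAdd (k : ℤ)) ∈ K ↔ Function.minimalPeriod
      (fun c : FreeByZ ι ⧸ K => (genT : FreeByZ ι) • c) ((1 : FreeByZ ι) : FreeByZ ι ⧸ K) ∣ k := by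
    intro k
    rw [← Function.isPeriodicPt_iff_minimalPeriod_dvd, Function.IsPeriodicPt, Function.IsFixedPt,
      smul_iterate, ← genT_pow]
    change _ ↔ ((genT ^ k * 1 : FreeByZ ι) : FreeByZ ι ⧸ K) = _
    rw [eq_comm, QuotientGroup.eq]
    simp
  refine ⟨fun h0 => ?_, mem_ordSet_genT.mpr h⟩
  obtain ⟨k, hk, -, hmem⟩ := Subgroup.exists_pow_mem_of_index_ne_zero hK genT
  rw [genT_pow, h, h0, zero_dvd_iff] at hmem
  omega

/-- The subgroups in `admSet m` sorted by the order of the central generator. -/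
theorem numSubgroups_admSet_eq_sum {ι : Type} [Finite ι] (m : ι → ℕ) {n : ℕ} (hn : n ≠ 0) :
    numSubgroups (admSet m) n = ∑ i ∈ n.divisors, numSubgroups (admSetT m i) n := by
  have hfin : ∀ 𝓢 : Set (Subgroup (FreeByZ ι)),
      Finite {K : Subgroup (FreeByZ ι) // K ∈ 𝓢 ∧ K.index = n} := fun 𝓢 =>
    finite_subgroups_index 𝓢 hn
  let Φ : (Σ i : n.divisors, {K : Subgroup (FreeByZ ι) // K ∈ admSetT m i ∧ K.index = n}) →
      {K : Subgroup (FreeByZ ι) // K ∈ admSet m ∧ K.index = n} :=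
    fun z => ⟨z.2.1, z.2.2.1.1, z.2.2.2⟩
  have hΦ : Function.Bijective Φ := by
    constructor
    · rintro ⟨⟨i₁, d₁⟩, K₁, ⟨h₁, t₁⟩, j₁⟩ ⟨⟨i₂, d₂⟩, K₂, ⟨h₂, t₂⟩, j₂⟩ e
      obtain rfl : K₁ = K₂ := congrArg Subtype.val e
      obtain rfl : i₁ = i₂ := Nat.dvd_right_iff_eq.mp fun k => by rw [← t₁ 1 k, ← t₂ 1 k]
      rfl
    · rintro ⟨K, hK, hi⟩
      obtain ⟨i, hi0, hT⟩ := exists_mem_ordSet_genT (hi.trans_ne hn)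
      have hd : i ∣ n := by
        by_contra hd
        have h0 := numSubgroups_eq_zero m hi0 hd
        rw [numSubgroups, Nat.card_eq_zero] at h0
        rcases h0 with h0 | h0
        · exact h0.elim ⟨K, ⟨hK, hT⟩, hi⟩
        · exact (not_infinite_iff_finite.mpr (hfin _)) h0
      exact ⟨⟨⟨i, Nat.mem_divisors.mpr ⟨hd, hn⟩⟩, K, ⟨hK, hT⟩, hi⟩, rfl⟩
  rw [numSubgroups, ← Nat.card_congr (Equiv.ofBijective Φ hΦ), Nat.card_sigma]
  exact Finset.sum_coe_sort n.divisors (fun i => numSubgroups (admSetT m i) n)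

theorem numSubgroups_mono {Γ : Type} [Group Γ] [∀ n, Finite (Γ →* Equiv.Perm (Fin n))]
    {𝓢 𝓣 : Set (Subgroup Γ)} (h : 𝓢 ⊆ 𝓣) {n : ℕ} (hn : n ≠ 0) :
    numSubgroups 𝓢 n ≤ numSubgroups 𝓣 n := by
  have := finite_subgroups_index 𝓣 hn
  exact Nat.card_le_card_of_injective
    (fun K : {K : Subgroup Γ // K ∈ 𝓢 ∧ K.index = n} =>
      (⟨K.1, h K.2.1, K.2.2⟩ : {K : Subgroup Γ // K ∈ 𝓣 ∧ K.index = n}))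
    fun K L hKL => Subtype.ext (congrArg (fun z => z.1) hKL)

/-- Möbius inversion of the relation between all subgroups and those projecting onto the infinite
cyclic factor. -/
theorem mul_numIsoClasses_eq_sum_moebius (p q : ℕ) {n : ℕ} (hn : n ≠ 0) :
    ((n * numIsoClasses p q n : ℕ) : ℚ) = ∑ k ∈ n.divisors,
      (ArithmeticFunction.moebius k : ℚ) * numSubgroups (admSet (pqOrders p q)) (n / k) := by
  have h := (ArithmeticFunction.sum_eq_iff_sum_mul_moebius_eq (R := ℚ)
    (f := fun n => ((n * numIsoClasses p q n : ℕ) : ℚ))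
    (g := fun n => (numSubgroups (admSet (pqOrders p q)) n : ℚ))).mp (by
      intro n hn
      rw [numSubgroups_admSet _ hn.ne', ← Nat.sum_div_divisors, Nat.cast_sum]
      refine Finset.sum_congr rfl fun d hd => ?_
      rw [mul_numIsoClasses]
      exact (Nat.div_pos (Nat.divisor_le hd) (Nat.pos_of_mem_divisors hd)).ne') n
        (Nat.pos_of_ne_zero hn)
  rw [← h]
  exact (Nat.sum_divisorsAntidiagonal
    fun k l => (ArithmeticFunction.moebius k : ℚ) * numSubgroups (admSet (pqOrders p q)) l)

/-- A sum over the positive integers supported on the divisors of `M`. -/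
theorem hasSum_pnat_divisors {f : ℕ+ → ℚ} {g : ℕ → ℚ} (M : ℕ)
    (h : ∀ n : ℕ+, f n = if (n : ℕ) ∈ M.divisors then g n else 0) :
    HasSum f (∑ n ∈ M.divisors, g n) := by
  have h1 : f = (fun n : ℕ => if n ∈ M.divisors then g n else 0) ∘ ((↑) : ℕ+ → ℕ) :=
    funext h
  rw [h1, PNat.coe_injective.hasSum_iff]
  · have h2 : ∑ n ∈ M.divisors, g n = ∑ n ∈ M.divisors, if n ∈ M.divisors then g n else 0 :=
      Finset.sum_congr rfl fun n hn => (if_pos hn).symm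
    rw [h2]
    exact hasSum_sum_of_ne_finset_zero fun n hn => if_neg hn
  · intro n hn
    refine if_neg fun hmem => hn ⟨⟨n, Nat.pos_of_mem_divisors hmem⟩, rfl⟩

/-- The inner sum of the formula for the growth series. -/
theorem hasSum_logOf_subst {p q : ℕ} (hp : p ≠ 0) (hq : q ≠ 0) (k : ℕ+) :
    HasSum (fun n : ℕ+ => (logOf (hadamard n (cycleFactor p n) (cycleFactor q n))).subst
        ((X : ℚ⟦X⟧) ^ ((n : ℕ) * k)))
      (PowerSeries.mk fun m => if (k : ℕ) ∈ m.divisors then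
        (numSubgroups (admSet (pqOrders p q)) (m / k) : ℚ) / ((m / k : ℕ) : ℚ) else 0) := by
  rw [WithPiTopology.hasSum_iff_hasSum_coeff]
  intro m
  rw [coeff_mk]
  have hk := k.ne_zero
  by_cases hkm : (k : ℕ) ∈ m.divisors
  · rw [if_pos hkm]
    obtain ⟨⟨M, rfl⟩, hm⟩ := Nat.mem_divisors.mp hkm
    have hM : M ≠ 0 := (mul_ne_zero_iff.mp hm).2
    rw [Nat.mul_div_cancel_left _ k.pos, numSubgroups_admSet_eq_sum _ hM, Nat.cast_sum,
      Finset.sum_div]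
    apply hasSum_pnat_divisors M
    intro n
    rw [coeff_subst_X_pow (mul_ne_zero n.ne_zero hk)]
    have hiff : (n : ℕ) * k ∣ k * M ↔ (n : ℕ) ∈ M.divisors := by
      rw [mul_comm, Nat.mul_dvd_mul_iff_left k.pos, Nat.mem_divisors]
      simp [hM]
    refine if_ctx_congr hiff (fun hn => ?_) fun _ => rfl
    obtain ⟨⟨j, rfl⟩, -⟩ := Nat.mem_divisors.mp hn
    have hj : j ≠ 0 := (mul_ne_zero_iff.mp hM).2
    rw [show (k : ℕ) * (n * j) / (n * k) = j by
      rw [← mul_assoc, mul_comm (k : ℕ), Nat.mul_div_cancel_left _ (Nat.mul_pos n.pos k.pos)],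
      coeff_logOf_hadamard hp hq n.ne_zero hj]
    rfl
  · rw [if_neg hkm]
    convert hasSum_zero using 1
    funext n
    rw [coeff_subst_X_pow (mul_ne_zero n.ne_zero hk)]
    split_ifs with hd
    · have hm : m = 0 := by
        by_contra hm
        exact hkm (Nat.mem_divisors.mpr ⟨(dvd_mul_left _ _).trans hd, hm⟩)
      rw [hm, Nat.zero_div, coeff_zero_eq_constantCoeff_apply,
        constantCoeff_logOf (constantCoeff_hadamard_cycleFactor hp hq n.ne_zero)]
      rfl
    · rfl

theorem hasSum_isoSeries {p q : ℕ} (hp : p ≠ 0) (hq : q ≠ 0) :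
    HasSum
      (fun k : ℕ+ => PowerSeries.C ((ArithmeticFunction.moebius (k : ℕ) : ℚ) / (k : ℕ)) *
        ∑' n : ℕ+,
          (PowerSeries.logOf (hadamard n (cycleFactor p n) (cycleFactor q n))).subst
            ((PowerSeries.X : ℚ⟦X⟧) ^ ((n : ℕ) * k)))
      (isoSeries p q) := by
  simp_rw [(hasSum_logOf_subst hp hq _).tsum_eq]
  rw [WithPiTopology.hasSum_iff_hasSum_coeff]
  intro m
  have hiso : coeff m (isoSeries p q) = ∑ k ∈ m.divisors, (ArithmeticFunction.moebius k : ℚ) *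
      numSubgroups (admSet (pqOrders p q)) (m / k) / m := by
    rw [isoSeries, coeff_mk]
    rcases Nat.eq_zero_or_pos m with rfl | hm
    · simp [numIsoClasses_zero]
    · have hm' : (m : ℚ) ≠ 0 := by exact_mod_cast hm.ne'
      rw [← Finset.sum_div, ← mul_numIsoClasses_eq_sum_moebius p q hm.ne', eq_div_iff hm']
      push_cast
      ring
  rw [hiso]
  apply hasSum_pnat_divisors m
  intro k
  rw [coeff_C_mul, coeff_mk]
  split_ifs with hk
  · obtain ⟨⟨M, rfl⟩, hm⟩ := Nat.mem_divisors.mp hk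
    have hM : (M : ℚ) ≠ 0 := by exact_mod_cast (mul_ne_zero_iff.mp hm).2
    have hk' : ((k : ℕ) : ℚ) ≠ 0 := by exact_mod_cast k.ne_zero
    rw [Nat.mul_div_cancel_left _ k.pos]
    push_cast
    field_simp
  · rw [mul_zero]

end GrowthSeries

/-! ### Bounds for the densities -/

section Bounds

theorem dvd_of_numActs_ne_zero {ι : Type} {m : ι → ℕ} {i n : ℕ} (h : numActs (admSetT m i) n ≠ 0)
    {j : ι} (hj : m j ≠ 0) : m j ∣ n := by
  obtain ⟨ρ⟩ : Nonempty (Act (admSetT m i) (Fin n)) := (Nat.card_ne_zero.mp h).1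
  by_contra hn
  have h0 := numSemireg_eq_zero hj hn
  rw [numSemireg, Nat.card_eq_zero] at h0
  rcases h0 with h0 | h0
  · exact h0.elim ⟨_, (homStab_mem_admSetT_iff.mp ρ.2).1 j⟩
  · exact (not_infinite_iff_finite.mpr inferInstance) h0

theorem actDensity_unit_one (p n : ℕ) :
    actDensity (admSetT (fun _ : Unit => p) 1) n = (numSemireg p n : ℚ) / n.factorial := by
  have h1 : Semireg (1 : Equiv.Perm (Fin n)) 1 := semireg_one_iff.mpr rfl
  have h2 : numSemireg 1 n = 1 := by
    rw [numSemireg, Nat.card_eq_one_iff_unique]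
    refine ⟨⟨fun a b => Subtype.ext ?_⟩, ⟨⟨1, h1⟩⟩⟩
    rw [semireg_one_iff.mp a.2, semireg_one_iff.mp b.2]
  rw [actDensity, numActs_eq _ h1, h2]
  simp [numCentral, numSemireg]

/-- The number of pairs of permutations of `n` points with cycles of lengths `p` and `q`, divided
by `n!`. -/
noncomputable def pqDensity (p q n : ℕ) : ℝ := (actDensity (admSetT (pqOrders p q) 1) n : ℝ)

theorem pqDensity_nonneg (p q n : ℕ) : 0 ≤ pqDensity p q n := by
  rw [pqDensity]
  exact_mod_cast actDensity_nonneg _ n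

theorem pqDensity_eq_zero {p q n : ℕ} (hp : p ≠ 0) (hq : q ≠ 0) (hn : ¬ p.lcm q ∣ n) :
    pqDensity p q n = 0 := by
  have : numActs (admSetT (pqOrders p q) 1) n = 0 := by
    by_contra h
    exact hn (Nat.lcm_dvd (dvd_of_numActs_ne_zero h (j := false) hp)
      (dvd_of_numActs_ne_zero h (j := true) hq))
  rw [pqDensity, actDensity, this]
  simp

theorem pqDensity_eq {p q n a b : ℕ} (hp : p ≠ 0) (hq : q ≠ 0) (ha : n = p * a) (hb : n = q * b) :
    pqDensity p q n
      = n.factorial / (((p : ℝ) ^ a * a.factorial) * ((q : ℝ) ^ b * b.factorial)) := by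
  have h := actDensity_mul_weight (pqOrders p q) one_ne_zero n
  rw [Fintype.prod_bool, one_mul] at h
  simp only [pqOrders, cond_true, cond_false, Nat.cast_one, one_pow, one_mul] at h
  have hpa := numSemireg_mul hp a
  have hqb := numSemireg_mul hq b
  rw [← ha, ← actDensity_unit_one] at hpa
  rw [← hb, ← actDensity_unit_one] at hqb
  rw [hpa, hqb] at h
  have hf : (n.factorial : ℚ) ≠ 0 := by exact_mod_cast Nat.factorial_ne_zero _
  have h2 : actDensity (admSetT (pqOrders p q) 1) n
      = n.factorial / (((p : ℚ) ^ a * a.factorial) * ((q : ℚ) ^ b * b.factorial)) := by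
    apply mul_right_cancel₀ hf
    rw [h]
    field_simp
  rw [pqDensity, h2]
  push_cast
  rfl

/-- The weights in the recurrence for the coefficients of `cycleFactor p i` add up to at most `1`,
because the totients of the divisors of `gcd i p` add up to `gcd i p`. -/
theorem sum_numSubgroups_unit_le {p i : ℕ} (hp : p ≠ 0) (hi : i ≠ 0) (k : ℕ) :
    ∑ j ∈ Finset.Icc 1 k, numSubgroups (admSetT (fun _ : Unit => p) i) (i * j) ≤ i := by
  calc ∑ j ∈ Finset.Icc 1 k, numSubgroups (admSetT (fun _ : Unit => p) i) (i * j)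
      = ∑ j ∈ Finset.Icc 1 k, ∑ δ ∈ (i.gcd p).divisors, if j * δ = p then δ.totient else 0 := by
        refine Finset.sum_congr rfl fun j hj => numSubgroups_unit hp hi ?_
        rw [Finset.mem_Icc] at hj
        omega
    _ = ∑ δ ∈ (i.gcd p).divisors, ∑ j ∈ Finset.Icc 1 k, if j * δ = p then δ.totient else 0 :=
        Finset.sum_comm
    _ ≤ ∑ δ ∈ (i.gcd p).divisors, δ.totient := by
        refine Finset.sum_le_sum fun δ hδ => ?_
        have hδ0 := Nat.pos_of_mem_divisors hδ
        calc _ ≤ ∑ j ∈ Finset.Icc 1 k, if j = p / δ then δ.totient else 0 := by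
              refine Finset.sum_le_sum fun j _ => ?_
              split_ifs with h1 h2
              · exact le_rfl
              · exact absurd (Nat.div_eq_of_eq_mul_left hδ0 h1.symm).symm h2
              · exact Nat.zero_le _
              · exact le_rfl
          _ ≤ δ.totient := by
              rw [Finset.sum_ite_eq']
              split_ifs
              · exact le_rfl
              · exact Nat.zero_le _
    _ = i.gcd p := Nat.sum_totient _
    _ ≤ i := Nat.gcd_le_left _ (Nat.pos_of_ne_zero hi)

/-- The coefficients of `cycleFactor p i` are at most `(k!) ^ (-1 / p)`: the weights in their
recurrence add up to at most `1` and reach back at most `p` steps. -/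
theorem actDensity_unit_le {p i : ℕ} (hp : p ≠ 0) (hi : i ≠ 0) (k : ℕ) :
    (actDensity (admSetT (fun _ : Unit => p) i) (i * k) : ℝ)
      ≤ (k.factorial : ℝ) ^ (-(1 / (p : ℝ))) := by
  have hp' : (p : ℝ) ≠ 0 := by exact_mod_cast hp
  induction k using Nat.strong_induction_on with
  | _ k ih =>
    rcases Nat.eq_zero_or_pos k with rfl | hk
    · simp [actDensity_zero]
    · have hk' : (0 : ℝ) < k := by exact_mod_cast hk
      have hi' : (0 : ℝ) < i := by exact_mod_cast Nat.pos_of_ne_zero hi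
      have h : (k : ℝ) * (actDensity (admSetT (fun _ : Unit => p) i) (i * k) : ℝ)
          = ∑ j ∈ Finset.Icc 1 k, ((numSubgroups (admSetT (fun _ : Unit => p) i) (i * j) : ℝ) / i) *
            (actDensity (admSetT (fun _ : Unit => p) i) (i * (k - j)) : ℝ) := by
        have h0 := congrArg (Rat.cast : ℚ → ℝ) (mul_actDensity_mul (fun _ : Unit => p) hi k)
        push_cast at h0
        exact h0
      set y := (k.factorial : ℝ) ^ (-(1 / (p : ℝ))) with hy
      have hy0 : 0 ≤ y := by positivity
      have hstep : ∀ j ∈ Finset.Icc 1 k,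
          ((numSubgroups (admSetT (fun _ : Unit => p) i) (i * j) : ℝ) / i) *
            (actDensity (admSetT (fun _ : Unit => p) i) (i * (k - j)) : ℝ)
          ≤ ((numSubgroups (admSetT (fun _ : Unit => p) i) (i * j) : ℝ) / i) * (k * y) := by
        intro j hj
        rw [Finset.mem_Icc] at hj
        by_cases hjp : j ≤ p
        · refine mul_le_mul_of_nonneg_left ((ih (k - j) (by omega)).trans ?_) (by positivity)
          have h1 : (k.factorial : ℝ) ≤ (k : ℝ) ^ p * (k - j).factorial := by
            have h2 : k.factorial ≤ k ^ p * (k - j).factorial := by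
              rw [← Nat.factorial_mul_descFactorial hj.2, mul_comm]
              exact Nat.mul_le_mul_right _ ((Nat.descFactorial_le_pow k j).trans
                (Nat.pow_le_pow_right hk hjp))
            exact_mod_cast h2
          have hf : (0 : ℝ) < k.factorial := by exact_mod_cast Nat.factorial_pos _
          have hf' : (0 : ℝ) < (k - j).factorial := by exact_mod_cast Nat.factorial_pos _
          have h3 : (k.factorial : ℝ) ^ (1 / (p : ℝ))
              ≤ k * ((k - j).factorial : ℝ) ^ (1 / (p : ℝ)) := by
            calc _ ≤ ((k : ℝ) ^ p * (k - j).factorial) ^ (1 / (p : ℝ)) :=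
                  Real.rpow_le_rpow hf.le h1 (by positivity)
              _ = _ := by
                  rw [Real.mul_rpow (by positivity) hf'.le, ← Real.rpow_natCast, ← Real.rpow_mul
                    hk'.le, mul_one_div_cancel hp', Real.rpow_one]
          rw [hy, Real.rpow_neg hf'.le, Real.rpow_neg hf.le, ← div_eq_mul_inv,
            le_div_iff₀ (by positivity), inv_mul_le_iff₀ (by positivity), mul_comm]
          exact h3
        · have : numSubgroups (admSetT (fun _ : Unit => p) i) (i * j) = 0 := by
            rw [numSubgroups_unit hp hi (by omega)]
            refine Finset.sum_eq_zero fun δ hδ => if_neg fun hjδ => hjp ?_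
            rw [← hjδ]
            exact Nat.le_mul_of_pos_right _ (Nat.pos_of_mem_divisors hδ)
          rw [this]
          simp
      have hsum : ∑ j ∈ Finset.Icc 1 k,
          ((numSubgroups (admSetT (fun _ : Unit => p) i) (i * j) : ℝ) / i) ≤ 1 := by
        rw [← Finset.sum_div, div_le_one hi']
        exact_mod_cast sum_numSubgroups_unit_le hp hi k
      have h4 := (h.trans_le (Finset.sum_le_sum hstep))
      rw [← Finset.sum_mul] at h4
      have h5 := h4.trans (mul_le_of_le_one_left (by positivity) hsum)
      exact le_of_mul_le_mul_left h5 hk'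

/-- The exponent `1 - 1 / p - 1 / q` of `n!` in the growth of the number of hypermaps. -/
noncomputable def hyperExp (p q : ℕ) : ℝ := 1 - 1 / (p : ℝ) - 1 / (q : ℝ)

theorem hyperExp_pos {p q : ℕ} (hp : 2 ≤ p) (hq : 2 ≤ q) (hpq : 6 ≤ p * q) : 0 < hyperExp p q := by
  have hp' : (0 : ℝ) < p := by positivity
  have hq' : (0 : ℝ) < q := by positivity
  have h : p + q < p * q := by
    obtain ⟨a, rfl⟩ := Nat.exists_eq_add_of_le hp
    obtain ⟨b, rfl⟩ := Nat.exists_eq_add_of_le hq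
    nlinarith [Nat.zero_le (a * b)]
  have h' : (p : ℝ) + q < p * q := by exact_mod_cast h
  have : hyperExp p q = (p * q - p - q) / (p * q) := by
    rw [hyperExp]
    field_simp
    ring
  rw [this]
  apply div_pos _ (mul_pos hp' hq')
  linarith

theorem actDensity_pq_le {p q i : ℕ} (hp : p ≠ 0) (hq : q ≠ 0) (hi : i ≠ 0) (k : ℕ) :
    (actDensity (admSetT (pqOrders p q) i) (i * k) : ℝ)
      ≤ (i : ℝ) ^ k * (k.factorial : ℝ) ^ hyperExp p q := by
  have hf : (0 : ℝ) < k.factorial := by exact_mod_cast Nat.factorial_pos _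
  have hi' : (0 : ℝ) < i := by exact_mod_cast Nat.pos_of_ne_zero hi
  have hw : (0 : ℝ) < (i : ℝ) ^ k * k.factorial := by positivity
  have h : (actDensity (admSetT (pqOrders p q) i) (i * k) : ℝ) * ((i : ℝ) ^ k * k.factorial)
      = ((actDensity (admSetT (fun _ : Unit => q) i) (i * k) : ℝ) * ((i : ℝ) ^ k * k.factorial)) *
        ((actDensity (admSetT (fun _ : Unit => p) i) (i * k) : ℝ) * ((i : ℝ) ^ k * k.factorial)) := by
    have h0 := actDensity_mul_weight (pqOrders p q) hi k
    rw [Fintype.prod_bool] at h0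
    exact_mod_cast congrArg (Rat.cast : ℚ → ℝ) h0
  have h1 : (actDensity (admSetT (pqOrders p q) i) (i * k) : ℝ)
      = (actDensity (admSetT (fun _ : Unit => p) i) (i * k) : ℝ) *
        (actDensity (admSetT (fun _ : Unit => q) i) (i * k) : ℝ) * ((i : ℝ) ^ k * k.factorial) := by
    apply mul_right_cancel₀ hw.ne'
    rw [h]
    ring
  have hexp : (k.factorial : ℝ) ^ (-(1 / (p : ℝ))) * (k.factorial : ℝ) ^ (-(1 / (q : ℝ))) *
      k.factorial = (k.factorial : ℝ) ^ hyperExp p q := by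
    rw [← Real.rpow_add hf, ← Real.rpow_add_one hf.ne', hyperExp]
    congr 1
    ring
  rw [h1, ← hexp]
  have hq0 : (0 : ℝ) ≤ (actDensity (admSetT (fun _ : Unit => q) i) (i * k) : ℝ) := by
    exact_mod_cast actDensity_nonneg _ _
  calc _ ≤ (k.factorial : ℝ) ^ (-(1 / (p : ℝ))) * (k.factorial : ℝ) ^ (-(1 / (q : ℝ))) *
        ((i : ℝ) ^ k * k.factorial) := by
        refine mul_le_mul_of_nonneg_right ?_ hw.le
        exact mul_le_mul (actDensity_unit_le hp hi k) (actDensity_unit_le hq hi k) hq0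
          (by positivity)
    _ = _ := by ring

theorem pow_mul_factorial_le {p a : ℕ} (hp : p ≠ 0) :
    (p : ℝ) ^ a * a.factorial ≤ (p : ℝ) ^ (p * a) * ((p * a).factorial : ℝ) ^ (1 / (p : ℝ)) := by
  have hp1 : (1 : ℝ) ≤ p := by exact_mod_cast Nat.one_le_iff_ne_zero.mpr hp
  have hp' : (p : ℝ) ≠ 0 := by exact_mod_cast hp
  have h1 : a.factorial ^ p ≤ (p * a).factorial := by
    have := Nat.prod_factorial_dvd_factorial_sum (Finset.range p) (fun _ => a)
    simp only [Finset.prod_const, Finset.card_range, Finset.sum_const, smul_eq_mul] at this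
    exact Nat.le_of_dvd (Nat.factorial_pos _) this
  have h2 : (a.factorial : ℝ) ≤ ((p * a).factorial : ℝ) ^ (1 / (p : ℝ)) := by
    calc (a.factorial : ℝ) = ((a.factorial : ℝ) ^ p) ^ (1 / (p : ℝ)) := by
          rw [← Real.rpow_natCast, ← Real.rpow_mul (by positivity), mul_one_div_cancel hp',
            Real.rpow_one]
      _ ≤ _ := Real.rpow_le_rpow (by positivity) (by exact_mod_cast h1) (by positivity)
  exact mul_le_mul (pow_le_pow_right₀ hp1 (Nat.le_mul_of_pos_left a (Nat.pos_of_ne_zero hp))) h2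
    (by positivity) (by positivity)

theorem le_pqDensity {p q n : ℕ} (hp : p ≠ 0) (hq : q ≠ 0) (hn : p.lcm q ∣ n) :
    (n.factorial : ℝ) ^ hyperExp p q ≤ ((p * q : ℕ) : ℝ) ^ n * pqDensity p q n := by
  obtain ⟨a, ha⟩ := (Nat.dvd_lcm_left p q).trans hn
  obtain ⟨b, hb⟩ := (Nat.dvd_lcm_right p q).trans hn
  have hp' : (0 : ℝ) < p := by exact_mod_cast Nat.pos_of_ne_zero hp
  have hq' : (0 : ℝ) < q := by exact_mod_cast Nat.pos_of_ne_zero hq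
  have hf : (0 : ℝ) < n.factorial := by exact_mod_cast Nat.factorial_pos _
  have h1 := pow_mul_factorial_le (a := a) hp
  have h2 := pow_mul_factorial_le (a := b) hq
  rw [← ha] at h1
  rw [← hb] at h2
  have hexp : (n.factorial : ℝ) ^ hyperExp p q * ((n.factorial : ℝ) ^ (1 / (p : ℝ)) *
      (n.factorial : ℝ) ^ (1 / (q : ℝ))) = n.factorial := by
    rw [← Real.rpow_add hf, ← Real.rpow_add hf, hyperExp]
    ring_nf
    exact Real.rpow_one _
  rw [pqDensity_eq hp hq ha hb, ← mul_div_assoc, le_div_iff₀ (by positivity)]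
  calc _ ≤ (n.factorial : ℝ) ^ hyperExp p q * (((p : ℝ) ^ n * (n.factorial : ℝ) ^ (1 / (p : ℝ))) *
        ((q : ℝ) ^ n * (n.factorial : ℝ) ^ (1 / (q : ℝ)))) := by gcongr
    _ = ((p : ℝ) ^ n * (q : ℝ) ^ n) * ((n.factorial : ℝ) ^ hyperExp p q *
        ((n.factorial : ℝ) ^ (1 / (p : ℝ)) * (n.factorial : ℝ) ^ (1 / (q : ℝ)))) := by ring
    _ = _ := by rw [hexp, ← mul_pow]; push_cast; ring

/-- The representations in which the central generator has cycles of a fixed length `i ≥ 2` are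
rare compared with those in which it acts trivially. -/
theorem actDensity_pq_le_mul {p q i n : ℕ} (hp : 2 ≤ p) (hq : 2 ≤ q) (hpq : 6 ≤ p * q)
    (hi : 2 ≤ i) (hin : i ∣ n) (hn : p.lcm q ∣ n) :
    (actDensity (admSetT (pqOrders p q) i) n : ℝ)
      ≤ ((2 * (p * q) : ℕ) : ℝ) ^ n / (((n + 1) / 2).factorial : ℝ) ^ hyperExp p q *
        pqDensity p q n := by
  obtain ⟨k, rfl⟩ := hin
  have hε := hyperExp_pos hp hq hpq
  set n := i * k with hn_def
  have hk2 : k + (n + 1) / 2 ≤ n := by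
    have : 2 * k ≤ n := Nat.mul_le_mul_right k hi
    rcases Nat.eq_zero_or_pos k with rfl | hk
    · simp [hn_def]
    · omega
  have hfac : (k.factorial : ℝ) * ((n + 1) / 2).factorial ≤ n.factorial := by
    have h1 := Nat.le_of_dvd (Nat.factorial_pos _)
      (Nat.factorial_mul_factorial_dvd_factorial_add k ((n + 1) / 2))
    exact_mod_cast h1.trans (Nat.factorial_le hk2)
  have hk0 : (0 : ℝ) < k.factorial := by exact_mod_cast Nat.factorial_pos _
  have hc0 : (0 : ℝ) < ((n + 1) / 2).factorial := by exact_mod_cast Nat.factorial_pos _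
  have h1 := actDensity_pq_le (p := p) (q := q) (i := i) (by omega) (by omega) (by omega) k
  have h2 := le_pqDensity (p := p) (q := q) (n := n) (by omega) (by omega) hn
  have h3 : (i : ℝ) ^ k ≤ 2 ^ n := by
    have : i ^ k ≤ 2 ^ n := by
      rw [hn_def, pow_mul]
      exact Nat.pow_le_pow_left Nat.lt_two_pow_self.le k
    exact_mod_cast this
  have h4 : (k.factorial : ℝ) ^ hyperExp p q * (((n + 1) / 2).factorial : ℝ) ^ hyperExp p q
      ≤ (n.factorial : ℝ) ^ hyperExp p q := by
    rw [← Real.mul_rpow hk0.le hc0.le]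
    exact Real.rpow_le_rpow (by positivity) hfac hε.le
  rw [div_mul_eq_mul_div, le_div_iff₀ (by positivity)]
  calc _ ≤ ((i : ℝ) ^ k * (k.factorial : ℝ) ^ hyperExp p q) *
        (((n + 1) / 2).factorial : ℝ) ^ hyperExp p q := by gcongr
    _ = (i : ℝ) ^ k * ((k.factorial : ℝ) ^ hyperExp p q *
        (((n + 1) / 2).factorial : ℝ) ^ hyperExp p q) := by ring
    _ ≤ 2 ^ n * (((p * q : ℕ) : ℝ) ^ n * pqDensity p q n) :=
        mul_le_mul h3 (h4.trans h2) (by positivity) (by positivity)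
    _ = _ := by push_cast; ring

theorem tendsto_mul_pow_div_factorial_rpow {ε : ℝ} (hε : 0 < ε) (A : ℕ) :
    Tendsto (fun n : ℕ => (n : ℝ) * ((A : ℝ) ^ n / (((n + 1) / 2).factorial : ℝ) ^ ε)) atTop
      (nhds 0) := by
  -- The factor `n` is absorbed by `2 ^ n`, and `(2 A) ^ n` is at most `(B ^ c) ^ ε` with
  -- `c = ⌈n / 2⌉`.
  set B : ℝ := (((2 * (A : ℝ) + 1) ^ 2)) ^ (1 / ε) with hB
  have hB0 : 0 ≤ B := by positivity
  have h1 : Tendsto (fun c : ℕ => (B ^ c / (c.factorial : ℝ)) ^ ε) atTop (nhds 0) := by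
    have := (FloorSemiring.tendsto_pow_div_factorial_atTop B).rpow_const (p := ε) (Or.inr hε.le)
    rwa [Real.zero_rpow hε.ne'] at this
  have hc : Tendsto (fun n : ℕ => (n + 1) / 2) atTop atTop := by
    refine tendsto_atTop.mpr fun b => ?_
    filter_upwards [eventually_ge_atTop (2 * b)] with n hn
    omega
  refine squeeze_zero (fun n => by positivity) (fun n => ?_) (h1.comp hc)
  set c := (n + 1) / 2 with hc_def
  have hf : (0 : ℝ) < c.factorial := by exact_mod_cast Nat.factorial_pos _
  rw [Function.comp_apply, ← hc_def, Real.div_rpow (by positivity) hf.le, ← mul_div_assoc]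
  refine div_le_div_of_nonneg_right ?_ (by positivity)
  have hBc : (B ^ c) ^ ε = ((2 * (A : ℝ) + 1) ^ 2) ^ c := by
    rw [hB, ← Real.rpow_natCast (_ ^ (1 / ε)), ← Real.rpow_mul (by positivity),
      ← Real.rpow_mul (by positivity), ← Real.rpow_natCast (_ ^ 2)]
    congr 1
    field_simp
  rw [hBc, ← pow_mul]
  have hn2 : (n : ℝ) ≤ 2 ^ n := by exact_mod_cast Nat.lt_two_pow_self.le
  calc (n : ℝ) * (A : ℝ) ^ n ≤ 2 ^ n * (A : ℝ) ^ n := by gcongr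
    _ = (2 * (A : ℝ)) ^ n := by rw [mul_pow]
    _ ≤ (2 * (A : ℝ) + 1) ^ n := by gcongr; linarith
    _ ≤ (2 * (A : ℝ) + 1) ^ (2 * c) :=
        pow_le_pow_right₀ (by linarith [Nat.cast_nonneg (α := ℝ) A]) (by omega)

end Bounds

/-! ### Log-convex sequences of superexponential growth -/

section LogConvex

variable {g ρ : ℕ → ℝ}

theorem mul_le_mul_of_ratio_monotone (hpos : ∀ k, 0 < g k) (hρ : ∀ k, g (k + 1) = ρ k * g k)
    (hmono : Monotone ρ) (a d e : ℕ) : g (a + d) * g (a + e) ≤ g a * g (a + d + e) := by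
  induction d with
  | zero => exact le_rfl
  | succ d ih =>
    have hρ0 : 0 < ρ (a + d) := by
      have h := hpos (a + d + 1)
      rw [hρ] at h
      exact pos_of_mul_pos_left h (hpos _).le
    calc g (a + (d + 1)) * g (a + e) = ρ (a + d) * (g (a + d) * g (a + e)) := by
          rw [← add_assoc, hρ, mul_assoc]
      _ ≤ ρ (a + d) * (g a * g (a + d + e)) := mul_le_mul_of_nonneg_left ih hρ0.le
      _ ≤ ρ (a + d + e) * (g a * g (a + d + e)) :=
          mul_le_mul_of_nonneg_right (hmono (Nat.le_add_right _ _))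
            (mul_pos (hpos _) (hpos _)).le
      _ = g a * g (a + (d + 1) + e) := by
          rw [show a + (d + 1) + e = a + d + e + 1 by ring, hρ]
          ring

/-- If the ratios of consecutive terms of `g` increase at least linearly, the convolution of `g`
with itself, without the two extreme terms, is negligible compared with `g`: by log-convexity its
terms are at most `g 2 * g (k - 2)`, except for two that are at most `g 1 * g (k - 1)`. -/
theorem sum_convolution_le (hpos : ∀ k, 0 < g k) (hρ : ∀ k, g (k + 1) = ρ k * g k)
    (hmono : Monotone ρ) {c : ℝ} (hc : 0 < c) (hlin : ∀ k : ℕ, c * k ≤ ρ k) {m : ℕ} (hm : 2 ≤ m) :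
    ∑ j ∈ Finset.Ico 1 (m + 2), g j * g (m + 2 - j)
      ≤ (2 * g 1 / c + 2 * g 2 / c ^ 2) / m * g (m + 2) := by
  have hm0 : (0 : ℝ) < m := by exact_mod_cast (by omega : 0 < m)
  have hB : 0 ≤ g 1 * g (m + 1) := (mul_pos (hpos _) (hpos _)).le
  have hD : 0 ≤ g 2 * g m := (mul_pos (hpos _) (hpos _)).le
  have hterm : ∀ j ∈ Finset.Ico 1 (m + 2), g j * g (m + 2 - j) ≤
      ((if j = 1 then g 1 * g (m + 1) else 0) + (if j = m + 1 then g 1 * g (m + 1) else 0))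
        + g 2 * g m := by
    intro j hj
    rw [Finset.mem_Ico] at hj
    by_cases h1 : j = 1
    · subst h1
      rw [if_pos rfl, show m + 2 - 1 = m + 1 by omega]
      split_ifs <;> linarith
    · by_cases h2 : j = m + 1
      · subst h2
        rw [if_pos rfl, show m + 2 - (m + 1) = 1 by omega, mul_comm, if_neg h1]
        linarith
      · rw [if_neg h1, if_neg h2]
        have h := mul_le_mul_of_ratio_monotone hpos hρ hmono 2 (j - 2) (m - j)
        rw [show 2 + (j - 2) = j by omega, show 2 + (m - j) = m + 2 - j by omega,
          show j + (m - j) = m by omega] at h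
        linarith
  have hsum : ∑ j ∈ Finset.Ico 1 (m + 2), g j * g (m + 2 - j)
      ≤ 2 * (g 1 * g (m + 1)) + (m + 1) * (g 2 * g m) := by
    refine (Finset.sum_le_sum hterm).trans ?_
    rw [Finset.sum_add_distrib, Finset.sum_add_distrib, Finset.sum_ite_eq', Finset.sum_ite_eq',
      Finset.sum_const, Nat.card_Ico, nsmul_eq_mul, if_pos (by rw [Finset.mem_Ico]; omega),
      if_pos (by rw [Finset.mem_Ico]; omega)]
    push_cast [show m + 2 - 1 = m + 1 by omega]
    linarith
  have h1 : c * m * g m ≤ g (m + 1) := by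
    rw [hρ]
    exact mul_le_mul_of_nonneg_right (hlin m) (hpos m).le
  have h2 : c * (m + 1) * g (m + 1) ≤ g (m + 2) := by
    rw [hρ (m + 1)]
    have := hlin (m + 1)
    push_cast at this
    exact mul_le_mul_of_nonneg_right this (hpos _).le
  have h3 : g (m + 1) ≤ g (m + 2) / (c * m) := by
    rw [le_div_iff₀ (by positivity)]
    nlinarith [hpos (m + 1)]
  have h4 : (m + 1) * g m ≤ g (m + 2) / (c ^ 2 * m) := by
    rw [le_div_iff₀ (by positivity)]
    calc _ = c * (m + 1) * (c * m * g m) := by ring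
      _ ≤ c * (m + 1) * g (m + 1) := by gcongr
      _ ≤ _ := h2
  have hg2 := hpos 2
  calc _ ≤ 2 * (g 1 * g (m + 1)) + (m + 1) * (g 2 * g m) := hsum
    _ = 2 * g 1 * g (m + 1) + g 2 * ((m + 1) * g m) := by ring
    _ ≤ 2 * g 1 * (g (m + 2) / (c * m)) + g 2 * (g (m + 2) / (c ^ 2 * m)) := by
        have := hpos 1
        gcongr
    _ ≤ 2 * g 1 * (g (m + 2) / (c * m)) + 2 * g 2 * (g (m + 2) / (c ^ 2 * m)) := by
        have : 0 < g 2 * (g (m + 2) / (c ^ 2 * m)) :=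
          mul_pos hg2 (div_pos (hpos _) (by positivity))
        linarith
    _ = _ := by field_simp

end LogConvex

/-! ### The hypergeometric recurrence for the leading term -/

section Hypergeometric

/-- The quotient of two consecutive values of `d ^ (e k) * (e k)!` is the product of the multiples of
`d` in the corresponding block of `d * e` consecutive integers. -/
theorem factorial_block {d : ℕ} (hd : d ≠ 0) (e k : ℕ) :
    d ^ (e * (k + 1)) * (e * (k + 1)).factorial
      = d ^ (e * k) * (e * k).factorial *
        ∏ j ∈ (Finset.Icc 1 (d * e)).filter (d ∣ ·), (d * e * k + j) := by
  have himg : (Finset.Icc 1 (d * e)).filter (d ∣ ·)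
      = (Finset.range e).image fun t => d * (t + 1) := by
    ext j
    simp only [Finset.mem_filter, Finset.mem_Icc, Finset.mem_image, Finset.mem_range]
    constructor
    · rintro ⟨⟨h1, h2⟩, t, rfl⟩
      have ht : t ≠ 0 := by rintro rfl; omega
      have hte : t ≤ e := Nat.le_of_mul_le_mul_left h2 (Nat.pos_of_ne_zero hd)
      exact ⟨t - 1, by omega, by rw [Nat.sub_add_cancel (Nat.pos_of_ne_zero ht)]⟩
    · rintro ⟨t, ht, rfl⟩
      exact ⟨⟨Nat.mul_pos (Nat.pos_of_ne_zero hd) (Nat.succ_pos t), Nat.mul_le_mul_left d ht⟩,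
        dvd_mul_right _ _⟩
  rw [himg, Finset.prod_image (fun a _ b _ h => by
    simpa using Nat.eq_of_mul_eq_mul_left (Nat.pos_of_ne_zero hd) h)]
  have h1 : ∀ t ∈ Finset.range e, d * e * k + d * (t + 1) = d * (e * k + 1 + t) :=
    fun t _ => by ring
  rw [Finset.prod_congr rfl h1, Finset.prod_mul_distrib, Finset.prod_const, Finset.card_range,
    ← Nat.ascFactorial_eq_prod_range, mul_add, mul_one, ← Nat.factorial_mul_ascFactorial, pow_add]
  ring

theorem lcm_eq_div (p q : ℕ) : p * q / p.gcd q = p.lcm q := rfl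

theorem lt_lcm_of_mem_growthIndices {p q i : ℕ} (h : i ∈ growthIndices p q) :
    0 < i ∧ i < p.lcm q := by
  rw [growthIndices, Finset.mem_filter, Finset.mem_Ico] at h
  exact ⟨h.1.1, h.1.2⟩

/-- The numbers from `1` to `lcm p q` are the multiples of `p`, the multiples of `q` and the
growth indices; only `lcm p q` itself is a multiple of both. -/
theorem prod_Icc_lcm {p q : ℕ} (hp : p ≠ 0) (hq : q ≠ 0) (F : ℕ → ℕ) :
    (∏ j ∈ Finset.Icc 1 (p.lcm q), F j) * F (p.lcm q)
      = (∏ j ∈ (Finset.Icc 1 (p.lcm q)).filter (p ∣ ·), F j) *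
        (∏ j ∈ (Finset.Icc 1 (p.lcm q)).filter (q ∣ ·), F j) *
        ∏ j ∈ growthIndices p q, F j := by
  have hl : 0 < p.lcm q := Nat.pos_of_ne_zero (Nat.lcm_ne_zero hp hq)
  set A := Finset.Icc 1 (p.lcm q) with hA
  have h1 := Finset.prod_filter_mul_prod_filter_not A (p ∣ ·) F
  have h2 := Finset.prod_filter_mul_prod_filter_not (A.filter (¬ p ∣ ·)) (q ∣ ·) F
  have h3 := Finset.prod_filter_mul_prod_filter_not (A.filter (q ∣ ·)) (p ∣ ·) F
  have h4 : (A.filter (q ∣ ·)).filter (p ∣ ·) = {p.lcm q} := by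
    ext j
    simp only [hA, Finset.mem_filter, Finset.mem_Icc, Finset.mem_singleton]
    constructor
    · rintro ⟨⟨⟨h1, h2⟩, hqj⟩, hpj⟩
      exact le_antisymm h2 (Nat.le_of_dvd h1 (Nat.lcm_dvd hpj hqj))
    · rintro rfl
      exact ⟨⟨⟨hl, le_rfl⟩, Nat.dvd_lcm_right p q⟩, Nat.dvd_lcm_left p q⟩
  have h5 : (A.filter (q ∣ ·)).filter (¬ p ∣ ·) = (A.filter (¬ p ∣ ·)).filter (q ∣ ·) :=
    Finset.filter_comm _ _ _
  have h6 : (A.filter (¬ p ∣ ·)).filter (¬ q ∣ ·) = growthIndices p q := by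
    ext j
    rw [growthIndices, lcm_eq_div]
    simp only [hA, Finset.mem_filter, Finset.mem_Icc, Finset.mem_Ico]
    constructor
    · rintro ⟨⟨⟨h1, h2⟩, hpj⟩, hqj⟩
      refine ⟨⟨h1, lt_of_le_of_ne h2 ?_⟩, hpj, hqj⟩
      rintro rfl
      exact hpj (Nat.dvd_lcm_left p q)
    · rintro ⟨⟨h1, h2⟩, hpj, hqj⟩
      exact ⟨⟨⟨h1, h2.le⟩, hpj⟩, hqj⟩
  rw [h4, h5, Finset.prod_singleton] at h3
  rw [h6] at h2
  rw [← h1, ← h2, ← h3]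
  ring

/-- The case of a constant function in `prod_Icc_lcm`, with exponents compared. -/
theorem card_growthIndices {p q : ℕ} (hp : p ≠ 0) (hq : q ≠ 0) :
    (growthIndices p q).card + p.lcm q / p + p.lcm q / q = p.lcm q + 1 := by
  have h := prod_Icc_lcm hp hq fun _ => 2
  have hcard : ∀ d, ((Finset.Icc 1 (p.lcm q)).filter (d ∣ ·)).card = p.lcm q / d := fun d =>
    Nat.Ioc_filter_dvd_card_eq_div _ _
  simp only [Finset.prod_const, hcard, Nat.card_Icc, Nat.add_sub_cancel] at h
  rw [← pow_succ, ← pow_add, ← pow_add] at h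
  have := Nat.pow_right_injective (le_refl 2) h
  omega

theorem cast_card_growthIndices {p q : ℕ} (hp : p ≠ 0) (hq : q ≠ 0) :
    ((growthIndices p q).card : ℝ) = growthN p q := by
  have hp' : (p : ℝ) ≠ 0 := by exact_mod_cast hp
  have hq' : (q : ℝ) ≠ 0 := by exact_mod_cast hq
  have hg : ((p.gcd q : ℕ) : ℝ) ≠ 0 := by
    exact_mod_cast (Nat.gcd_pos_of_pos_left q (Nat.pos_of_ne_zero hp)).ne'
  have hl : ((p.gcd q : ℕ) : ℝ) * (p.lcm q : ℕ) = p * q := by exact_mod_cast Nat.gcd_mul_lcm p q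
  have h : ((growthIndices p q).card : ℝ) + (p.lcm q : ℝ) / p + (p.lcm q : ℝ) / q
      = p.lcm q + 1 := by
    have := card_growthIndices hp hq
    rw [← Nat.cast_div (Nat.dvd_lcm_left p q) hp', ← Nat.cast_div (Nat.dvd_lcm_right p q) hq']
    exact_mod_cast this
  have hl' : ((p.lcm q : ℕ) : ℝ) = p * q / (p.gcd q : ℕ) := by
    rw [eq_div_iff hg, mul_comm, hl]
  rw [hl'] at h
  rw [growthN]
  field_simp at h ⊢
  linarith

theorem two_le_card_growthIndices {p q : ℕ} (hp : 2 ≤ p) (hq : 2 ≤ q) (hpq : 6 ≤ p * q) :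
    2 ≤ (growthIndices p q).card := by
  have h : (1 : ℝ) < (growthIndices p q).card := by
    rw [cast_card_growthIndices (by omega) (by omega), growthN]
    have hg : (0 : ℝ) < (p.gcd q : ℕ) := by
      exact_mod_cast Nat.gcd_pos_of_pos_left q (by omega)
    have h1 : p + q < p * q := by
      obtain ⟨a, rfl⟩ := Nat.exists_eq_add_of_le hp
      obtain ⟨b, rfl⟩ := Nat.exists_eq_add_of_le hq
      nlinarith [Nat.zero_le (a * b)]
    have h2 : (p : ℝ) + q < p * q := by exact_mod_cast h1
    have h3 : 0 < (((p : ℝ) - 1) * (q - 1) - 1) / (p.gcd q : ℕ) := by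
      apply div_pos _ hg
      nlinarith
    linarith
  exact_mod_cast h

theorem growthA_eq {p q : ℕ} (hp : p ≠ 0) (hq : q ≠ 0) (i : ℕ) :
    growthA p q i = (i : ℝ) / (p.lcm q : ℕ) := by
  have hp' : (p : ℝ) ≠ 0 := by exact_mod_cast hp
  have hq' : (q : ℝ) ≠ 0 := by exact_mod_cast hq
  have hl0 : ((p.lcm q : ℕ) : ℝ) ≠ 0 := by exact_mod_cast Nat.lcm_ne_zero hp hq
  have hl : ((p.gcd q : ℕ) : ℝ) * (p.lcm q : ℕ) = p * q := by exact_mod_cast Nat.gcd_mul_lcm p q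
  rw [growthA, div_eq_div_iff (mul_ne_zero hp' hq') hl0, mul_assoc, hl]

theorem growthA_pos {p q i : ℕ} (hp : p ≠ 0) (hq : q ≠ 0) (hi : i ∈ growthIndices p q) :
    0 < growthA p q i := by
  rw [growthA_eq hp hq]
  have hl : 0 < p.lcm q := Nat.pos_of_ne_zero (Nat.lcm_ne_zero hp hq)
  have := (lt_lcm_of_mem_growthIndices hi).1
  positivity

theorem growthA_lt_one {p q i : ℕ} (hp : p ≠ 0) (hq : q ≠ 0) (hi : i ∈ growthIndices p q) :
    growthA p q i < 1 := by
  have hl : (0 : ℝ) < (p.lcm q : ℕ) := by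
    exact_mod_cast Nat.pos_of_ne_zero (Nat.lcm_ne_zero hp hq)
  rw [growthA_eq hp hq, div_lt_one hl]
  exact_mod_cast (lt_lcm_of_mem_growthIndices hi).2

/-- The ratio of the densities on `lcm p q * (k + 1)` and on `lcm p q * k` points. -/
noncomputable def growthRatio (p q k : ℕ) : ℝ :=
  (p.lcm q : ℝ) ^ ((growthIndices p q).card - 1) *
    (∏ i ∈ growthIndices p q, (k + growthA p q i)) / (k + 1)

theorem pqDensity_lcm_eq {p q : ℕ} (hp : p ≠ 0) (hq : q ≠ 0) (k : ℕ) :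
    pqDensity p q (p.lcm q * k) = (p.lcm q * k).factorial /
      (((p : ℝ) ^ (p.lcm q / p * k) * (p.lcm q / p * k).factorial) *
        ((q : ℝ) ^ (p.lcm q / q * k) * (p.lcm q / q * k).factorial)) := by
  apply pqDensity_eq hp hq
  · rw [← mul_assoc, Nat.mul_div_cancel' (Nat.dvd_lcm_left p q)]
  · rw [← mul_assoc, Nat.mul_div_cancel' (Nat.dvd_lcm_right p q)]

theorem pqDensity_lcm_pos {p q : ℕ} (hp : p ≠ 0) (hq : q ≠ 0) (k : ℕ) :
    0 < pqDensity p q (p.lcm q * k) := by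
  have hp' := Nat.pos_of_ne_zero hp
  have hq' := Nat.pos_of_ne_zero hq
  rw [pqDensity_lcm_eq hp hq]
  have := fun n => Nat.factorial_pos n
  have h1 := this (p.lcm q * k)
  have h2 := this (p.lcm q / p * k)
  have h3 := this (p.lcm q / q * k)
  positivity

theorem pqDensity_lcm_succ {p q : ℕ} (hp : p ≠ 0) (hq : q ≠ 0)
    (hcard : 1 ≤ (growthIndices p q).card) (k : ℕ) :
    pqDensity p q (p.lcm q * (k + 1)) = growthRatio p q k * pqDensity p q (p.lcm q * k) := by
  set l := p.lcm q with hl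
  have hl0 : l ≠ 0 := Nat.lcm_ne_zero hp hq
  have hl' : (l : ℝ) ≠ 0 := by exact_mod_cast hl0
  have hk' : ((k : ℝ) + 1) ≠ 0 := by positivity
  have hprod := prod_Icc_lcm hp hq fun j => l * k + j
  rw [← hl] at hprod
  have h1 := factorial_block one_ne_zero l k
  have hp1 := factorial_block hp (l / p) k
  have hq1 := factorial_block hq (l / q) k
  rw [Nat.mul_div_cancel' (Nat.dvd_lcm_left p q)] at hp1
  rw [Nat.mul_div_cancel' (Nat.dvd_lcm_right p q)] at hq1
  simp only [one_pow, one_mul, one_dvd, Finset.filter_true] at h1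
  have hI : ((∏ i ∈ growthIndices p q, (l * k + i) : ℕ) : ℝ)
      = (l : ℝ) ^ ((growthIndices p q).card - 1) * l *
        ∏ i ∈ growthIndices p q, (k + growthA p q i) := by
    rw [← pow_succ, Nat.sub_add_cancel hcard, ← Finset.prod_const, ← Finset.prod_mul_distrib]
    push_cast
    refine Finset.prod_congr rfl fun i _ => ?_
    rw [growthA_eq hp hq, ← hl]
    field_simp
  have hprod' := congrArg (Nat.cast : ℕ → ℝ) hprod
  have h1' := congrArg (Nat.cast : ℕ → ℝ) h1
  have hp1' := congrArg (Nat.cast : ℕ → ℝ) hp1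
  have hq1' := congrArg (Nat.cast : ℕ → ℝ) hq1
  rw [Nat.cast_mul, Nat.cast_mul, Nat.cast_mul, hI] at hprod'
  rw [Nat.cast_mul] at h1'
  rw [Nat.cast_mul, Nat.cast_mul, Nat.cast_mul, Nat.cast_pow, Nat.cast_pow] at hp1' hq1'
  rw [pqDensity_lcm_eq hp hq, pqDensity_lcm_eq hp hq, ← hl, h1', hp1', hq1', growthRatio, ← hl]
  have hfp : ((l / p * k).factorial : ℝ) ≠ 0 := by exact_mod_cast Nat.factorial_ne_zero _
  have hfq : ((l / q * k).factorial : ℝ) ≠ 0 := by exact_mod_cast Nat.factorial_ne_zero _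
  have hp' : (p : ℝ) ≠ 0 := by exact_mod_cast hp
  have hq' : (q : ℝ) ≠ 0 := by exact_mod_cast hq
  have hne : ∀ s : Finset ℕ, s ⊆ Finset.Icc 1 l → ((∏ j ∈ s, (l * k + j) : ℕ) : ℝ) ≠ 0 := by
    intro s hs
    have : (∏ j ∈ s, (l * k + j)) ≠ 0 := by
      refine Finset.prod_ne_zero_iff.mpr fun j hj => ?_
      have := (Finset.mem_Icc.mp (hs hj)).1
      omega
    exact_mod_cast this
  have hnp := hne _ (Finset.filter_subset (p ∣ ·) (Finset.Icc 1 l))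
  have hnq := hne _ (Finset.filter_subset (q ∣ ·) (Finset.Icc 1 l))
  set X := ((∏ j ∈ (Finset.Icc 1 l).filter (p ∣ ·), (l * k + j) : ℕ) : ℝ)
  set Y := ((∏ j ∈ (Finset.Icc 1 l).filter (q ∣ ·), (l * k + j) : ℕ) : ℝ)
  set Z := ((∏ j ∈ Finset.Icc 1 l, (l * k + j) : ℕ) : ℝ)
  have hcast : ((l * k + l : ℕ) : ℝ) = l * (k + 1) := by push_cast; ring
  rw [hcast] at hprod'
  have hZ : Z * (k + 1) = X * Y * ((l : ℝ) ^ ((growthIndices p q).card - 1) *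
        ∏ i ∈ growthIndices p q, (k + growthA p q i)) := by
    apply mul_right_cancel₀ hl'
    linear_combination hprod'
  field_simp
  linear_combination hZ

/-- Pairing the denominator `k + 1` with one factor `k + a` of the numerator, where `a < 1`, exhibits
the ratio as a product of increasing factors. -/
theorem growthRatio_eq {p q i₀ : ℕ} (hi₀ : i₀ ∈ growthIndices p q) (k : ℕ) :
    growthRatio p q k = (p.lcm q : ℝ) ^ ((growthIndices p q).card - 1) *
      ((k + growthA p q i₀) / (k + 1)) *
        ∏ i ∈ (growthIndices p q).erase i₀, (k + growthA p q i) := by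
  rw [growthRatio, ← Finset.mul_prod_erase _ _ hi₀]
  ring

theorem growthRatio_monotone {p q : ℕ} (hp : p ≠ 0) (hq : q ≠ 0)
    (hcard : 1 ≤ (growthIndices p q).card) : Monotone (growthRatio p q) := by
  obtain ⟨i₀, hi₀⟩ := Finset.card_pos.mp hcard
  intro k m hkm
  have hkm' : (k : ℝ) ≤ m := by exact_mod_cast hkm
  have h0 := growthA_pos hp hq hi₀
  have h1 := growthA_lt_one hp hq hi₀
  have hk0 : (0 : ℝ) ≤ k := Nat.cast_nonneg k
  rw [growthRatio_eq hi₀, growthRatio_eq hi₀]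
  have hpos : ∀ i ∈ (growthIndices p q).erase i₀, 0 < growthA p q i := fun i hi =>
    growthA_pos hp hq (Finset.mem_of_mem_erase hi)
  apply mul_le_mul
  · refine mul_le_mul_of_nonneg_left ?_ (by positivity)
    rw [div_le_div_iff₀ (by positivity) (by positivity)]
    nlinarith
  · refine Finset.prod_le_prod (fun i hi => ?_) fun i hi => ?_
    · have := hpos i hi
      positivity
    · linarith
  · refine Finset.prod_nonneg fun i hi => ?_
    have := hpos i hi
    positivity
  · positivity

theorem exists_linear_le_growthRatio {p q : ℕ} (hp : p ≠ 0) (hq : q ≠ 0)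
    (hcard : 2 ≤ (growthIndices p q).card) :
    ∃ c > 0, ∀ k : ℕ, c * k ≤ growthRatio p q k := by
  obtain ⟨i₀, hi₀, i₁, hi₁, hne⟩ := Finset.one_lt_card.mp hcard
  have hl : (0 : ℝ) < (p.lcm q : ℕ) := by
    exact_mod_cast Nat.pos_of_ne_zero (Nat.lcm_ne_zero hp hq)
  have hi₁' : i₁ ∈ (growthIndices p q).erase i₀ := Finset.mem_erase.mpr ⟨hne.symm, hi₁⟩
  have hpos : ∀ i ∈ ((growthIndices p q).erase i₀).erase i₁, 0 < growthA p q i := fun i hi =>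
    growthA_pos hp hq (Finset.mem_of_mem_erase (Finset.mem_of_mem_erase hi))
  have h0 := growthA_pos hp hq hi₀
  have h1 := growthA_pos hp hq hi₁
  refine ⟨(p.lcm q : ℝ) ^ ((growthIndices p q).card - 1) * growthA p q i₀ *
    ∏ i ∈ ((growthIndices p q).erase i₀).erase i₁, growthA p q i, ?_, fun k => ?_⟩
  · have := Finset.prod_pos hpos
    positivity
  · have hk0 : (0 : ℝ) ≤ k := Nat.cast_nonneg k
    rw [growthRatio_eq hi₀, ← Finset.mul_prod_erase _ _ hi₁']
    have hA : growthA p q i₀ ≤ (k + growthA p q i₀) / (k + 1) := by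
      rw [le_div_iff₀ (by positivity)]
      nlinarith [growthA_lt_one hp hq hi₀]
    have hB : ∏ i ∈ ((growthIndices p q).erase i₀).erase i₁, growthA p q i
        ≤ ∏ i ∈ ((growthIndices p q).erase i₀).erase i₁, (k + growthA p q i) :=
      Finset.prod_le_prod (fun i hi => (hpos i hi).le) fun i _ => by linarith
    have hB0 := (Finset.prod_pos hpos).le
    calc _ = (p.lcm q : ℝ) ^ ((growthIndices p q).card - 1) * growthA p q i₀ *
          (k * ∏ i ∈ ((growthIndices p q).erase i₀).erase i₁, growthA p q i) := by ring
      _ ≤ _ := by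
          refine mul_le_mul (mul_le_mul_of_nonneg_left hA (by positivity))
            (mul_le_mul (by linarith) hB hB0 (by positivity)) (by positivity) (by positivity)

end Hypergeometric

/-! ### The asymptotic form of the leading term -/

section GammaAsymptotics

theorem pqDensity_lcm_prod {p q : ℕ} (hp : p ≠ 0) (hq : q ≠ 0)
    (hcard : 1 ≤ (growthIndices p q).card) (k : ℕ) :
    pqDensity p q (p.lcm q * k) = ((p.lcm q : ℝ) ^ ((growthIndices p q).card - 1)) ^ k *
      (∏ i ∈ growthIndices p q, ∏ t ∈ Finset.range k, (growthA p q i + t)) / k.factorial := by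
  induction k with
  | zero =>
    rw [pqDensity, mul_zero, actDensity_zero]
    simp
  | succ k ih =>
    have hf : (k.factorial : ℝ) ≠ 0 := by exact_mod_cast Nat.factorial_ne_zero _
    have hk' : ((k : ℝ) + 1) ≠ 0 := by positivity
    rw [pqDensity_lcm_succ hp hq hcard, ih, growthRatio]
    simp_rw [Finset.prod_range_succ]
    rw [Finset.prod_mul_distrib, Nat.factorial_succ, pow_succ _ k]
    push_cast
    simp_rw [add_comm (growthA p q _) (k : ℝ)]
    field_simp

/-- Euler's limit formula rearranged as a formula for the rising factorial. -/
theorem prod_range_add_eq {a : ℝ} (ha : 0 < a) {k : ℕ} (hk : k ≠ 0) :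
    ∏ t ∈ Finset.range k, (a + t)
      = (k : ℝ) ^ a * k.factorial * (Real.GammaSeq a k)⁻¹ * (k / (a + k)) / k := by
  have hk' : (0 : ℝ) < k := by exact_mod_cast Nat.pos_of_ne_zero hk
  have hpos : 0 < ∏ t ∈ Finset.range k, (a + (t : ℝ)) :=
    Finset.prod_pos fun t _ => by positivity
  have hf : (0 : ℝ) < k.factorial := by exact_mod_cast Nat.factorial_pos _
  have hr : (0 : ℝ) < (k : ℝ) ^ a := Real.rpow_pos_of_pos hk' a
  have hak : 0 < a + k := by positivity
  rw [Real.GammaSeq, Finset.prod_range_succ]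
  field_simp

/-- The bounded factor in the asymptotic form of the density. -/
noncomputable def growthFactor (p q k : ℕ) : ℝ :=
  Stirling.stirlingSeq k ^ ((growthIndices p q).card - 1) *
    √2 ^ ((growthIndices p q).card - 1) *
    ((∏ i ∈ growthIndices p q, (Real.GammaSeq (growthA p q i) k)⁻¹) *
      ∏ i ∈ growthIndices p q, ((k : ℝ) / (growthA p q i + k)))

theorem growthC_eq {p q : ℕ} (hp : p ≠ 0) (hq : q ≠ 0) (hcard : 1 ≤ (growthIndices p q).card) :
    growthC p q = √Real.pi ^ ((growthIndices p q).card - 1) *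
      √2 ^ ((growthIndices p q).card - 1) *
      ((∏ i ∈ growthIndices p q, (Real.Gamma (growthA p q i))⁻¹) *
        ∏ _i ∈ growthIndices p q, 1) := by
  rw [growthC, ← cast_card_growthIndices hp hq, Finset.prod_const_one, mul_one, ← mul_pow,
    ← Real.sqrt_mul Real.pi_pos.le, div_eq_mul_inv, Finset.prod_inv_distrib, mul_comm Real.pi 2,
    Real.sqrt_eq_rpow, ← Real.rpow_natCast, ← Real.rpow_mul (by positivity), Nat.cast_sub hcard]
  congr 2
  push_cast
  ring

theorem growthC_pos {p q : ℕ} (hp : p ≠ 0) (hq : q ≠ 0) : 0 < growthC p q := by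
  rw [growthC]
  refine div_pos (by positivity) (Finset.prod_pos fun i hi => ?_)
  exact Real.Gamma_pos_of_pos (growthA_pos hp hq hi)

theorem tendsto_growthFactor {p q : ℕ} (hp : p ≠ 0) (hq : q ≠ 0)
    (hcard : 1 ≤ (growthIndices p q).card) :
    Tendsto (growthFactor p q) atTop (nhds (growthC p q)) := by
  rw [growthC_eq hp hq hcard]
  refine ((Stirling.tendsto_stirlingSeq_sqrt_pi.pow _).mul_const _).mul (Tendsto.mul ?_ ?_)
  · refine tendsto_finsetProd _ fun i hi => ?_
    exact (Real.GammaSeq_tendsto_Gamma _).inv₀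
      (Real.Gamma_pos_of_pos (growthA_pos hp hq hi)).ne'
  · refine tendsto_finsetProd _ fun i _ => ?_
    have h := tendsto_natCast_div_add_atTop (𝕜 := ℝ) (growthA p q i)
    simpa only [add_comm] using h

theorem growthBase_eq {p q : ℕ} (hp : p ≠ 0) (hq : q ≠ 0)
    (hcard : 1 ≤ (growthIndices p q).card) :
    growthBase p q = (p.lcm q : ℝ) ^ ((growthIndices p q).card - 1) := by
  rw [growthBase, ← Real.rpow_natCast, Nat.cast_sub hcard, cast_card_growthIndices hp hq, growthN]
  congr 1
  push_cast
  ring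

theorem pqDensity_lcm_eq_growthFactor {p q : ℕ} (hp : p ≠ 0) (hq : q ≠ 0)
    (hcard : 1 ≤ (growthIndices p q).card) {k : ℕ} (hk : k ≠ 0) :
    pqDensity p q (p.lcm q * k) = growthFactor p q k *
      ((k : ℝ) ^ ((growthN p q - 1) * k - growthC0 p q) * Real.exp (growthC1 p q * k)) := by
  have hk' : (0 : ℝ) < k := by exact_mod_cast Nat.pos_of_ne_zero hk
  have hl : (0 : ℝ) < (p.lcm q : ℕ) := by
    exact_mod_cast Nat.pos_of_ne_zero (Nat.lcm_ne_zero hp hq)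
  have hf : (0 : ℝ) < k.factorial := by exact_mod_cast Nat.factorial_pos _
  obtain ⟨M, hM⟩ : ∃ M, (growthIndices p q).card = M + 1 := ⟨_, (Nat.sub_add_cancel hcard).symm⟩
  have hN : growthN p q = M + 1 := by rw [← cast_card_growthIndices hp hq, hM]; push_cast; rfl
  have hb0 : 0 < growthBase p q := by rw [growthBase]; positivity
  -- Everything is written as an exponential of an expression in `log k`.
  set L := Real.log k with hL
  have hkL : ∀ x : ℝ, (k : ℝ) ^ x = Real.exp (L * x) := fun x => Real.rpow_def_of_pos hk' x
  have hk1 : (k : ℝ) = Real.exp L := (Real.exp_log hk').symm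
  have hst : (k.factorial : ℝ) = Stirling.stirlingSeq k * (√2 * Real.exp (L * (1 / 2)) *
      Real.exp (L * k - k)) := by
    have h1 : √(2 * (k : ℝ)) = √2 * Real.exp (L * (1 / 2)) := by
      rw [Real.sqrt_mul (by norm_num), Real.sqrt_eq_rpow (k : ℝ), hkL]
    have h2 : ((k : ℝ) / Real.exp 1) ^ k = Real.exp (L * k - k) := by
      rw [← Real.rpow_natCast, Real.rpow_def_of_pos (by positivity), Real.log_div hk'.ne'
        (Real.exp_pos 1).ne', Real.log_exp, ← hL]
      congr 1
      ring
    rw [Stirling.stirlingSeq, h1, h2]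
    field_simp
  have hb : growthBase p q ^ k = Real.exp (Real.log (growthBase p q) * k) := by
    rw [← Real.rpow_natCast, Real.rpow_def_of_pos hb0]
  have hprod : ∏ i ∈ growthIndices p q, ∏ t ∈ Finset.range k, (growthA p q i + (t : ℝ))
      = Real.exp (L * ∑ i ∈ growthIndices p q, growthA p q i) * (k.factorial : ℝ) ^ (M + 1) *
        ((∏ i ∈ growthIndices p q, (Real.GammaSeq (growthA p q i) k)⁻¹) *
          ∏ i ∈ growthIndices p q, ((k : ℝ) / (growthA p q i + k))) *
        Real.exp (-(L * (M + 1))) := by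
    rw [Finset.prod_congr rfl fun i hi => prod_range_add_eq (growthA_pos hp hq hi) hk]
    simp_rw [div_eq_mul_inv _ (k : ℝ)]
    rw [Finset.prod_mul_distrib, Finset.prod_mul_distrib, Finset.prod_mul_distrib,
      Finset.prod_mul_distrib, Finset.prod_const, Finset.prod_const, hM, Finset.mul_sum,
      Real.exp_sum, Finset.prod_congr rfl fun i _ => hkL (growthA p q i)]
    have : ((k : ℝ)⁻¹) ^ (M + 1) = Real.exp (-(L * (M + 1))) := by
      rw [inv_pow, Real.exp_neg, ← Real.rpow_natCast, hkL]
      push_cast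
      rfl
    rw [this]
    ring
  rw [pqDensity_lcm_prod hp hq hcard, ← growthBase_eq hp hq hcard, hprod, hb, growthFactor, hM,
    Nat.add_sub_cancel, hkL]
  have hfM : (k.factorial : ℝ) ^ M = Stirling.stirlingSeq k ^ M * √2 ^ M *
      Real.exp (L * (1 / 2) * M) * Real.exp ((L * k - k) * M) := by
    rw [hst, mul_pow, mul_pow, mul_pow, ← Real.exp_nat_mul, ← Real.exp_nat_mul]
    ring_nf
  have hexp : Real.exp (L * ((growthN p q - 1) * k - growthC0 p q)) *
      Real.exp (growthC1 p q * k)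
      = Real.exp (Real.log (growthBase p q) * k) *
        Real.exp (L * ∑ i ∈ growthIndices p q, growthA p q i) * Real.exp (-(L * (M + 1))) *
        (Real.exp (L * (1 / 2) * M) * Real.exp ((L * k - k) * M)) := by
    rw [← Real.exp_add, ← Real.exp_add, ← Real.exp_add, ← Real.exp_add, ← Real.exp_add, growthC0,
      growthC1, hN]
    congr 1
    ring
  rw [hexp, pow_succ, hfM]
  field_simp

theorem pqDensity_lcm_isEquivalent {p q : ℕ} (hp : p ≠ 0) (hq : q ≠ 0)
    (hcard : 1 ≤ (growthIndices p q).card) :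
    (fun k : ℕ => pqDensity p q (p.lcm q * k)) ~[atTop]
      fun k : ℕ => growthC p q * (k : ℝ) ^ ((growthN p q - 1) * k - growthC0 p q) *
          Real.exp (growthC1 p q * k) := by
  have h1 : (growthFactor p q) ~[atTop] fun _ => growthC p q :=
    (isEquivalent_const_iff_tendsto (growthC_pos hp hq).ne').mpr (tendsto_growthFactor hp hq hcard)
  have h2 := h1.mul (IsEquivalent.refl (u := fun k : ℕ =>
    (k : ℝ) ^ ((growthN p q - 1) * k - growthC0 p q) * Real.exp (growthC1 p q * k)))
  refine (h2.congr_left ?_).congr_right ?_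
  · filter_upwards [eventually_ne_atTop 0] with k hk
    exact (pqDensity_lcm_eq_growthFactor hp hq hcard hk).symm
  · exact Eventually.of_forall fun k => (mul_assoc _ _ _).symm

end GammaAsymptotics

/-! ### Asymptotics of the numbers of hypermaps -/

section Asymptotics

theorem numRooted_le_mul_numIsoClasses (p q : ℕ) {n : ℕ} (hn : n ≠ 0) :
    numRooted p q n ≤ n * numIsoClasses p q n := by
  rw [numRooted_eq p q hn, mul_numIsoClasses p q hn]
  refine numSubgroups_mono ?_ hn
  rintro K ⟨hA, hT⟩
  refine ⟨hA, 1, ?_⟩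
  have := (mem_ordSet_genT.mp hT 1).mpr dvd_rfl
  simpa using this

theorem mul_numIsoClasses_le_sum (p q : ℕ) {n : ℕ} (hn : n ≠ 0) :
    n * numIsoClasses p q n ≤ ∑ i ∈ n.divisors, numSubgroups (admSetT (pqOrders p q) i) n := by
  rw [mul_numIsoClasses p q hn, ← numSubgroups_admSet_eq_sum _ hn]
  exact numSubgroups_mono Set.inter_subset_left hn

theorem cast_numSubgroups_le {p q n : ℕ} (i : ℕ) (hn : n ≠ 0) :
    (numSubgroups (admSetT (pqOrders p q) i) n : ℝ)
      ≤ n * (actDensity (admSetT (pqOrders p q) i) n : ℝ) := by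
  have h := numSubgroups_le (conjClosed_admSetT (pqOrders p q) i) hn
  have h2 : ((numSubgroups (admSetT (pqOrders p q) i) n : ℚ) : ℝ)
      ≤ ((n * actDensity (admSetT (pqOrders p q) i) n : ℚ) : ℝ) := Rat.cast_le.mpr h
  push_cast at h2
  exact h2

theorem numIsoClasses_eq_zero {p q n : ℕ} (hp : p ≠ 0) (hq : q ≠ 0) (hn : ¬ p.lcm q ∣ n) :
    numIsoClasses p q n = 0 := by
  have hn0 : n ≠ 0 := by rintro rfl; exact hn (dvd_zero _)
  have h := mul_numIsoClasses_le_sum p q hn0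
  rw [Finset.sum_eq_zero] at h
  · simpa [hn0] using h
  · intro i _
    have h1 : numActs (admSetT (pqOrders p q) i) n = 0 := by
      by_contra h
      exact hn (Nat.lcm_dvd (dvd_of_numActs_ne_zero h (j := false) hp)
        (dvd_of_numActs_ne_zero h (j := true) hq))
    have h2 := cast_numSubgroups_le (p := p) (q := q) i hn0
    rw [actDensity, h1] at h2
    simp only [Nat.cast_zero, zero_div, Rat.cast_zero, mul_zero] at h2
    exact_mod_cast le_antisymm h2 (Nat.cast_nonneg _)

/-- Hypermaps with a nontrivial automorphism are negligible. -/
theorem numIsoClasses_sub_le {p q n : ℕ} (hp : 2 ≤ p) (hq : 2 ≤ q) (hpq : 6 ≤ p * q)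
    (hn : n ≠ 0) :
    (numIsoClasses p q n : ℝ) - 1 / (n : ℝ) * numRooted p q n
      ≤ (n : ℝ) * (((2 * (p * q) : ℕ) : ℝ) ^ n /
        (((n + 1) / 2).factorial : ℝ) ^ hyperExp p q) * pqDensity p q n := by
  have hn' : (0 : ℝ) < n := by exact_mod_cast Nat.pos_of_ne_zero hn
  have hf0 := pqDensity_nonneg p q n
  set B := ((2 * (p * q) : ℕ) : ℝ) ^ n / (((n + 1) / 2).factorial : ℝ) ^ hyperExp p q with hB
  have hB0 : 0 ≤ B := by positivity
  by_cases hd : p.lcm q ∣ n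
  · have h1 : (1 : ℕ) ∈ n.divisors := Nat.one_mem_divisors.mpr hn
    have h2 : ((n * numIsoClasses p q n : ℕ) : ℝ) ≤ numRooted p q n +
        ∑ i ∈ n.divisors.erase 1, (numSubgroups (admSetT (pqOrders p q) i) n : ℝ) := by
      have h := mul_numIsoClasses_le_sum p q hn
      rw [← Finset.add_sum_erase _ _ h1, ← numRooted_eq p q hn] at h
      exact_mod_cast h
    have h3 : ∑ i ∈ n.divisors.erase 1, (numSubgroups (admSetT (pqOrders p q) i) n : ℝ)
        ≤ ∑ _i ∈ n.divisors.erase 1, (n : ℝ) * (B * pqDensity p q n) := by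
      refine Finset.sum_le_sum fun i hi => ?_
      obtain ⟨hi1, hi⟩ := Finset.mem_erase.mp hi
      have hi0 := Nat.pos_of_mem_divisors hi
      refine (cast_numSubgroups_le i hn).trans (mul_le_mul_of_nonneg_left ?_ hn'.le)
      exact actDensity_pq_le_mul hp hq hpq (by omega) (Nat.dvd_of_mem_divisors hi) hd
    rw [Finset.sum_const, nsmul_eq_mul] at h3
    have h4 : ((n.divisors.erase 1).card : ℝ) ≤ n := by
      exact_mod_cast (Finset.card_erase_le).trans (Nat.card_divisors_le_self n)
    have h5 : ((n.divisors.erase 1).card : ℝ) * ((n : ℝ) * (B * pqDensity p q n))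
        ≤ n * ((n : ℝ) * (B * pqDensity p q n)) :=
      mul_le_mul_of_nonneg_right h4 (by positivity)
    have h6 := h2.trans (add_le_add_right (h3.trans h5) _)
    push_cast at h6
    rw [← mul_le_mul_iff_right₀ hn', mul_sub, ← mul_assoc, mul_one_div_cancel hn'.ne', one_mul]
    linarith
  · rw [numIsoClasses_eq_zero (by omega) (by omega) hd]
    have : (0 : ℝ) ≤ 1 / (n : ℝ) * numRooted p q n := by positivity
    have h0 : 0 ≤ (n : ℝ) * B * pqDensity p q n := by positivity
    push_cast
    linarith

theorem numRooted_div_le {p q n : ℕ} (hn : n ≠ 0) :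
    1 / (n : ℝ) * numRooted p q n ≤ pqDensity p q n := by
  have hn' : (0 : ℝ) < n := by exact_mod_cast Nat.pos_of_ne_zero hn
  rw [numRooted_eq p q hn, one_div, inv_mul_le_iff₀ hn']
  exact cast_numSubgroups_le 1 hn

/-- The number of disconnected pairs of permutations is bounded by a convolution. -/
theorem pqDensity_sub_le {p q n : ℕ} (hn : n ≠ 0) :
    pqDensity p q n - 1 / (n : ℝ) * numRooted p q n
      ≤ ∑ j ∈ Finset.Ico 1 n, pqDensity p q j * pqDensity p q (n - j) := by
  have hn' : (0 : ℝ) < n := by exact_mod_cast Nat.pos_of_ne_zero hn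
  have h0 := congrArg (Rat.cast : ℚ → ℝ)
    (mul_actDensity (conjClosed_admSetT (pqOrders p q) 1) n)
  push_cast at h0
  have h : (n : ℝ) * pqDensity p q n = ∑ j ∈ Finset.Icc 1 n,
      (numSubgroups (admSetT (pqOrders p q) 1) j : ℝ) * pqDensity p q (n - j) := h0
  have h1 : pqDensity p q 0 = 1 := by simp [pqDensity, actDensity_zero]
  rw [← Finset.Ico_insert_right (Nat.one_le_iff_ne_zero.mpr hn),
    Finset.sum_insert Finset.right_notMem_Ico, Nat.sub_self, h1, mul_one,
    ← numRooted_eq p q hn] at h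
  have h2 : ∑ j ∈ Finset.Ico 1 n,
      (numSubgroups (admSetT (pqOrders p q) 1) j : ℝ) * pqDensity p q (n - j)
      ≤ ∑ j ∈ Finset.Ico 1 n, (n : ℝ) * (pqDensity p q j * pqDensity p q (n - j)) := by
    refine Finset.sum_le_sum fun j hj => ?_
    rw [Finset.mem_Ico] at hj
    rw [← mul_assoc]
    refine mul_le_mul_of_nonneg_right ?_ (pqDensity_nonneg _ _ _)
    refine (cast_numSubgroups_le 1 (by omega)).trans ?_
    have hjn : (j : ℝ) ≤ n := by exact_mod_cast hj.2.le
    exact mul_le_mul_of_nonneg_right hjn (pqDensity_nonneg p q j)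
  rw [← Finset.mul_sum] at h2
  rw [← mul_le_mul_iff_right₀ hn', mul_sub, ← mul_assoc, mul_one_div_cancel hn'.ne', one_mul]
  linarith

theorem sum_pqDensity_lcm {p q : ℕ} (hp : p ≠ 0) (hq : q ≠ 0) (k : ℕ) :
    ∑ j ∈ Finset.Ico 1 (p.lcm q * k), pqDensity p q j * pqDensity p q (p.lcm q * k - j)
      = ∑ j ∈ Finset.Ico 1 k, pqDensity p q (p.lcm q * j) * pqDensity p q (p.lcm q * (k - j)) := by
  have hl : 0 < p.lcm q := Nat.pos_of_ne_zero (Nat.lcm_ne_zero hp hq)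
  symm
  refine Finset.sum_of_injOn (fun j => p.lcm q * j) ?_ ?_ ?_ ?_
  · intro a _ b _ hab
    exact Nat.eq_of_mul_eq_mul_left hl hab
  · intro j hj
    simp only [Finset.coe_Ico, Set.mem_Ico] at hj ⊢
    exact ⟨Nat.mul_pos hl hj.1, Nat.mul_lt_mul_of_pos_left hj.2 hl⟩
  · intro j hj hj'
    rw [pqDensity_eq_zero hp hq, zero_mul]
    rintro ⟨t, rfl⟩
    rw [Finset.mem_Ico] at hj
    refine hj' ⟨t, ?_, rfl⟩
    simp only [Finset.coe_Ico, Set.mem_Ico]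
    refine ⟨Nat.pos_of_ne_zero ?_, Nat.lt_of_mul_lt_mul_left hj.2⟩
    rintro rfl
    omega
  · intro j _
    rw [Nat.mul_sub]

/-- Most pairs of permutations with cycles of lengths `p` and `q` generate a transitive group. -/
theorem numRooted_isEquivalent {p q : ℕ} (hp : 2 ≤ p) (hq : 2 ≤ q) (hpq : 6 ≤ p * q) :
    (fun n : ℕ => 1 / (n : ℝ) * (numRooted p q n : ℝ)) ~[atTop] fun n => pqDensity p q n := by
  have hp0 : p ≠ 0 := by omega
  have hq0 : q ≠ 0 := by omega
  have hcard := two_le_card_growthIndices hp hq hpq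
  have hl : 0 < p.lcm q := Nat.pos_of_ne_zero (Nat.lcm_ne_zero hp0 hq0)
  obtain ⟨c, hc, hlin⟩ := exists_linear_le_growthRatio hp0 hq0 hcard
  set K : ℝ := 2 * pqDensity p q (p.lcm q * 1) / c + 2 * pqDensity p q (p.lcm q * 2) / c ^ 2
    with hK
  refine IsLittleO.of_bound fun ε hε => ?_
  obtain ⟨m₀, hm₀⟩ := exists_nat_gt (K / ε)
  filter_upwards [eventually_ge_atTop (p.lcm q * (m₀ + 4))] with n hn
  have hn0 : n ≠ 0 := by
    have := Nat.mul_pos hl (Nat.succ_pos (m₀ + 3))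
    intro h
    rw [h] at hn
    exact absurd hn (not_le.mpr this)
  have hle := numRooted_div_le (p := p) (q := q) hn0
  have hf := pqDensity_nonneg p q n
  rw [Pi.sub_apply, Real.norm_eq_abs, Real.norm_eq_abs, abs_of_nonneg hf, abs_sub_comm,
    abs_of_nonneg (sub_nonneg.mpr hle)]
  by_cases hd : p.lcm q ∣ n
  · obtain ⟨k, rfl⟩ := hd
    have hk : m₀ + 4 ≤ k := Nat.le_of_mul_le_mul_left hn hl
    obtain ⟨m, rfl⟩ : ∃ m, k = m + 2 := ⟨k - 2, by omega⟩
    have hm : m₀ + 2 ≤ m := by omega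
    have hm' : (0 : ℝ) < m := by exact_mod_cast (by omega : 0 < m)
    have hconv := sum_convolution_le (g := fun k => pqDensity p q (p.lcm q * k))
      (ρ := growthRatio p q) (pqDensity_lcm_pos hp0 hq0)
      (pqDensity_lcm_succ hp0 hq0 (by omega)) (growthRatio_monotone hp0 hq0 (by omega)) hc hlin
      (m := m) (by omega)
    refine (pqDensity_sub_le hn0).trans ?_
    rw [sum_pqDensity_lcm hp0 hq0]
    refine hconv.trans (mul_le_mul_of_nonneg_right ?_ hf)
    rw [div_le_iff₀ hm']
    have h1 : K / ε ≤ m := hm₀.le.trans (by exact_mod_cast (by omega : m₀ ≤ m))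
    rw [div_le_iff₀ hε] at h1
    linarith
  · rw [pqDensity_eq_zero hp0 hq0 hd] at hle ⊢
    have : (0 : ℝ) ≤ 1 / (n : ℝ) * numRooted p q n := by positivity
    linarith

/-- Most hypermaps have no nontrivial automorphism. -/
theorem numIsoClasses_isEquivalent {p q : ℕ} (hp : 2 ≤ p) (hq : 2 ≤ q) (hpq : 6 ≤ p * q) :
    (fun n : ℕ => (numIsoClasses p q n : ℝ)) ~[atTop]
      fun n : ℕ => 1 / (n : ℝ) * (numRooted p q n : ℝ) := by
  have hequiv := numRooted_isEquivalent hp hq hpq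
  have ho : ((fun n : ℕ => (numIsoClasses p q n : ℝ)) -
      fun n : ℕ => 1 / (n : ℝ) * (numRooted p q n : ℝ)) =o[atTop] fun n => pqDensity p q n := by
    have hlim := tendsto_mul_pow_div_factorial_rpow (hyperExp_pos hp hq hpq) (2 * (p * q))
    refine IsLittleO.of_bound fun ε hε => ?_
    filter_upwards [eventually_ne_atTop 0, hlim.eventually (gt_mem_nhds hε)] with n hn hδ
    have hf := pqDensity_nonneg p q n
    have hn' : (0 : ℝ) < n := by exact_mod_cast Nat.pos_of_ne_zero hn
    have h1 : 1 / (n : ℝ) * (numRooted p q n : ℝ) ≤ numIsoClasses p q n := by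
      rw [one_div, inv_mul_le_iff₀ hn']
      exact_mod_cast numRooted_le_mul_numIsoClasses p q hn
    rw [Pi.sub_apply, Real.norm_eq_abs, Real.norm_eq_abs, abs_of_nonneg hf,
      abs_of_nonneg (sub_nonneg.mpr h1)]
    exact (numIsoClasses_sub_le hp hq hpq hn).trans (mul_le_mul_of_nonneg_right hδ.le hf)
  exact ho.trans_isBigO hequiv.symm.isBigO

end Asymptotics

theorem mainTheorem7 (p q : ℕ) (hp : 2 ≤ p) (hq : 2 ≤ q) :
    -- (i) the formula for the growth series
    ((∀ k : ℕ+, Summable fun n : ℕ+ =>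
        (PowerSeries.logOf (hadamard n (cycleFactor p n) (cycleFactor q n))).subst
          ((PowerSeries.X : ℚ⟦X⟧) ^ ((n : ℕ) * k))) ∧
      HasSum
        (fun k : ℕ+ => PowerSeries.C ((ArithmeticFunction.moebius (k : ℕ) : ℚ) / (k : ℕ)) *
          ∑' n : ℕ+,
            (PowerSeries.logOf (hadamard n (cycleFactor p n) (cycleFactor q n))).subst
              ((PowerSeries.X : ℚ⟦X⟧) ^ ((n : ℕ) * k)))
        (isoSeries p q)) ∧
    -- (ii) the asymptotics of the non-zero coefficients
    (∀ n : ℕ, numIsoClasses p q n ≠ 0 → p.lcm q ∣ n) ∧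
    (6 ≤ p * q →
      ((fun n : ℕ => (numIsoClasses p q n : ℝ)) ~[atTop]
        fun n : ℕ => 1 / (n : ℝ) * (numRooted p q n : ℝ)) ∧
      0 < growthC p q ∧
      ((fun k : ℕ => (numIsoClasses p q (p.lcm q * k) : ℝ)) ~[atTop]
        fun k : ℕ => growthC p q * (k : ℝ) ^ ((growthN p q - 1) * k - growthC0 p q) *
          Real.exp (growthC1 p q * k))) := by
  have hp0 : p ≠ 0 := by omega
  have hq0 : q ≠ 0 := by omega
  refine ⟨⟨fun k => (hasSum_logOf_subst hp0 hq0 k).summable, hasSum_isoSeries hp0 hq0⟩,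
    fun n hn => ?_, fun hpq => ⟨numIsoClasses_isEquivalent hp hq hpq, growthC_pos hp0 hq0, ?_⟩⟩
  · by_contra hd
    exact hn (numIsoClasses_eq_zero hp0 hq0 hd)
  · have hl : 0 < p.lcm q := Nat.pos_of_ne_zero (Nat.lcm_ne_zero hp0 hq0)
    have htend : Tendsto (fun k : ℕ => p.lcm q * k) atTop atTop :=
      tendsto_id.const_mul_atTop' hl
    have h1 := ((numIsoClasses_isEquivalent hp hq hpq).trans
      (numRooted_isEquivalent hp hq hpq)).comp_tendsto htend
    have hcard := two_le_card_growthIndices hp hq hpq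
    exact h1.trans (pqDensity_lcm_isEquivalent hp0 hq0 (by omega))
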